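/- Let $n\ge 1$, let $\mathbb B_n$ be the open unit ball of $\mathbb C^n$ and $dv$ the Lebesgue measure on $\mathbb B_n$ normalized so that $v(\mathbb B_n)=1$. For $0<p<\infty$ and $\alpha>-1$ let the Bergman space $A^p_\alpha$ consist of the holomorphic functions $f$ on $\mathbb B_n$ with $$\|f\|_{A^p_\alpha}^p:=\int_{\mathbb B_n}|f(z)|^p(1-|z|^2)^\alpha\,dv(z)<\infty .$$ Let $\alpha,\beta>-1$, $0<p,q<\infty$, let $\varphi:\mathbb C\to\mathbb C$ be an arbitrary function, and put $S_\varphi f=\varphi\circ f$. Then $S_\varphi$ maps $A^p_\alpha$ into $A^q_\beta$ if and only if $\varphi$ is a polynomial whose degree $N$ (with $N=0$ if $\varphi\equiv 0$) satisfies (i) $N\le \dfrac{p(n+1+\beta)}{q(n+1+\alpha)}$ in the case $\alpha\le\beta$; (ii) $N<\dfrac{p(\beta+1)}{q(\alpha+1)}$ in the case $\alpha>\beta$. Moreover, if $S_\varphi$ maps $A^p_\alpha$ into $A^q_\beta$, then $S_\varphi:A^p_\alpha\to A^q_\beta$ is bounded (it maps bounded sets to bounded sets) and continuous with respect to the (quasi-)norms.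 -/

import Mathlib

open MeasureTheory Set

noncomputable section

/-- Complex Euclidean space `ℂⁿ`, with the norm `|z|² = ∑ |z_j|²`. -/
abbrev Cn (n : ℕ) : Type := EuclideanSpace ℂ (Fin n)

/-- The open unit ball `𝔹_n` of `ℂⁿ`. -/
def unitBall (n : ℕ) : Set (Cn n) := Metric.ball 0 1

/-- Lebesgue measure on `ℂⁿ`: the product of the Lebesgue measures on the `n` factors `ℂ`. -/
def lebesgueCn (n : ℕ) : Measure (Cn n) :=
  (volume : Measure (Fin n → ℂ)).map (WithLp.toLp 2)

/-- Normalized Lebesgue measure `dv` on the unit ball, `v(𝔹_n) = 1`. -/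
def ballMeasure (n : ℕ) : Measure (Cn n) :=
  (lebesgueCn n (unitBall n))⁻¹ • (lebesgueCn n).restrict (unitBall n)

/-- The weighted measure `dv_α(z) = (1 - |z|²)^α dv(z)` on the unit ball. -/
def weightedMeasure (n : ℕ) (α : ℝ) : Measure (Cn n) :=
  (ballMeasure n).withDensity fun z => ENNReal.ofReal ((1 - ‖z‖ ^ 2) ^ α)

/-- The Bergman space `A^p_α`: the functions `f` holomorphic on the unit ball with
`∫ |f|^p dv_α < ∞`. Functions on the ball are represented by functions on `ℂⁿ` whose values
outside the ball are irrelevant (`dv_α` gives no mass to the complement of the ball). -/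
def bergmanSpace (n : ℕ) (p α : ℝ) : Set (Cn n → ℂ) :=
  {f | DifferentiableOn ℂ f (unitBall n) ∧ MemLp f (ENNReal.ofReal p) (weightedMeasure n α)}

/-- The (quasi-)norm `‖f‖ = (∫ |f|^p dv_α)^{1/p}` of the Bergman space `A^p_α`. -/
def bergmanNorm (n : ℕ) (p α : ℝ) (f : Cn n → ℂ) : ℝ :=
  (eLpNorm f (ENNReal.ofReal p) (weightedMeasure n α)).toReal

/-- The superposition operator `S_φ f = φ ∘ f`. -/
def superposition {n : ℕ} (φ : ℂ → ℂ) (f : Cn n → ℂ) : Cn n → ℂ := fun z => φ (f z)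

/-- A (not necessarily linear) operator `S` from `A^p_α` to `A^q_β` is bounded if it maps bounded
sets to bounded sets. -/
def IsBoundedBergman (n : ℕ) (p α q β : ℝ) (S : (Cn n → ℂ) → (Cn n → ℂ)) : Prop :=
  ∀ R : ℝ, ∃ C : ℝ, ∀ f ∈ bergmanSpace n p α,
    bergmanNorm n p α f ≤ R → bergmanNorm n q β (S f) ≤ C

/-- A (not necessarily linear) operator `S` from `A^p_α` to `A^q_β` is continuous, for the
topologies given by the (quasi-)norms. -/
def IsContinuousBergman (n : ℕ) (p α q β : ℝ) (S : (Cn n → ℂ) → (Cn n → ℂ)) : Prop :=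
  ∀ f ∈ bergmanSpace n p α, ∀ ε > (0 : ℝ), ∃ δ > (0 : ℝ), ∀ g ∈ bergmanSpace n p α,
    bergmanNorm n p α (g - f) < δ → bergmanNorm n q β (S g - S f) < ε

end

/-!
# Superposition operators between Bergman spaces of the ball

Everything is reduced to the question for which exponents `r` the space `A^p_α` is contained in
`A^r_β`. A polynomial of degree `N` satisfies `|P(u)| ≤ C (1 + |u|)^N` and, if `N ≥ 1`,
`|u|^N ≤ C (1 + |P(u)|)`; so superposition by `P` maps `A^p_α` into `A^q_β` exactly when
`A^p_α ⊆ A^(Nq)_β`. Boundedness and continuity follow from the norm estimate of the embedding and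
the elementary inequality `|P(v) - P(u)| ≤ ε (1 + |u|)^N + C_ε |v - u|^N`.

*The embedding* (`lintegral_rpow_le`). For `r ≥ p` the pointwise bound
`|f(z)|^p (1 - |z|²)^(n+1+α) ≤ C ‖f‖^p` (`enorm_rpow_mul_weight_le`) is applied to the factor
`|f|^(r-p)` of `|f|^r`. For `r < p` it is Hölder's inequality, and the condition
`r (α + 1) < p (β + 1)` says that the remaining power of the weight is integrable.

*The symbol is a polynomial* (`exists_polynomial_of_mapsTo`). Composition with linear functions
shows that `φ` is entire. The functions `u (1 - z₀)^(-s)` with `|u| = 1` lie in `A^p_α` for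
`s p < n + 1 + α`. Comparing the growth of their images near the singularity with the pointwise
bound in `A^q_β` shows that `φ` grows at most like a power of `|w|` whose exponent is any number
above `p (n + 1 + β) / (q (n + 1 + α))`, and Liouville's theorem applies.

*Sharpness for `β < α`* (`exists_mem_bergmanSpace_lintegral_eq_top`). If `r < p` and
`p (β + 1) ≤ r (α + 1)`, then `A^p_α` is not contained in `A^r_β`. A radial function `H(|z|²)` whose
Taylor coefficients are nonnegative, with `H^(p/2)` integrable for the weight `α` but `H^(r/2)` not
integrable for the weight `β`, is obtained by adding up powers `(1 - |z|²)^(-t_j)` with `t_j`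
increasing to the critical exponent (`exists_radial_profile`). Independent Gaussian multiples of the
monomials, normalized so that the sum of their squared moduli is `H(|z|²)`, give a random power
series `f` for which `f(z)` has variance `H(|z|²)` at each point `z`. All moments of a Gaussian
variable are comparable with powers of its variance, and this remains true on events of large
probability, so `f` is almost surely in `A^p_α` but not almost surely in `A^r_β`.
-/

noncomputable section

variable {n : ℕ}

/-! ### Lebesgue measure on the ball and its radial weights -/

instance isAddHaarMeasure_lebesgueCn (n : ℕ) : (lebesgueCn n).IsAddHaarMeasure :=
  (PiLp.continuousLinearEquiv 2 ℝ (fun _ : Fin n => ℂ)).symm.isAddHaarMeasure_map volume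

lemma finrank_Cn (n : ℕ) : Module.finrank ℝ (Cn n) = 2 * n := by
  rw [(WithLp.linearEquiv 2 ℝ (Fin n → ℂ)).finrank_eq, Module.finrank_pi_fintype]
  simp [Complex.finrank_real_complex, mul_comm]

lemma measurableSet_unitBall : MeasurableSet (unitBall n) := Metric.isOpen_ball.measurableSet

lemma isOpen_unitBall : IsOpen (unitBall n) := Metric.isOpen_ball

lemma mem_unitBall {z : Cn n} : z ∈ unitBall n ↔ ‖z‖ < 1 := by simp [unitBall]

lemma one_sub_norm_sq_pos {z : Cn n} (hz : z ∈ unitBall n) : 0 < 1 - ‖z‖ ^ 2 := by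
  rw [mem_unitBall] at hz
  nlinarith [norm_nonneg z]

lemma lebesgueCn_unitBall_ne_zero : lebesgueCn n (unitBall n) ≠ 0 :=
  (Metric.measure_ball_pos _ _ one_pos).ne'

lemma lebesgueCn_unitBall_ne_top : lebesgueCn n (unitBall n) ≠ ⊤ :=
  measure_ball_lt_top.ne

/-- A unitary map multiplies Haar measure by a constant, and the constant is `1` because the unit
ball is mapped onto itself. -/
lemma measurePreserving_linearIsometryEquiv (U : Cn n ≃ₗᵢ[ℂ] Cn n) :
    MeasurePreserving U (lebesgueCn n) (lebesgueCn n) := by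
  refine ⟨U.continuous.measurable, ?_⟩
  let V : Cn n ≃L[ℝ] Cn n := (U.toContinuousLinearEquiv).restrictScalars ℝ
  have hH : (Measure.map U (lebesgueCn n)).IsAddHaarMeasure := V.isAddHaarMeasure_map (lebesgueCn n)
  have h1 := Measure.isAddLeftInvariant_eq_smul (Measure.map U (lebesgueCn n)) (lebesgueCn n)
  set c := Measure.addHaarScalarFactor (Measure.map U (lebesgueCn n)) (lebesgueCn n) with hc
  have h2 : Measure.map U (lebesgueCn n) (unitBall n) = lebesgueCn n (unitBall n) := by
    rw [Measure.map_apply U.continuous.measurable measurableSet_unitBall]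
    congr 1
    ext z
    simp [unitBall]
  have h3 : (c : ENNReal) = 1 := by
    rw [h1, Measure.smul_apply] at h2
    have : (c : ENNReal) * lebesgueCn n (unitBall n) = 1 * lebesgueCn n (unitBall n) := by
      rw [one_mul]; exact h2
    exact (ENNReal.mul_left_inj lebesgueCn_unitBall_ne_zero lebesgueCn_unitBall_ne_top).1 this
  rw [h1]
  have h4 : c = 1 := by exact_mod_cast h3
  rw [h4, one_smul]

instance isProbabilityMeasure_ballMeasure (n : ℕ) : IsProbabilityMeasure (ballMeasure n) := by
  refine ⟨?_⟩
  rw [ballMeasure, Measure.smul_apply, Measure.restrict_apply_univ, smul_eq_mul]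
  exact ENNReal.inv_mul_cancel lebesgueCn_unitBall_ne_zero lebesgueCn_unitBall_ne_top

lemma ae_mem_unitBall (n : ℕ) : ∀ᵐ z ∂ballMeasure n, z ∈ unitBall n :=
  Measure.ae_smul_measure (ae_restrict_mem measurableSet_unitBall) _

lemma lintegral_ballMeasure (F : Cn n → ENNReal) :
    ∫⁻ z, F z ∂ballMeasure n =
      (lebesgueCn n (unitBall n))⁻¹ * ∫⁻ z in unitBall n, F z ∂lebesgueCn n := by
  rw [ballMeasure, lintegral_smul_measure, smul_eq_mul]

lemma measurable_weight (α : ℝ) :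
    Measurable fun z : Cn n => ENNReal.ofReal ((1 - ‖z‖ ^ 2) ^ α) := by
  fun_prop

lemma lintegral_weightedMeasure (α : ℝ) (F : Cn n → ENNReal) :
    ∫⁻ z, F z ∂weightedMeasure n α =
      ∫⁻ z, ENNReal.ofReal ((1 - ‖z‖ ^ 2) ^ α) * F z ∂ballMeasure n := by
  rw [weightedMeasure, lintegral_withDensity_eq_lintegral_mul_non_measurable _
    (measurable_weight α) (by simp)]
  rfl

lemma ae_weightedMeasure_mem_unitBall (n : ℕ) (α : ℝ) :
    ∀ᵐ z ∂weightedMeasure n α, z ∈ unitBall n :=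
  (withDensity_absolutelyContinuous _ _).ae_le (ae_mem_unitBall n)

instance sFinite_weightedMeasure (n : ℕ) (α : ℝ) : SFinite (weightedMeasure n α) := by
  unfold weightedMeasure; infer_instance

/-- The primitive `-(1 - y²)^η / (2η)` of `y (1 - y²)^(η-1)`. -/
lemma hasDerivAt_radial {η : ℝ} (hη : 0 < η) {x : ℝ} (hx : x ∈ Ioo (0 : ℝ) 1) :
    HasDerivAt (fun y : ℝ => (1 - y ^ 2) ^ η * -(2 * η)⁻¹) (x * (1 - x ^ 2) ^ (η - 1)) x := by
  have h1 : HasDerivAt (fun y : ℝ => 1 - y ^ 2) (-(2 * x)) x := by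
    simpa using (hasDerivAt_pow 2 x).const_sub 1
  have h2 := (h1.rpow_const (p := η) (Or.inl (by nlinarith [hx.1, hx.2]))).mul_const (-(2 * η)⁻¹)
  refine h2.congr_deriv ?_
  have h3 : η * (2 * η)⁻¹ = 1 / 2 := by field_simp
  linear_combination (2 * x * (1 - x ^ 2) ^ (η - 1)) * h3

lemma integrableOn_radial {η a : ℝ} (hη : 0 < η) (ha : 0 ≤ a) :
    IntegrableOn (fun y : ℝ => y * (1 - y ^ 2) ^ (η - 1)) (Ioc a 1) := by
  refine intervalIntegral.integrableOn_deriv_of_nonneg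
    (g := fun y : ℝ => (1 - y ^ 2) ^ η * -(2 * η)⁻¹)
    ?_ (fun x hx => hasDerivAt_radial hη ⟨ha.trans_lt hx.1, hx.2⟩) (fun x hx => ?_)
  · have : Continuous (fun y : ℝ => (1 - y ^ 2) ^ η) :=
      Continuous.rpow_const (by fun_prop) (fun _ => Or.inr hη.le)
    exact (this.mul_const _).continuousOn
  · have h0 : 0 < x := ha.trans_lt hx.1
    have : 0 ≤ 1 - x ^ 2 := by nlinarith [hx.2]
    positivity

lemma integral_radial {η a : ℝ} (hη : 0 < η) (ha : 0 ≤ a) (ha1 : a ≤ 1) :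
    ∫ y in Ioc a 1, y * (1 - y ^ 2) ^ (η - 1) = (1 - a ^ 2) ^ η / (2 * η) := by
  have hc : Continuous (fun y : ℝ => (1 - y ^ 2) ^ η) :=
      Continuous.rpow_const (by fun_prop) (fun _ => Or.inr hη.le)
  rw [← intervalIntegral.integral_of_le ha1,
    intervalIntegral.integral_eq_sub_of_hasDerivAt_of_le ha1
      (f := fun y : ℝ => (1 - y ^ 2) ^ η * -(2 * η)⁻¹) (hc.mul_const _).continuousOn
      (fun x hx => hasDerivAt_radial hη ⟨ha.trans_lt hx.1, hx.2⟩)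
      ((intervalIntegrable_iff_integrableOn_Ioc_of_le ha1).2 (integrableOn_radial hη ha))]
  simp only [one_pow, sub_self, Real.zero_rpow hη.ne']
  ring

lemma integrableOn_radial_pow (m : ℕ) {η : ℝ} (hη : 0 < η) :
    IntegrableOn (fun y : ℝ => y ^ (m + 1) * (1 - y ^ 2) ^ (η - 1)) (Ioo 0 1) := by
  have h := (integrableOn_radial hη le_rfl).mono_set (Ioo_subset_Ioc_self (b := (0 : ℝ)) (a := 1))
  refine Integrable.mono' h (Measurable.aestronglyMeasurable (by fun_prop)) ?_
  filter_upwards [ae_restrict_mem measurableSet_Ioo] with y hy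
  have h1 : 0 ≤ 1 - y ^ 2 := by nlinarith [hy.1, hy.2]
  have h2 : y ^ (m + 1) ≤ y := by
    simpa using pow_le_of_le_one hy.1.le hy.2.le (Nat.succ_ne_zero m)
  have h3 := hy.1.le
  rw [Real.norm_of_nonneg (by positivity)]
  gcongr

/-- Total mass of `dv_(η-1)` in polar coordinates. -/
lemma weightedMeasure_univ (hn : 1 ≤ n) {η : ℝ} (hη : 0 < η) :
    weightedMeasure n (η - 1) univ = ENNReal.ofReal
      (2 * n * ∫ y in Ioo (0 : ℝ) 1, y ^ (2 * n - 1) * (1 - y ^ 2) ^ (η - 1)) := by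
  have : Nonempty (Fin n) := ⟨⟨0, hn⟩⟩
  have : Nontrivial (Cn n) := inferInstance
  obtain ⟨m, hm⟩ : ∃ m, 2 * n - 1 = m + 1 := ⟨2 * n - 2, by omega⟩
  have hint : IntegrableOn (fun z : Cn n => (fun y : ℝ => (1 - y ^ 2) ^ (η - 1)) ‖z‖)
      (Metric.ball 0 1) (lebesgueCn n) := by
    rw [integrableOn_fun_norm_addHaar (lebesgueCn n) (f := fun y : ℝ => (1 - y ^ 2) ^ (η - 1)),
      finrank_Cn, hm]
    exact integrableOn_radial_pow m hη
  rw [← lintegral_one, lintegral_weightedMeasure, lintegral_ballMeasure]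
  simp only [mul_one]
  rw [unitBall, ← ofReal_integral_eq_lintegral_ofReal hint]
  · rw [← integral_indicator Metric.isOpen_ball.measurableSet]
    have h1 : ∀ z : Cn n, (Metric.ball (0 : Cn n) 1).indicator
        (fun z : Cn n => (fun y : ℝ => (1 - y ^ 2) ^ (η - 1)) ‖z‖) z =
        (Iio (1 : ℝ)).indicator (fun y : ℝ => (1 - y ^ 2) ^ (η - 1)) ‖z‖ := by
      intro z
      simp [indicator]
    simp_rw [h1]
    rw [integral_fun_norm_addHaar (lebesgueCn n), finrank_Cn]
    have h2 : ∫ y in Ioi (0 : ℝ), y ^ (2 * n - 1) • (Iio (1 : ℝ)).indicator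
        (fun y : ℝ => (1 - y ^ 2) ^ (η - 1)) y =
        ∫ y in Ioo (0 : ℝ) 1, y ^ (2 * n - 1) * (1 - y ^ 2) ^ (η - 1) := by
      rw [← Ioi_inter_Iio, ← setIntegral_indicator measurableSet_Iio]
      congr 1
      ext y
      by_cases hy : y < 1 <;> simp [hy]
    rw [h2, nsmul_eq_mul, smul_eq_mul, ← mul_assoc, mul_right_comm, ENNReal.ofReal_mul']
    · rw [Measure.real, ← unitBall, ENNReal.ofReal_toReal lebesgueCn_unitBall_ne_top, mul_comm,
        mul_assoc,
        ENNReal.mul_inv_cancel lebesgueCn_unitBall_ne_zero lebesgueCn_unitBall_ne_top, mul_one]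
      push_cast
      rfl
    · positivity
  · filter_upwards [ae_restrict_mem Metric.isOpen_ball.measurableSet] with z hz
    have := one_sub_norm_sq_pos hz
    simp only [Pi.zero_apply]; positivity

/-- The mass of `dv_(η-1)` is of order `1/η` as `η → 0`: upper bound. -/
lemma weightedMeasure_univ_le (hn : 1 ≤ n) {η : ℝ} (hη : 0 < η) :
    weightedMeasure n (η - 1) univ ≤ ENNReal.ofReal (n / η) := by
  rw [weightedMeasure_univ hn hη]
  refine ENNReal.ofReal_le_ofReal ?_
  obtain ⟨m, hm⟩ : ∃ m, 2 * n - 1 = m + 1 := ⟨2 * n - 2, by omega⟩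
  have h1 : ∫ y in Ioo (0 : ℝ) 1, y ^ (2 * n - 1) * (1 - y ^ 2) ^ (η - 1) ≤ 1 / (2 * η) := by
    have h2 := integral_radial hη le_rfl zero_le_one
    rw [integral_Ioc_eq_integral_Ioo] at h2
    simp only [ne_eq, OfNat.ofNat_ne_zero, not_false_eq_true, zero_pow, sub_zero,
      Real.one_rpow] at h2
    rw [← h2, hm]
    refine setIntegral_mono_on (integrableOn_radial_pow m hη)
      ((integrableOn_radial hη le_rfl).mono_set Ioo_subset_Ioc_self) measurableSet_Ioo
      (fun y hy => ?_)
    have h3 : 0 ≤ 1 - y ^ 2 := by nlinarith [hy.1, hy.2]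
    have h4 : y ^ (m + 1) ≤ y := by
      simpa using pow_le_of_le_one hy.1.le hy.2.le (Nat.succ_ne_zero m)
    gcongr
  calc 2 * n * ∫ y in Ioo (0 : ℝ) 1, y ^ (2 * n - 1) * (1 - y ^ 2) ^ (η - 1)
      ≤ 2 * n * (1 / (2 * η)) := by gcongr
    _ = n / η := by field_simp

/-- The mass of `dv_(η-1)` is of order `1/η` as `η → 0`: lower bound. -/
lemma le_weightedMeasure_univ (hn : 1 ≤ n) : ∃ c : ℝ, 0 < c ∧ ∀ η : ℝ, 0 < η → η ≤ 1 →
    ENNReal.ofReal (c / η) ≤ weightedMeasure n (η - 1) univ := by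
  refine ⟨n * (1 / 2) ^ (2 * n - 2) * (3 / 4), by positivity, fun η hη hη1 => ?_⟩
  rw [weightedMeasure_univ hn hη]
  refine ENNReal.ofReal_le_ofReal ?_
  obtain ⟨m, hm⟩ : ∃ m, 2 * n - 1 = m + 1 := ⟨2 * n - 2, by omega⟩
  have hm' : 2 * n - 2 = m := by omega
  rw [hm, hm']
  have h1 : (1 / 2) ^ m * ((3 / 4) / (2 * η)) ≤
      ∫ y in Ioo (0 : ℝ) 1, y ^ (m + 1) * (1 - y ^ 2) ^ (η - 1) := by
    have h2 := integral_radial hη (a := 1 / 2) (by norm_num) (by norm_num)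
    rw [integral_Ioc_eq_integral_Ioo] at h2
    have h5 : (3 / 4 : ℝ) ≤ (1 - (1 / 2) ^ 2) ^ η := by
      have := Real.rpow_le_rpow_of_exponent_ge (x := 3 / 4) (by norm_num) (by norm_num) hη1
      norm_num at this ⊢
      exact this
    have hsub : Ioo (1 / 2 : ℝ) 1 ⊆ Ioo 0 1 := Ioo_subset_Ioo (by norm_num) le_rfl
    calc (1 / 2) ^ m * ((3 / 4) / (2 * η))
        ≤ (1 / 2) ^ m * ((1 - (1 / 2) ^ 2) ^ η / (2 * η)) := by gcongr
      _ = ∫ y in Ioo (1 / 2 : ℝ) 1, (1 / 2) ^ m * (y * (1 - y ^ 2) ^ (η - 1)) := by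
          rw [integral_const_mul, h2]
      _ ≤ ∫ y in Ioo (1 / 2 : ℝ) 1, y ^ (m + 1) * (1 - y ^ 2) ^ (η - 1) := by
          refine setIntegral_mono_on (((integrableOn_radial hη (by norm_num)).mono_set
            Ioo_subset_Ioc_self).const_mul _)
            ((integrableOn_radial_pow m hη).mono_set hsub) measurableSet_Ioo (fun y hy => ?_)
          have h3 : 0 ≤ 1 - y ^ 2 := by nlinarith [hy.1, hy.2]
          have h4 := hy.1.le
          have h6 : 0 ≤ y := by linarith [hy.1]
          rw [pow_succ y m, mul_assoc]
          gcongr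
      _ ≤ _ := by
          refine setIntegral_mono_set (integrableOn_radial_pow m hη) ?_ hsub.eventuallyLE
          filter_upwards [ae_restrict_mem measurableSet_Ioo] with y hy
          have h3 : 0 ≤ 1 - y ^ 2 := by nlinarith [hy.1, hy.2]
          have h6 := hy.1.le
          simp only [Pi.zero_apply]
          positivity
  calc n * (1 / 2 : ℝ) ^ m * (3 / 4) / η = 2 * n * ((1 / 2) ^ m * ((3 / 4) / (2 * η))) := by
        field_simp
    _ ≤ _ := by gcongr

lemma isFiniteMeasure_weightedMeasure (hn : 1 ≤ n) {α : ℝ} (hα : -1 < α) :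
    IsFiniteMeasure (weightedMeasure n α) := by
  refine ⟨?_⟩
  have := weightedMeasure_univ_le hn (η := α + 1) (by linarith)
  rw [add_sub_cancel_right] at this
  exact this.trans_lt ENNReal.ofReal_lt_top

/-! ### Growth of Bergman functions -/

open Metric Real Filter in
/-- `|g|^p` satisfies the sub-mean value property on the unit circle: by Jensen's formula `log |g|`
does, and the exponential function is convex. -/
lemma norm_rpow_le_circleAverage {g : ℂ → ℂ} (hg : AnalyticOnNhd ℂ g (closedBall 0 1)) {p : ℝ}
    (hp : 0 < p) : ‖g 0‖ ^ p ≤ circleAverage (fun z => ‖g z‖ ^ p) 0 1 := by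
  rcases eq_or_ne (g 0) 0 with h0 | h0
  · rw [h0, norm_zero, zero_rpow hp.ne']
    exact circleAverage_nonneg_of_nonneg fun x _ => by positivity
  have hg' : AnalyticOnNhd ℂ g (closedBall 0 |(1 : ℝ)|) := by simpa using hg
  have hsub : sphere (0 : ℂ) |(1 : ℝ)| ⊆ closedBall 0 |(1 : ℝ)| := sphere_subset_closedBall
  have hlog : CircleIntegrable (fun z => log ‖g z‖) 0 1 :=
    MeromorphicOn.circleIntegrable_log_norm (hg'.mono hsub).meromorphicOn
  set A := circleAverage (fun z => log ‖g z‖) 0 1 with hA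
  have hjensen : log ‖g 0‖ ≤ A := by
    rw [hA, AnalyticOnNhd.circleAverage_log_norm one_ne_zero hg' h0]
    have : 0 ≤ ∑ᶠ u, (MeromorphicOn.divisor g (closedBall 0 |(1 : ℝ)|) u : ℝ) *
        log (1 * ‖0 - u‖⁻¹) := by
      refine finsum_nonneg fun u => ?_
      by_cases hu : u ∈ closedBall (0 : ℂ) |(1 : ℝ)|
      · have h1 : 0 ≤ MeromorphicOn.divisor g (closedBall 0 |(1 : ℝ)|) u :=
          MeromorphicOn.AnalyticOnNhd.divisor_nonneg hg' u
        have h2 : (0 : ℝ) ≤ (MeromorphicOn.divisor g (closedBall 0 |(1 : ℝ)|) u : ℝ) := by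
          exact_mod_cast h1
        refine mul_nonneg h2 ?_
        simp only [abs_one, mem_closedBall, dist_zero_right] at hu
        rw [zero_sub, norm_neg, one_mul, log_inv]
        linarith [log_nonpos (norm_nonneg u) hu]
      · rw [Function.locallyFinsuppWithin.apply_eq_zero_of_notMem _ hu]
        simp
    linarith
  have hne : ∀ᶠ z in codiscreteWithin (sphere (0 : ℂ) |(1 : ℝ)|), g z ≠ 0 := by
    refine codiscreteWithin_mono hsub ?_
    exact hg'.preimage_zero_mem_codiscreteWithin h0 (by simp)
      ⟨⟨0, by simp⟩, (convex_closedBall 0 _).isPreconnected⟩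
  have hcongr : (fun z => ‖g z‖ ^ p) =ᶠ[codiscreteWithin (sphere (0 : ℂ) |(1 : ℝ)|)]
      fun z => exp (p * log ‖g z‖) := by
    filter_upwards [hne] with z hz
    rw [rpow_def_of_pos (norm_pos_iff.2 hz), mul_comm]
  have hint : CircleIntegrable (fun z => ‖g z‖ ^ p) 0 1 := by
    refine ContinuousOn.circleIntegrable zero_le_one ?_
    have : ContinuousOn g (sphere 0 1) := (hg.continuousOn).mono sphere_subset_closedBall
    exact this.norm.rpow_const fun _ _ => Or.inr hp.le
  have hint' : CircleIntegrable (fun z => exp (p * log ‖g z‖)) 0 1 :=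
    CircleIntegrable.congr_codiscreteWithin hcongr hint
  have hlin : CircleIntegrable (fun z => exp (p * A) * p * log ‖g z‖) 0 1 := hlog.const_mul _
  rw [circleAverage_congr_codiscreteWithin hcongr one_ne_zero]
  -- the tangent line of `exp` at `p * A`
  calc ‖g 0‖ ^ p = exp (p * log ‖g 0‖) := by
        rw [rpow_def_of_pos (norm_pos_iff.2 h0), mul_comm]
    _ ≤ exp (p * A) := by gcongr
    _ = circleAverage (fun z => exp (p * A) * p * log ‖g z‖ + exp (p * A) * (1 - p * A)) 0 1 := by
        rw [circleAverage_fun_add hlin (circleIntegrable_const _ _ _), circleAverage_const]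
        have := circleAverage_fun_smul (f := fun z => log ‖g z‖) (a := exp (p * A) * p)
          (c := 0) (R := 1)
        simp only [smul_eq_mul] at this
        rw [this, ← hA]
        ring
    _ ≤ _ := by
        refine circleAverage_mono (hlin.add (circleIntegrable_const _ _ _)) hint' fun z _ => ?_
        have := add_one_le_exp (p * log ‖g z‖ - p * A)
        have h2 : exp (p * log ‖g z‖) = exp (p * A) * exp (p * log ‖g z‖ - p * A) := by
          rw [← exp_add]; ring_nf
        rw [h2]
        have h3 := mul_le_mul_of_nonneg_left this (exp_pos (p * A)).le
        linarith

open Real in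
lemma enorm_rpow_le_lintegral_circle {g : ℂ → ℂ} (hg : AnalyticOnNhd ℂ g (Metric.closedBall 0 1))
    {p : ℝ} (hp : 0 < p) : ENNReal.ofReal (2 * π) * ‖g 0‖ₑ ^ p ≤
      ∫⁻ θ in Ioc 0 (2 * π), ‖g (circleMap 0 1 θ)‖ₑ ^ p := by
  have h1 := norm_rpow_le_circleAverage hg hp
  have hcont : Continuous fun θ : ℝ => ‖g (circleMap 0 1 θ)‖ ^ p := by
    have h2 : Continuous fun θ : ℝ => g (circleMap 0 1 θ) :=
      hg.continuousOn.comp_continuous (continuous_circleMap 0 1) fun θ => by simp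
    exact h2.norm.rpow_const fun _ => Or.inr hp.le
  have h3 : ∀ z : ℂ, ‖z‖ₑ ^ p = ENNReal.ofReal (‖z‖ ^ p) := fun z => by
    rw [← ofReal_norm, ENNReal.ofReal_rpow_of_nonneg (norm_nonneg _) hp.le]
  simp_rw [h3]
  rw [← ofReal_integral_eq_lintegral_ofReal, ← ENNReal.ofReal_mul (by positivity)]
  · refine ENNReal.ofReal_le_ofReal ?_
    rw [circleAverage_def, intervalIntegral.integral_of_le (by positivity), smul_eq_mul] at h1
    calc 2 * π * ‖g 0‖ ^ p ≤ 2 * π * ((2 * π)⁻¹ * _) := by gcongr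
      _ = _ := by field_simp
  · exact (hcont.integrableOn_Icc).mono_set Ioc_subset_Icc_self
  · exact Filter.Eventually.of_forall fun θ => by positivity

lemma measurable_indicator_unitBall {f : Cn n → ℂ} (hf : DifferentiableOn ℂ f (unitBall n)) :
    Measurable ((unitBall n).indicator f) := by
  classical
  rw [← piecewise_eq_indicator]
  exact hf.continuousOn.measurable_piecewise continuousOn_const measurableSet_unitBall

/-- Multiplication by a unimodular number, as a unitary map of `ℂⁿ`. -/
def unimodularRotation (n : ℕ) (c : ℂ) (hc : ‖c‖ = 1) : Cn n ≃ₗᵢ[ℂ] Cn n :=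
  ⟨LinearEquiv.smulOfNeZero ℂ (Cn n) c (norm_pos_iff.1 (by rw [hc]; exact one_pos)),
    fun x => by simp [norm_smul, hc]⟩

open Real in
/-- The sub-mean value property of `|f|^p` over a circled set: average the one-variable inequality
on the discs `λ ↦ a + λ w`. -/
lemma enorm_rpow_mul_measure_le {f : Cn n → ℂ} (hf : DifferentiableOn ℂ f (unitBall n))
    {a : Cn n} {E : Set (Cn n)} (hE : MeasurableSet E)
    (hrot : ∀ c : ℂ, ‖c‖ = 1 → ∀ w, c • w ∈ E ↔ w ∈ E)
    (hsub : ∀ w ∈ E, ∀ c : ℂ, ‖c‖ ≤ 1 → a + c • w ∈ unitBall n) {p : ℝ} (hp : 0 < p) :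
    ‖f a‖ₑ ^ p * lebesgueCn n E ≤ ∫⁻ w in E, ‖f (a + w)‖ₑ ^ p ∂lebesgueCn n := by
  set F : Cn n → ENNReal := fun z => ‖(unitBall n).indicator f z‖ₑ ^ p with hF
  have hFm : Measurable F := (measurable_indicator_unitBall hf).enorm.pow_const _
  have hFf : ∀ z ∈ unitBall n, F z = ‖f z‖ₑ ^ p := fun z hz => by simp [hF, hz]
  have hstep : ∀ w ∈ E, ENNReal.ofReal (2 * π) * ‖f a‖ₑ ^ p ≤
      ∫⁻ θ in Ioc 0 (2 * π), F (a + circleMap 0 1 θ • w) := by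
    intro w hw
    have hg : AnalyticOnNhd ℂ (fun c : ℂ => f (a + c • w)) (Metric.closedBall 0 1) := by
      have hopen : IsOpen ((fun c : ℂ => a + c • w) ⁻¹' unitBall n) :=
        isOpen_unitBall.preimage (by fun_prop)
      have hd : DifferentiableOn ℂ (fun c : ℂ => f (a + c • w))
          ((fun c : ℂ => a + c • w) ⁻¹' unitBall n) :=
        hf.comp (Differentiable.differentiableOn (by fun_prop)) fun c hc => hc
      exact (hd.analyticOnNhd hopen).mono fun c hc => hsub w hw c (by simpa using hc)
    have h := enorm_rpow_le_lintegral_circle hg hp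
    simp only [zero_smul, add_zero] at h
    refine h.trans (le_of_eq ?_)
    refine lintegral_congr fun θ => ?_
    rw [hFf _ (hsub w hw _ (by simp))]
  have hjoint : Measurable fun x : Cn n × ℝ => F (a + circleMap 0 1 x.2 • x.1) := by
    refine hFm.comp (Continuous.measurable ?_)
    have := continuous_circleMap 0 1
    fun_prop
  have h1 : ENNReal.ofReal (2 * π) * ‖f a‖ₑ ^ p * lebesgueCn n E ≤
      ENNReal.ofReal (2 * π) * ∫⁻ w in E, F (a + w) ∂lebesgueCn n := by
    calc ENNReal.ofReal (2 * π) * ‖f a‖ₑ ^ p * lebesgueCn n E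
        = ∫⁻ w in E, ENNReal.ofReal (2 * π) * ‖f a‖ₑ ^ p ∂lebesgueCn n := by simp
      _ ≤ ∫⁻ w in E, (∫⁻ θ in Ioc 0 (2 * π), F (a + circleMap 0 1 θ • w)) ∂lebesgueCn n :=
          setLIntegral_mono' hE hstep
      _ = ∫⁻ θ in Ioc 0 (2 * π), ∫⁻ w in E, F (a + circleMap 0 1 θ • w) ∂lebesgueCn n :=
          lintegral_lintegral_swap hjoint.aemeasurable
      _ = ∫⁻ θ in Ioc 0 (2 * π), ∫⁻ w in E, F (a + w) ∂lebesgueCn n := by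
          refine lintegral_congr fun θ => ?_
          have hc : ‖circleMap 0 1 θ‖ = 1 := by simp
          have hpre : unimodularRotation n _ hc ⁻¹' E = E := by
            ext w; exact hrot _ hc w
          have := (measurePreserving_linearIsometryEquiv
            (unimodularRotation n _ hc)).setLIntegral_comp_preimage hE
            (hFm.comp (measurable_const_add a))
          rw [hpre] at this
          exact this
      _ = ENNReal.ofReal (2 * π) * ∫⁻ w in E, F (a + w) ∂lebesgueCn n := by
          rw [lintegral_const, mul_comm]; simp
  rw [mul_assoc, ENNReal.mul_le_mul_iff_right (by simp [pi_pos]) ENNReal.ofReal_ne_top] at h1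
  refine h1.trans (le_of_eq (setLIntegral_congr_fun hE fun w hw => hFf _ ?_))
  simpa using hsub w hw 1 (by simp)

/-- A circled nonisotropic neighbourhood of the origin, of size `1 - |a|²` in the direction of `a`
and `(1 - |a|²)^(1/2)` in the orthogonal directions. -/
def nonisotropicNhd (a : Cn n) : Set (Cn n) :=
  {w | ‖inner ℂ a w‖ < (1 - ‖a‖ ^ 2) / 8 ∧ ‖w‖ < √(1 - ‖a‖ ^ 2) / 8}

lemma isOpen_nonisotropicNhd (a : Cn n) : IsOpen (nonisotropicNhd a) :=
  (isOpen_lt (f := fun w => ‖inner ℂ a w‖) (by fun_prop) continuous_const).inter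
    (isOpen_lt continuous_norm continuous_const)

lemma weight_add_mem_Icc {a w : Cn n} (ha : a ∈ unitBall n) (hw : w ∈ nonisotropicNhd a) :
    1 - ‖a + w‖ ^ 2 ∈ Icc ((1 - ‖a‖ ^ 2) / 2) (2 * (1 - ‖a‖ ^ 2)) := by
  have hK := one_sub_norm_sq_pos ha
  obtain ⟨h1, h2⟩ := hw
  have h3 := norm_add_sq (𝕜 := ℂ) a w
  have h4 : |RCLike.re (inner ℂ a w)| ≤ ‖inner ℂ a w‖ := RCLike.abs_re_le_norm _
  have h5 := abs_le.1 (h4.trans h1.le)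
  have h6 : ‖w‖ ^ 2 ≤ (1 - ‖a‖ ^ 2) / 64 := by
    have := pow_le_pow_left₀ (norm_nonneg w) h2.le 2
    rw [div_pow, Real.sq_sqrt hK.le] at this
    linarith
  have h7 := sq_nonneg ‖w‖
  constructor <;> rw [h3] <;> linarith [h5.1, h5.2]

lemma smul_mem_nonisotropicNhd {a w : Cn n} (hw : w ∈ nonisotropicNhd a) {c : ℂ} (hc : ‖c‖ ≤ 1) :
    c • w ∈ nonisotropicNhd a := by
  refine ⟨lt_of_le_of_lt ?_ hw.1, lt_of_le_of_lt ?_ hw.2⟩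
  · rw [inner_smul_right, norm_mul]
    exact mul_le_of_le_one_left (norm_nonneg _) hc
  · rw [norm_smul]
    exact mul_le_of_le_one_left (norm_nonneg _) hc

lemma lebesgueCn_polydisc (c : Fin n → ℂ) (R : Fin n → ℝ) :
    lebesgueCn n {x | ∀ i, ‖x i - c i‖ < R i} =
      ∏ i, (ENNReal.ofReal (R i) ^ 2 * NNReal.pi) := by
  have hm : MeasurableSet {x : Cn n | ∀ i, ‖x i - c i‖ < R i} := by
    refine IsOpen.measurableSet ?_
    simp only [ofPred_forall]
    exact isOpen_iInter_of_finite fun i => isOpen_lt (by fun_prop) (by fun_prop)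
  rw [lebesgueCn, Measure.map_apply (by fun_prop) hm]
  have : (WithLp.toLp 2 : (Fin n → ℂ) → Cn n) ⁻¹' {x | ∀ i, ‖x i - c i‖ < R i} =
      Set.pi univ fun i => Metric.ball (c i) (R i) := by
    ext x
    simp [dist_eq_norm]
  rw [this, volume_pi_pi]
  simp [Complex.volume_ball]

lemma exists_unitary_inner (hn : 1 ≤ n) (a : Cn n) :
    ∃ U : Cn n ≃ₗᵢ[ℂ] Cn n, ∀ w, ‖inner ℂ a w‖ = ‖a‖ * ‖(U w) ⟨0, hn⟩‖ := by
  obtain ⟨u, hu, hau⟩ : ∃ u : Cn n, ‖u‖ = 1 ∧ a = (‖a‖ : ℂ) • u := by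
    rcases eq_or_ne a 0 with rfl | h
    · exact ⟨EuclideanSpace.single ⟨0, hn⟩ 1, by simp, by simp⟩
    · have h' : (‖a‖ : ℂ) ≠ 0 := by exact_mod_cast norm_ne_zero_iff.2 h
      refine ⟨(‖a‖ : ℂ)⁻¹ • a, ?_, ?_⟩
      · rw [norm_smul, norm_inv, Complex.norm_real, norm_norm,
          inv_mul_cancel₀ (norm_ne_zero_iff.2 h)]
      · rw [smul_smul, mul_inv_cancel₀ h', one_smul]
  obtain ⟨b, hb⟩ := Orthonormal.exists_orthonormalBasis_extension_of_card_eq (𝕜 := ℂ) (E := Cn n)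
    (ι := Fin n) (by simp) (v := fun _ => u) (s := {⟨0, hn⟩}) (by
      constructor
      · intro i; simpa using hu
      · intro i j hij; exact absurd (Subsingleton.elim i j) hij)
  refine ⟨b.repr, fun w => ?_⟩
  rw [b.repr_apply_apply, hb _ rfl]
  conv_lhs => rw [hau, inner_smul_left]
  simp

lemma le_measure_nonisotropicNhd (hn : 1 ≤ n) : ∃ c : ℝ, 0 < c ∧ ∀ a ∈ unitBall n,
    ENNReal.ofReal (c * (1 - ‖a‖ ^ 2) ^ (n + 1)) ≤ lebesgueCn n (nonisotropicNhd a) := by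
  obtain ⟨m, rfl⟩ : ∃ m, n = m + 1 := ⟨n - 1, by omega⟩
  set c' : ℝ := 1 / (8 * (m + 1)) with hc'
  have hc'0 : 0 < c' := by positivity
  have hc'8 : c' ≤ 1 / 8 := by
    rw [hc']; gcongr; linarith [(Nat.cast_nonneg m : (0 : ℝ) ≤ m)]
  refine ⟨(c' ^ 2 * Real.pi) ^ (m + 1), by positivity, fun a ha => ?_⟩
  have hK := one_sub_norm_sq_pos ha
  set K := 1 - ‖a‖ ^ 2 with hKdef
  have hK1 : K ≤ 1 := by rw [hKdef]; linarith [sq_nonneg ‖a‖]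
  have hsK : √K ^ 2 = K := Real.sq_sqrt hK.le
  have hsK0 : 0 < √K := Real.sqrt_pos.2 hK
  have hKs : K ≤ √K := by nlinarith [Real.sqrt_le_one.2 hK1]
  obtain ⟨U, hU⟩ := exists_unitary_inner hn a
  set R : Fin (m + 1) → ℝ := Fin.cons (c' * K) fun _ => c' * √K with hR
  set D : Set (Cn (m + 1)) := {x | ∀ i, ‖x i - (0 : Fin (m + 1) → ℂ) i‖ < R i} with hD
  have hRle : ∀ i, R i ≤ c' * √K := by
    intro i
    refine Fin.cases ?_ (fun j => ?_) i
    · simp only [hR, Fin.cons_zero]; gcongr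
    · simp [hR]
  have hsub : U ⁻¹' D ⊆ nonisotropicNhd a := by
    intro w hw
    simp only [hD, mem_preimage, mem_ofPred_eq, Pi.zero_apply, sub_zero] at hw
    constructor
    · rw [hU]
      have h0 := hw ⟨0, hn⟩
      have h1 : R ⟨0, hn⟩ = c' * K := rfl
      rw [h1] at h0
      have h2 : ‖a‖ ≤ 1 := (mem_unitBall.1 ha).le
      calc ‖a‖ * ‖(U w) ⟨0, hn⟩‖ ≤ 1 * ‖(U w) ⟨0, hn⟩‖ := by gcongr
        _ < c' * K := by rwa [one_mul]
        _ ≤ K / 8 := by nlinarith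
    · rw [← U.norm_map, EuclideanSpace.norm_eq, Real.sqrt_lt' (by positivity)]
      have h1 : ∀ i ∈ Finset.univ, ‖(U w) i‖ ^ 2 < (c' * √K) ^ 2 := fun i _ => by
        have := (hw i).trans_le (hRle i)
        gcongr
      refine (Finset.sum_lt_sum_of_nonempty Finset.univ_nonempty h1).trans_le ?_
      simp only [Finset.sum_const, Finset.card_univ, Fintype.card_fin, nsmul_eq_mul]
      rw [mul_pow c' (√K), div_pow (√K), hsK, hc']
      push_cast
      have h3 : (m + 1 : ℝ) * ((1 / (8 * (m + 1))) ^ 2 * K) = 1 / (m + 1) * (K / 8 ^ 2) := by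
        field_simp
      rw [h3]
      have h4 : 1 / (m + 1 : ℝ) ≤ 1 := by
        rw [div_le_one (by positivity)]; linarith [(Nat.cast_nonneg m : (0 : ℝ) ≤ m)]
      exact mul_le_of_le_one_left (by positivity) h4
  have hDm : MeasurableSet D := by
    refine IsOpen.measurableSet ?_
    simp only [hD, ofPred_forall]
    exact isOpen_iInter_of_finite fun i => isOpen_lt (by fun_prop) (by fun_prop)
  refine le_trans (le_of_eq ?_) (measure_mono hsub)
  rw [(measurePreserving_linearIsometryEquiv U).measure_preimage hDm.nullMeasurableSet, hD,
    lebesgueCn_polydisc, Fin.prod_univ_succ]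
  simp only [hR, Fin.cons_zero, Fin.cons_succ, Finset.prod_const, Finset.card_univ,
    Fintype.card_fin]
  have hpi : (NNReal.pi : ENNReal) = ENNReal.ofReal Real.pi := by
    rw [ENNReal.ofReal, Real.toNNReal_of_nonneg Real.pi_pos.le]; rfl
  rw [hpi, ← ENNReal.ofReal_pow (by positivity), ← ENNReal.ofReal_pow (by positivity),
    ← ENNReal.ofReal_mul (by positivity), ← ENNReal.ofReal_mul (by positivity),
    ← ENNReal.ofReal_pow (by positivity), ← ENNReal.ofReal_mul (by positivity)]
  congr 1
  rw [mul_pow c' (√K), hsK]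
  ring_nf

lemma two_rpow_neg_abs_mul_le {K x : ℝ} (hK : 0 < K) (hx : x ∈ Icc (K / 2) (2 * K)) (α : ℝ) :
    (2 : ℝ) ^ (-|α|) * K ^ α ≤ x ^ α := by
  have hx0 : 0 < x := lt_of_lt_of_le (by positivity) hx.1
  have h1 : (2 : ℝ) ^ (-|α|) ≤ (x / K) ^ α := by
    rcases le_total 0 α with h | h
    · rw [abs_of_nonneg h, Real.rpow_neg (by norm_num), ← Real.inv_rpow (by norm_num)]
      refine Real.rpow_le_rpow (by norm_num) ?_ h
      rw [le_div_iff₀ hK]; linarith [hx.1]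
    · rw [abs_of_nonpos h, neg_neg]
      refine Real.rpow_le_rpow_of_nonpos (by positivity) ?_ h
      rw [div_le_iff₀ hK]; linarith [hx.2]
  calc (2 : ℝ) ^ (-|α|) * K ^ α ≤ (x / K) ^ α * K ^ α := by gcongr
    _ = x ^ α := by rw [← Real.mul_rpow (by positivity) hK.le, div_mul_cancel₀ _ hK.ne']

/-- The sharp pointwise growth estimate for Bergman functions. -/
lemma enorm_rpow_mul_weight_le (hn : 1 ≤ n) {p : ℝ} (hp : 0 < p) (α : ℝ) :
    ∃ C : ℝ, 0 < C ∧ ∀ f : Cn n → ℂ, DifferentiableOn ℂ f (unitBall n) → ∀ a ∈ unitBall n,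
      ‖f a‖ₑ ^ p * ENNReal.ofReal ((1 - ‖a‖ ^ 2) ^ (n + 1 + α)) ≤
        ENNReal.ofReal C * ∫⁻ z, ‖f z‖ₑ ^ p ∂weightedMeasure n α := by
  obtain ⟨c, hc, hvol⟩ := le_measure_nonisotropicNhd hn
  set L := lebesgueCn n (unitBall n) with hL
  have hL0 : L ≠ 0 := lebesgueCn_unitBall_ne_zero
  have hLt : L ≠ ⊤ := lebesgueCn_unitBall_ne_top
  set d : ℝ := c * 2 ^ (-|α|) with hd
  have hd0 : 0 < d := by positivity
  refine ⟨d⁻¹ * L.toReal, mul_pos (inv_pos.2 hd0) (ENNReal.toReal_pos hL0 hLt),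
    fun f hf a ha => ?_⟩
  have hK := one_sub_norm_sq_pos ha
  set K := 1 - ‖a‖ ^ 2 with hKdef
  set E := nonisotropicNhd a
  have hE : MeasurableSet E := (isOpen_nonisotropicNhd a).measurableSet
  have hmem : ∀ w ∈ E, a + w ∈ unitBall n := by
    intro w hw
    have h1 := (weight_add_mem_Icc ha hw).1
    rw [mem_unitBall]
    nlinarith [norm_nonneg (a + w), one_sub_norm_sq_pos ha]
  have hmean := enorm_rpow_mul_measure_le hf (a := a) hE
    (fun c hc w => ⟨fun h => by
      have h2 := smul_mem_nonisotropicNhd h (c := c⁻¹) (by simp [hc])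
      rwa [smul_smul, inv_mul_cancel₀ (norm_pos_iff.1 (by rw [hc]; exact one_pos)),
        one_smul] at h2, fun h => smul_mem_nonisotropicNhd h hc.le⟩)
    (fun w hw c hc => hmem _ (smul_mem_nonisotropicNhd hw hc)) hp
  set G : Cn n → ENNReal := fun z => ENNReal.ofReal ((1 - ‖z‖ ^ 2) ^ α) * ‖f z‖ₑ ^ p with hG
  have hint : ENNReal.ofReal (2 ^ (-|α|) * K ^ α) * ∫⁻ w in E, ‖f (a + w)‖ₑ ^ p ∂lebesgueCn n ≤
      ∫⁻ z in unitBall n, G z ∂lebesgueCn n := by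
    calc _ = ∫⁻ w in E, ENNReal.ofReal (2 ^ (-|α|) * K ^ α) * ‖f (a + w)‖ₑ ^ p ∂lebesgueCn n :=
          (lintegral_const_mul' _ _ ENNReal.ofReal_ne_top).symm
      _ ≤ ∫⁻ w in E, (unitBall n).indicator G (a + w) ∂lebesgueCn n := by
          refine setLIntegral_mono' hE fun w hw => ?_
          rw [indicator_of_mem (hmem w hw)]
          simp only [hG]
          have := two_rpow_neg_abs_mul_le hK (weight_add_mem_Icc ha hw) α
          gcongr
      _ ≤ ∫⁻ w, (unitBall n).indicator G (a + w) ∂lebesgueCn n := setLIntegral_le_lintegral _ _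
      _ = ∫⁻ w, (unitBall n).indicator G w ∂lebesgueCn n :=
          lintegral_add_left_eq_self (μ := lebesgueCn n) _ a
      _ = _ := lintegral_indicator measurableSet_unitBall _
  have hmain : ENNReal.ofReal d * (‖f a‖ₑ ^ p * ENNReal.ofReal (K ^ (n + 1 + α))) ≤
      ∫⁻ z in unitBall n, G z ∂lebesgueCn n := by
    refine le_trans ?_ hint
    calc ENNReal.ofReal d * (‖f a‖ₑ ^ p * ENNReal.ofReal (K ^ (n + 1 + α)))
        = ENNReal.ofReal (2 ^ (-|α|) * K ^ α) *
          (‖f a‖ₑ ^ p * ENNReal.ofReal (c * K ^ (n + 1))) := by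
          rw [mul_left_comm, mul_left_comm (ENNReal.ofReal (2 ^ (-|α|) * K ^ α)),
            ← ENNReal.ofReal_mul hd0.le, ← ENNReal.ofReal_mul (by positivity), hd]
          congr 2
          have : K ^ ((n : ℝ) + 1 + α) = K ^ (n + 1) * K ^ α := by
            rw [Real.rpow_add hK, ← Nat.cast_add_one, Real.rpow_natCast]
          rw [this]; ring
      _ ≤ ENNReal.ofReal (2 ^ (-|α|) * K ^ α) * (‖f a‖ₑ ^ p * lebesgueCn n E) := by
          gcongr; exact hvol a ha
      _ ≤ _ := by gcongr
  rw [lintegral_weightedMeasure, lintegral_ballMeasure, ENNReal.ofReal_mul (inv_nonneg.2 hd0.le),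
    ENNReal.ofReal_toReal hLt, ENNReal.ofReal_inv_of_pos hd0, mul_assoc, ← mul_assoc L,
    ENNReal.mul_inv_cancel hL0 hLt, one_mul, mul_comm (ENNReal.ofReal d)⁻¹, ← div_eq_mul_inv,
    ENNReal.le_div_iff_mul_le (Or.inl (by simpa using hd0)) (Or.inl ENNReal.ofReal_ne_top),
    mul_comm]
  exact hmain

lemma aestronglyMeasurable_of_differentiableOn {f : Cn n → ℂ}
    (hf : DifferentiableOn ℂ f (unitBall n)) : AEStronglyMeasurable f (ballMeasure n) :=
  (hf.continuousOn.aestronglyMeasurable measurableSet_unitBall).smul_measure _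

lemma aestronglyMeasurable_weightedMeasure {f : Cn n → ℂ}
    (hf : DifferentiableOn ℂ f (unitBall n)) (α : ℝ) :
    AEStronglyMeasurable f (weightedMeasure n α) :=
  (aestronglyMeasurable_of_differentiableOn hf).mono_ac (withDensity_absolutelyContinuous _ _)

/-- `A^p_α ⊆ A^r_β` for `p ≤ r`, by the pointwise growth estimate. -/
lemma lintegral_rpow_le_of_le (hn : 1 ≤ n) {p r α β : ℝ} (hp : 0 < p) (hpr : p ≤ r)
    (h : r * (n + 1 + α) ≤ p * (n + 1 + β)) :
    ∃ C : ENNReal, C ≠ ⊤ ∧ ∀ f : Cn n → ℂ, DifferentiableOn ℂ f (unitBall n) →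
      ∫⁻ z, ‖f z‖ₑ ^ p ∂weightedMeasure n α ≠ ⊤ →
      ∫⁻ z, ‖f z‖ₑ ^ r ∂weightedMeasure n β ≤
        C * (∫⁻ z, ‖f z‖ₑ ^ p ∂weightedMeasure n α) ^ (r / p) := by
  obtain ⟨C, hC, hpt⟩ := enorm_rpow_mul_weight_le hn hp α
  set e := (r - p) / p with he
  have he0 : 0 ≤ e := div_nonneg (by linarith) hp.le
  have hre : r / p = e + 1 := by rw [he]; field_simp; ring
  refine ⟨ENNReal.ofReal C ^ e, ENNReal.rpow_ne_top_of_nonneg he0 ENNReal.ofReal_ne_top,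
    fun f hf hI => ?_⟩
  set I := ∫⁻ z, ‖f z‖ₑ ^ p ∂weightedMeasure n α with hIdef
  have hD : (ENNReal.ofReal C * I) ^ e ≠ ⊤ :=
    ENNReal.rpow_ne_top_of_nonneg he0 (ENNReal.mul_ne_top ENNReal.ofReal_ne_top hI)
  calc ∫⁻ z, ‖f z‖ₑ ^ r ∂weightedMeasure n β
      = ∫⁻ z, ENNReal.ofReal ((1 - ‖z‖ ^ 2) ^ β) * ‖f z‖ₑ ^ r ∂ballMeasure n :=
        lintegral_weightedMeasure _ _
    _ ≤ ∫⁻ z, (ENNReal.ofReal C * I) ^ e *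
          (ENNReal.ofReal ((1 - ‖z‖ ^ 2) ^ α) * ‖f z‖ₑ ^ p) ∂ballMeasure n := by
        refine lintegral_mono_ae ?_
        filter_upwards [ae_mem_unitBall n] with z hz
        have hK := one_sub_norm_sq_pos hz
        have h1 := ENNReal.rpow_le_rpow (hpt f hf z hz) he0
        rw [ENNReal.mul_rpow_of_nonneg _ _ he0, ← ENNReal.rpow_mul,
          ENNReal.ofReal_rpow_of_pos (by positivity), ← Real.rpow_mul hK.le] at h1
        have h2 : (1 - ‖z‖ ^ 2) ^ β ≤ (1 - ‖z‖ ^ 2) ^ ((n + 1 + α) * e) * (1 - ‖z‖ ^ 2) ^ α := by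
          rw [← Real.rpow_add hK]
          refine Real.rpow_le_rpow_of_exponent_ge hK (by linarith [sq_nonneg ‖z‖]) ?_
          have h3 : r * (n + 1 + α) / p ≤ n + 1 + β := by
            rw [div_le_iff₀ hp]; linarith
          have h4 : r * (n + 1 + α) / p = (e + 1) * (n + 1 + α) := by rw [← hre]; ring
          linarith
        have h5 : ‖f z‖ₑ ^ r = ‖f z‖ₑ ^ (p * e) * ‖f z‖ₑ ^ p := by
          rw [← ENNReal.rpow_add_of_nonneg _ _ (by positivity) hp.le]
          congr 1
          rw [he]; field_simp; ring
        calc ENNReal.ofReal ((1 - ‖z‖ ^ 2) ^ β) * ‖f z‖ₑ ^ r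
            ≤ ENNReal.ofReal ((1 - ‖z‖ ^ 2) ^ ((n + 1 + α) * e) * (1 - ‖z‖ ^ 2) ^ α) *
              (‖f z‖ₑ ^ (p * e) * ‖f z‖ₑ ^ p) := by rw [h5]; gcongr
          _ = (‖f z‖ₑ ^ (p * e) * ENNReal.ofReal ((1 - ‖z‖ ^ 2) ^ ((n + 1 + α) * e))) *
              (ENNReal.ofReal ((1 - ‖z‖ ^ 2) ^ α) * ‖f z‖ₑ ^ p) := by
              rw [ENNReal.ofReal_mul (by positivity)]; ring
          _ ≤ _ := by gcongr
    _ = (ENNReal.ofReal C * I) ^ e * I := by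
        rw [lintegral_const_mul' _ _ hD, ← lintegral_weightedMeasure]
    _ = ENNReal.ofReal C ^ e * I ^ (r / p) := by
        rw [ENNReal.mul_rpow_of_nonneg _ _ he0, hre,
          ENNReal.rpow_add_of_nonneg _ _ he0 zero_le_one, ENNReal.rpow_one, mul_assoc]

/-- `A^p_α ⊆ A^r_β` for `r < p`, by Hölder's inequality. -/
lemma lintegral_rpow_le_of_lt (hn : 1 ≤ n) {p r α β : ℝ} (hr : 0 < r) (hpr : r < p)
    (h : r * (α + 1) < p * (β + 1)) :
    ∃ C : ENNReal, C ≠ ⊤ ∧ ∀ f : Cn n → ℂ, DifferentiableOn ℂ f (unitBall n) →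
      ∫⁻ z, ‖f z‖ₑ ^ r ∂weightedMeasure n β ≤
        C * (∫⁻ z, ‖f z‖ₑ ^ p ∂weightedMeasure n α) ^ (r / p) := by
  have hp : 0 < p := hr.trans hpr
  have hpr' : 0 < p - r := by linarith
  set γ := (β - α * r / p) * (p / (p - r)) with hγ
  have hγ1 : -1 < γ := by
    have : γ = (β * p - α * r) / (p - r) := by rw [hγ]; field_simp
    rw [this, lt_div_iff₀ hpr']
    linarith
  have hfin := isFiniteMeasure_weightedMeasure hn hγ1
  refine ⟨(weightedMeasure n γ univ) ^ (1 / (p / (p - r))),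
    ENNReal.rpow_ne_top_of_nonneg (by positivity) (measure_ne_top _ _), fun f hf => ?_⟩
  have hconj : (p / r).HolderConjugate (p / (p - r)) := by
    rw [Real.holderConjugate_iff]
    refine ⟨by rw [lt_div_iff₀ hr]; linarith, ?_⟩
    field_simp; ring
  have hfm : AEMeasurable (fun z => ‖f z‖ₑ) (ballMeasure n) :=
    (aestronglyMeasurable_of_differentiableOn hf).enorm
  have hHol := ENNReal.lintegral_mul_le_Lp_mul_Lq (ballMeasure n) hconj
    (f := fun z => ENNReal.ofReal ((1 - ‖z‖ ^ 2) ^ (α * r / p)) * ‖f z‖ₑ ^ r)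
    (g := fun z => ENNReal.ofReal ((1 - ‖z‖ ^ 2) ^ (β - α * r / p)))
    ((measurable_weight _).aemeasurable.mul (hfm.pow_const r)) (measurable_weight _).aemeasurable
  have h1 : ∫⁻ z, ‖f z‖ₑ ^ r ∂weightedMeasure n β = ∫⁻ z,
      ((fun z : Cn n => ENNReal.ofReal ((1 - ‖z‖ ^ 2) ^ (α * r / p)) * ‖f z‖ₑ ^ r) *
      (fun z : Cn n => ENNReal.ofReal ((1 - ‖z‖ ^ 2) ^ (β - α * r / p)))) z ∂ballMeasure n := by
    rw [lintegral_weightedMeasure]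
    refine lintegral_congr_ae ?_
    filter_upwards [ae_mem_unitBall n] with z hz
    have hK := one_sub_norm_sq_pos hz
    rw [Pi.mul_apply, mul_right_comm, ← ENNReal.ofReal_mul (by positivity), ← Real.rpow_add hK,
      add_sub_cancel]
  have h2 : ∫⁻ z, (ENNReal.ofReal ((1 - ‖z‖ ^ 2) ^ (α * r / p)) * ‖f z‖ₑ ^ r) ^ (p / r)
      ∂ballMeasure n = ∫⁻ z, ‖f z‖ₑ ^ p ∂weightedMeasure n α := by
    rw [lintegral_weightedMeasure]
    refine lintegral_congr_ae ?_
    filter_upwards [ae_mem_unitBall n] with z hz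
    have hK := one_sub_norm_sq_pos hz
    rw [ENNReal.mul_rpow_of_nonneg _ _ (by positivity), ← ENNReal.rpow_mul,
      ENNReal.ofReal_rpow_of_pos (by positivity), ← Real.rpow_mul hK.le]
    congr 3 <;> field_simp
  have h3 : ∫⁻ z : Cn n, ENNReal.ofReal ((1 - ‖z‖ ^ 2) ^ (β - α * r / p)) ^ (p / (p - r))
      ∂ballMeasure n = weightedMeasure n γ univ := by
    rw [← lintegral_one, lintegral_weightedMeasure]
    refine lintegral_congr_ae ?_
    filter_upwards [ae_mem_unitBall n] with z hz
    have hK := one_sub_norm_sq_pos hz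
    rw [ENNReal.ofReal_rpow_of_pos (by positivity), ← Real.rpow_mul hK.le, mul_one]
  rw [h2, h3, ← h1, one_div_div p r, mul_comm] at hHol
  exact hHol

/-- The embedding of Bergman spaces, in the range of parameters in which it holds. -/
lemma lintegral_rpow_le (hn : 1 ≤ n) {p r α β : ℝ} (hp : 0 < p) (hr : 0 < r) (hα : -1 < α)
    (h1 : α ≤ β → r * (n + 1 + α) ≤ p * (n + 1 + β))
    (h2 : β < α → r * (α + 1) < p * (β + 1)) :
    ∃ C : ENNReal, C ≠ ⊤ ∧ ∀ f : Cn n → ℂ, DifferentiableOn ℂ f (unitBall n) →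
      ∫⁻ z, ‖f z‖ₑ ^ p ∂weightedMeasure n α ≠ ⊤ →
      ∫⁻ z, ‖f z‖ₑ ^ r ∂weightedMeasure n β ≤
        C * (∫⁻ z, ‖f z‖ₑ ^ p ∂weightedMeasure n α) ^ (r / p) := by
  have hα1 : 0 < α + 1 := by linarith
  rcases le_or_gt p r with hpr | hpr
  · refine lintegral_rpow_le_of_le hn hp hpr (h1 (le_of_not_gt fun hβα => ?_))
    have := h2 hβα
    nlinarith
  · obtain ⟨C, hC, hf⟩ := lintegral_rpow_le_of_lt hn hr hpr (α := α) (β := β) (by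
      rcases le_or_gt α β with h | h
      · nlinarith
      · exact h2 h)
    exact ⟨C, hC, fun f hd _ => hf f hd⟩

/-! ### Membership in the Bergman space -/

lemma mem_bergmanSpace_iff {p α : ℝ} (hp : 0 < p) {f : Cn n → ℂ} :
    f ∈ bergmanSpace n p α ↔ DifferentiableOn ℂ f (unitBall n) ∧
      ∫⁻ z, ‖f z‖ₑ ^ p ∂weightedMeasure n α ≠ ⊤ := by
  refine and_congr_right fun hf => ?_
  have h0 : ENNReal.ofReal p ≠ 0 := by simpa using hp
  rw [MemLp, and_iff_right (aestronglyMeasurable_weightedMeasure hf α),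
    eLpNorm_lt_top_iff_lintegral_rpow_enorm_lt_top h0 ENNReal.ofReal_ne_top,
    ENNReal.toReal_ofReal hp.le, lt_top_iff_ne_top]

lemma bergmanNorm_eq {p : ℝ} (hp : 0 < p) (α : ℝ) (f : Cn n → ℂ) :
    bergmanNorm n p α f = ((∫⁻ z, ‖f z‖ₑ ^ p ∂weightedMeasure n α) ^ (1 / p)).toReal := by
  have h0 : ENNReal.ofReal p ≠ 0 := by simpa using hp
  rw [bergmanNorm, eLpNorm_eq_lintegral_rpow_enorm_toReal h0 ENNReal.ofReal_ne_top,
    ENNReal.toReal_ofReal hp.le]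

lemma mem_bergmanSpace_of_bounded (hn : 1 ≤ n) {p α : ℝ} (hp : 0 < p) (hα : -1 < α)
    {f : Cn n → ℂ} (hf : DifferentiableOn ℂ f (unitBall n)) {M : ℝ}
    (hM : ∀ z ∈ unitBall n, ‖f z‖ ≤ M) : f ∈ bergmanSpace n p α := by
  rw [mem_bergmanSpace_iff hp]
  refine ⟨hf, ne_top_of_le_ne_top (b := ∫⁻ _, ENNReal.ofReal M ^ p ∂weightedMeasure n α) ?_ ?_⟩
  · have := isFiniteMeasure_weightedMeasure hn hα
    rw [lintegral_const]
    exact ENNReal.mul_ne_top (ENNReal.rpow_ne_top_of_nonneg hp.le ENNReal.ofReal_ne_top)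
      (measure_ne_top _ _)
  · refine lintegral_mono_ae ?_
    filter_upwards [ae_weightedMeasure_mem_unitBall n α] with z hz
    rw [← ofReal_norm]
    have := hM z hz
    gcongr

/-! ### Test functions with one boundary singularity -/

/-- The part of the ball within distance `δ` of `1` in the coordinate `i`. -/
def boundaryCap (i : Fin n) (δ : ℝ) : Set (Cn n) := {z | z ∈ unitBall n ∧ ‖1 - z i‖ < δ}

lemma measurableSet_boundaryCap (i : Fin n) (δ : ℝ) : MeasurableSet (boundaryCap i δ) :=
  (isOpen_unitBall.inter (isOpen_lt (f := fun z : Cn n => ‖1 - z i‖) (by fun_prop)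
    continuous_const)).measurableSet

lemma lintegral_Ioo_rpow {α δ : ℝ} (hα : -1 < α) (hδ : 0 < δ) :
    ∫⁻ t in Ioo 0 δ, ENNReal.ofReal (t ^ α) = ENNReal.ofReal (δ ^ (α + 1) / (α + 1)) := by
  have hint : IntegrableOn (fun t : ℝ => t ^ α) (Ioo 0 δ) :=
    ((intervalIntegrable_iff_integrableOn_Ioo_of_le hδ.le).1
      (intervalIntegral.intervalIntegrable_rpow' hα))
  rw [← ofReal_integral_eq_lintegral_ofReal hint]
  · rw [← integral_Ioc_eq_integral_Ioo, ← intervalIntegral.integral_of_le hδ.le,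
      integral_rpow (Or.inl hα), Real.zero_rpow (by linarith), sub_zero]
  · filter_upwards [ae_restrict_mem measurableSet_Ioo] with t ht
    exact Real.rpow_nonneg ht.1.le _

lemma norm_add_smul_single_sq (i : Fin n) (z : Cn n) (t : ℝ) :
    ‖z + (t : ℂ) • EuclideanSpace.single i (1 : ℂ)‖ ^ 2 = ‖z‖ ^ 2 + 2 * t * (z i).re + t ^ 2 := by
  rw [norm_add_sq (𝕜 := ℂ), inner_smul_right, EuclideanSpace.inner_single_right, norm_smul]
  simp
  ring

lemma norm_sq_apply_add_le {i j : Fin n} (hij : j ≠ i) (z : Cn n) :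
    ‖z i‖ ^ 2 + ‖z j‖ ^ 2 ≤ ‖z‖ ^ 2 := by
  rw [EuclideanSpace.norm_sq_eq, ← Finset.sum_pair (f := fun k => ‖z k‖ ^ 2) hij.symm]
  exact Finset.sum_le_sum_of_subset_of_nonneg (Finset.subset_univ _) fun _ _ _ => by positivity

lemma norm_apply_le (i : Fin n) (z : Cn n) : ‖z i‖ ≤ ‖z‖ := PiLp.norm_apply_le z i

/-- Along a line in the real direction of the coordinate `i`, the weight near the boundary point is
comparable to a power of the distance to the end point of the chord. -/
lemma weight_le_of_mem_boundaryCap {i : Fin n} {δ α : ℝ} (hδ : δ ≤ 1 / 4) {z : Cn n} {t : ℝ}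
    (h : z + (t : ℂ) • EuclideanSpace.single i (1 : ℂ) ∈ boundaryCap i δ) :
    √(1 - ‖z‖ ^ 2 + (z i).re ^ 2) - (z i).re - t ∈ Ioo 0 δ ∧
    (1 - ‖z + (t : ℂ) • EuclideanSpace.single i (1 : ℂ)‖ ^ 2) ^ α ≤
      2 ^ |α| * (√(1 - ‖z‖ ^ 2 + (z i).re ^ 2) - (z i).re - t) ^ α := by
  obtain ⟨h1, h2⟩ := h
  have hK := one_sub_norm_sq_pos h1
  rw [norm_add_smul_single_sq] at hK ⊢
  set x := (z i).re with hx
  set M := 1 - ‖z‖ ^ 2 + x ^ 2 with hM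
  have hre : 1 - x - t < δ := by
    have := (Complex.abs_re_le_norm _).trans_lt h2
    have h3 := (abs_lt.1 this).2
    simp at h3
    linarith
  have hM1 : M ≤ 1 := by
    have h3 : |x| ≤ ‖z‖ := (Complex.abs_re_le_norm _).trans (norm_apply_le i z)
    have := sq_le_sq' (by linarith [abs_nonneg x, norm_nonneg z]) h3
    rw [sq_abs] at this
    linarith
  have hM0 : 0 < M := by nlinarith [sq_nonneg (x + t)]
  have hs : √M ^ 2 = M := Real.sq_sqrt hM0.le
  have hs1 : √M ≤ 1 := Real.sqrt_le_one.2 hM1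
  have hs0 : 0 < √M := Real.sqrt_pos.2 hM0
  have hfac : 1 - (‖z‖ ^ 2 + 2 * t * x + t ^ 2) = (√M - x - t) * (√M + x + t) := by
    linear_combination -hs + hM
  have hpos : 0 < √M - x - t := by
    rw [hfac] at hK
    exact (pos_iff_pos_of_mul_pos hK).2 (by linarith)
  refine ⟨⟨hpos, by linarith⟩, ?_⟩
  rw [hfac]
  set b := √M - x - t with hb
  have hb' : 0 < b * (√M + x + t) := by rw [← hfac]; exact hK
  have := two_rpow_neg_abs_mul_le (K := b * (√M + x + t)) (x := b) hb'
    ⟨by nlinarith, by nlinarith⟩ α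
  rw [Real.rpow_neg (by norm_num), inv_mul_le_iff₀ (by positivity)] at this
  exact this

lemma lintegral_chord_le {i : Fin n} {δ α : ℝ} (hα : -1 < α) (hδ0 : 0 < δ) (hδ : δ ≤ 1 / 4)
    (z : Cn n) :
    ∫⁻ t : ℝ, (boundaryCap i δ).indicator (fun w => ENNReal.ofReal ((1 - ‖w‖ ^ 2) ^ α))
      (z + (t : ℂ) • EuclideanSpace.single i (1 : ℂ)) ≤
      ENNReal.ofReal (2 ^ |α| * (δ ^ (α + 1) / (α + 1))) := by
  set b := √(1 - ‖z‖ ^ 2 + (z i).re ^ 2) - (z i).re with hb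
  calc _ ≤ ∫⁻ t : ℝ, ENNReal.ofReal (2 ^ |α|) *
        (Ioo 0 δ).indicator (fun s => ENNReal.ofReal (s ^ α)) (b - t) := by
        refine lintegral_mono fun t => ?_
        by_cases h : z + (t : ℂ) • EuclideanSpace.single i (1 : ℂ) ∈ boundaryCap i δ
        · obtain ⟨h1, h2⟩ := weight_le_of_mem_boundaryCap (α := α) hδ h
          rw [indicator_of_mem h]
          simp only [hb]
          rw [indicator_of_mem h1, ← ENNReal.ofReal_mul (by positivity)]
          exact ENNReal.ofReal_le_ofReal h2
        · rw [indicator_of_notMem h]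
          exact zero_le
    _ = ENNReal.ofReal (2 ^ |α|) * ∫⁻ t : ℝ,
        (Ioo 0 δ).indicator (fun s => ENNReal.ofReal (s ^ α)) (b - t) :=
        lintegral_const_mul' _ _ ENNReal.ofReal_ne_top
    _ = ENNReal.ofReal (2 ^ |α|) * ENNReal.ofReal (δ ^ (α + 1) / (α + 1)) := by
        rw [lintegral_sub_left_eq_self (μ := volume)
          (fun u : ℝ => (Ioo 0 δ).indicator (fun s => ENNReal.ofReal (s ^ α)) u) b,
          lintegral_indicator measurableSet_Ioo, lintegral_Ioo_rpow hα hδ0]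
    _ = _ := by rw [← ENNReal.ofReal_mul (by positivity)]

/-- A cap of size `δ` has `dv_α`-measure of order `δ^(n+1+α)`. The weight is averaged over
translations in the real direction of the coordinate `i`, which reduces the claim to the Lebesgue
measure of a polydisc. -/
lemma weightedMeasure_boundaryCap_le (hn : 1 ≤ n) {α : ℝ} (hα : -1 < α) :
    ∃ C : ℝ, 0 < C ∧ ∀ δ : ℝ, 0 < δ → δ ≤ 1 / 4 →
      weightedMeasure n α (boundaryCap ⟨0, hn⟩ δ) ≤ ENNReal.ofReal (C * δ ^ (n + 1 + α)) := by
  obtain ⟨m, rfl⟩ : ∃ m, n = m + 1 := ⟨n - 1, by omega⟩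
  set i : Fin (m + 1) := ⟨0, hn⟩ with hi
  set L := lebesgueCn (m + 1) (unitBall (m + 1)) with hL
  have hL0 : L ≠ 0 := lebesgueCn_unitBall_ne_zero
  have hLt : L ≠ ⊤ := lebesgueCn_unitBall_ne_top
  have hLr : 0 < L.toReal := ENNReal.toReal_pos hL0 hLt
  have hα1 : 0 < α + 1 := by linarith
  refine ⟨L.toReal⁻¹ * ((2 ^ |α| / (α + 1)) * (9 * Real.pi * (2 * Real.pi) ^ m) / 2),
    by positivity, fun δ hδ0 hδ => ?_⟩
  set S := boundaryCap i δ with hS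
  have hSm : MeasurableSet S := measurableSet_boundaryCap i δ
  set F : Cn (m + 1) → ENNReal := S.indicator fun w => ENNReal.ofReal ((1 - ‖w‖ ^ 2) ^ α) with hF
  have hFm : Measurable F := (measurable_weight α).indicator hSm
  set c : Fin (m + 1) → ℂ := Fin.cons 1 fun _ => 0 with hc
  set R : Fin (m + 1) → ℝ := Fin.cons (3 * δ) fun _ => √(2 * δ) with hR
  set S' : Set (Cn (m + 1)) := {x | ∀ j, ‖x j - c j‖ < R j} with hS'
  have hS'm : MeasurableSet S' := by
    refine IsOpen.measurableSet ?_
    simp only [hS', ofPred_forall]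
    exact isOpen_iInter_of_finite fun j => isOpen_lt (by fun_prop) (by fun_prop)
  have hpi : (NNReal.pi : ENNReal) = ENNReal.ofReal Real.pi := by
    rw [ENNReal.ofReal, Real.toNNReal_of_nonneg Real.pi_pos.le]; rfl
  have hvol : lebesgueCn (m + 1) S' =
      ENNReal.ofReal (9 * Real.pi * (2 * Real.pi) ^ m * δ ^ (m + 2)) := by
    rw [hS', lebesgueCn_polydisc, Fin.prod_univ_succ]
    simp only [hR, Fin.cons_zero, Fin.cons_succ, Finset.prod_const, Finset.card_univ,
      Fintype.card_fin]
    rw [hpi, ← ENNReal.ofReal_pow (by positivity), ← ENNReal.ofReal_pow (by positivity),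
      ← ENNReal.ofReal_mul (by positivity), ← ENNReal.ofReal_mul (by positivity),
      ← ENNReal.ofReal_pow (by positivity), ← ENNReal.ofReal_mul (by positivity),
      Real.sq_sqrt (by positivity)]
    congr 1
    ring
  have hsupp : ∀ z, z ∉ S' → ∀ t ∈ Ioo 0 (2 * δ),
      F (z + (t : ℂ) • EuclideanSpace.single i (1 : ℂ)) = 0 := by
    intro z hz t ht
    refine indicator_of_notMem (fun hw => hz fun j => ?_) _
    obtain ⟨hw1, hw2⟩ := hw
    have hwi : (z + (t : ℂ) • EuclideanSpace.single i (1 : ℂ)) i = z i + t := by simp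
    rw [hwi] at hw2
    refine Fin.cases ?_ (fun k => ?_) j
    · simp only [hc, hR, Fin.cons_zero]
      calc ‖z i - 1‖ = ‖(1 - (z i + t)) + (t : ℂ)‖ := by rw [← norm_neg]; congr 1; ring
        _ ≤ ‖1 - (z i + t)‖ + ‖(t : ℂ)‖ := norm_add_le _ _
        _ < δ + 2 * δ := by
          rw [Complex.norm_real, Real.norm_of_nonneg ht.1.le]; linarith [ht.2]
        _ = 3 * δ := by ring
    · simp only [hc, hR, Fin.cons_succ, sub_zero]
      have hki : k.succ ≠ i := Fin.succ_ne_zero k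
      have h1 := norm_sq_apply_add_le hki (z + (t : ℂ) • EuclideanSpace.single i (1 : ℂ))
      have h2 : (z + (t : ℂ) • EuclideanSpace.single i (1 : ℂ)) k.succ = z k.succ := by
        simp [hki]
      rw [hwi, h2] at h1
      have h3 := one_sub_norm_sq_pos hw1
      have h4 : 1 - ‖z i + t‖ ≤ ‖1 - (z i + t)‖ := by
        simpa using norm_sub_norm_le (1 : ℂ) (z i + t)
      refine Real.lt_sqrt_of_sq_lt ?_
      nlinarith [sq_nonneg (1 - ‖z i + t‖)]
  have hjoint : Measurable fun x : ℝ × Cn (m + 1) =>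
      F (x.2 + (x.1 : ℂ) • EuclideanSpace.single i (1 : ℂ)) :=
    hFm.comp (Continuous.measurable (by fun_prop))
  have hmain : ENNReal.ofReal (2 * δ) * ∫⁻ z, F z ∂lebesgueCn (m + 1) ≤
      ENNReal.ofReal (2 ^ |α| * (δ ^ (α + 1) / (α + 1))) * lebesgueCn (m + 1) S' := by
    calc ENNReal.ofReal (2 * δ) * ∫⁻ z, F z ∂lebesgueCn (m + 1)
        = ∫⁻ t in Ioo 0 (2 * δ), (∫⁻ z, F (z + (t : ℂ) • EuclideanSpace.single i (1 : ℂ))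
            ∂lebesgueCn (m + 1)) := by
          simp_rw [lintegral_add_right_eq_self (μ := lebesgueCn (m + 1)) F]
          rw [lintegral_const, mul_comm]; simp
      _ = ∫⁻ z, (∫⁻ t in Ioo 0 (2 * δ), F (z + (t : ℂ) • EuclideanSpace.single i (1 : ℂ)))
            ∂lebesgueCn (m + 1) := lintegral_lintegral_swap hjoint.aemeasurable
      _ ≤ ∫⁻ z, S'.indicator
            (fun _ => ENNReal.ofReal (2 ^ |α| * (δ ^ (α + 1) / (α + 1)))) z
            ∂lebesgueCn (m + 1) := by
          refine lintegral_mono fun z => ?_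
          by_cases hz : z ∈ S'
          · rw [indicator_of_mem hz]
            exact (setLIntegral_le_lintegral _ _).trans (lintegral_chord_le hα hδ0 hδ z)
          · rw [indicator_of_notMem hz, setLIntegral_congr_fun measurableSet_Ioo (hsupp z hz)]
            simp
      _ = _ := by rw [lintegral_indicator hS'm, setLIntegral_const]
  have hmeas : weightedMeasure (m + 1) α S = L⁻¹ * ∫⁻ z, F z ∂lebesgueCn (m + 1) := by
    have h1 : weightedMeasure (m + 1) α S = ∫⁻ z, S.indicator 1 z ∂weightedMeasure (m + 1) α :=
      (lintegral_indicator_one hSm).symm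
    rw [h1, lintegral_weightedMeasure, lintegral_ballMeasure,
      ← lintegral_indicator measurableSet_unitBall]
    congr 1
    refine lintegral_congr fun z => ?_
    by_cases hz : z ∈ S
    · simp [hF, hz, hz.1]
    · simp [hF, hz]
  rw [hmeas, ENNReal.ofReal_mul' (by positivity) , ENNReal.ofReal_mul (by positivity),
    ENNReal.ofReal_inv_of_pos hLr, ENNReal.ofReal_toReal hLt, mul_assoc]
  gcongr
  rw [hvol, ← ENNReal.ofReal_mul (by positivity)] at hmain
  have h2δ : ENNReal.ofReal (2 * δ) ≠ 0 := by simpa using hδ0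
  rw [← ENNReal.mul_le_mul_iff_right h2δ ENNReal.ofReal_ne_top,
    ← ENNReal.ofReal_mul (by positivity), ← ENNReal.ofReal_mul (by positivity)]
  refine hmain.trans (le_of_eq ?_)
  congr 1
  have h5 : δ ^ (((m + 1 : ℕ) : ℝ) + 1 + α) = δ ^ (m + 1) * δ ^ (α + 1) := by
    rw [← Real.rpow_natCast δ (m + 1), ← Real.rpow_add hδ0]
    congr 1; ring
  rw [h5]
  ring

lemma lintegral_norm_one_sub_rpow_ne_top (hn : 1 ≤ n) {α c : ℝ} (hα : -1 < α) (hc : 0 < c)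
    (hcα : c < n + 1 + α) :
    ∫⁻ z, ENNReal.ofReal (‖1 - z ⟨0, hn⟩‖ ^ (-c)) ∂weightedMeasure n α ≠ ⊤ := by
  obtain ⟨C, hC, hcap⟩ := weightedMeasure_boundaryCap_le hn hα
  have hfin := isFiniteMeasure_weightedMeasure hn hα
  set i : Fin n := ⟨0, hn⟩ with hi
  set T : ℕ → Set (Cn n) := fun j => boundaryCap i ((1 / 2) ^ j * (1 / 4)) with hT
  set s : ℝ := n + 1 + α with hs
  set ρ : ℝ := (1 / 2) ^ (s - c) with hρ
  have hρ0 : 0 < ρ := by positivity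
  have hρ1 : ρ < 1 := Real.rpow_lt_one (by norm_num) (by norm_num) (by linarith)
  -- on the dyadic shell with index `j`, the distance to `1` is at least `2^(-j) / 16`
  have hle : ∀ z ∈ unitBall n, ENNReal.ofReal (‖1 - z i‖ ^ (-c)) ≤ ENNReal.ofReal (8 ^ c) +
      ∑' j, (T j).indicator (fun _ => ENNReal.ofReal (((1 / 2) ^ j * (1 / 16)) ^ (-c))) z := by
    intro z hz
    set d := ‖1 - z i‖ with hd
    have hd0 : 0 < d := by
      have h1 : ‖z i‖ < 1 := (norm_apply_le i z).trans_lt (mem_unitBall.1 hz)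
      have h2 : 1 - ‖z i‖ ≤ d := by simpa using norm_sub_norm_le (1 : ℂ) (z i)
      linarith
    rcases le_or_gt (1 / 8) d with h | h
    · refine le_add_right (ENNReal.ofReal_le_ofReal ?_)
      calc d ^ (-c) ≤ (1 / 8) ^ (-c) :=
            Real.rpow_le_rpow_of_nonpos (by norm_num) h (by linarith)
        _ = 8 ^ c := by rw [one_div, Real.inv_rpow (by norm_num), Real.rpow_neg (by norm_num),
            inv_inv]
    · obtain ⟨j, hj1, hj2⟩ := exists_nat_pow_near_of_lt_one (x := 8 * d) (y := 1 / 2)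
        (by positivity) (by linarith) (by norm_num) (by norm_num)
      have hzT : z ∈ T j := ⟨hz, by
        have : (0 : ℝ) < (1 / 2) ^ j := by positivity
        linarith⟩
      refine le_add_left (le_trans ?_ (ENNReal.le_tsum j))
      rw [indicator_of_mem hzT]
      refine ENNReal.ofReal_le_ofReal
        (Real.rpow_le_rpow_of_nonpos (by positivity) ?_ (by linarith))
      rw [pow_succ] at hj1
      linarith
  refine ne_top_of_le_ne_top ?_ (lintegral_mono_ae
    ((ae_weightedMeasure_mem_unitBall n α).mono hle))
  rw [lintegral_add_left measurable_const, lintegral_const, lintegral_tsum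
    fun j => (measurable_const.indicator (measurableSet_boundaryCap _ _)).aemeasurable]
  refine ENNReal.add_ne_top.2 ⟨ENNReal.mul_ne_top ENNReal.ofReal_ne_top (measure_ne_top _ _), ?_⟩
  have hterm : ∀ j, ∫⁻ z, (T j).indicator
      (fun _ => ENNReal.ofReal (((1 / 2) ^ j * (1 / 16)) ^ (-c))) z ∂weightedMeasure n α ≤
      ENNReal.ofReal ((1 / 16) ^ (-c) * (C * (1 / 4) ^ s) * ρ ^ j) := by
    intro j
    rw [lintegral_indicator (measurableSet_boundaryCap _ _), setLIntegral_const]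
    have h2 : (1 / 2 : ℝ) ^ j ≤ 1 := pow_le_one₀ (by norm_num) (by norm_num)
    have h3 : (0 : ℝ) < (1 / 2) ^ j := by positivity
    calc _ ≤ ENNReal.ofReal (((1 / 2) ^ j * (1 / 16)) ^ (-c)) *
          ENNReal.ofReal (C * ((1 / 2) ^ j * (1 / 4)) ^ s) := by
          gcongr
          exact hcap _ (by positivity) (by linarith)
      _ = _ := by
          rw [← ENNReal.ofReal_mul (by positivity)]
          congr 1
          have h4 : ρ ^ j = ((1 / 2) ^ j) ^ s * ((1 / 2) ^ j) ^ (-c) := by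
            rw [← Real.rpow_add h3, hρ, ← Real.rpow_natCast, ← Real.rpow_natCast,
              ← Real.rpow_mul (by norm_num), ← Real.rpow_mul (by norm_num), mul_comm,
              sub_eq_add_neg]
          rw [h4, Real.mul_rpow h3.le (by norm_num), Real.mul_rpow h3.le (by norm_num)]
          ring
  refine ne_top_of_le_ne_top ?_ (ENNReal.tsum_le_tsum hterm)
  have hsum : Summable fun j : ℕ => (1 / 16) ^ (-c) * (C * (1 / 4) ^ s) * ρ ^ j :=
    (summable_geometric_of_lt_one hρ0.le hρ1).mul_left _
  exact hsum.tsum_ofReal_ne_top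

/-- The function `u (1 - z_0)^(-s)`. -/
def testFunction (hn : 1 ≤ n) (s : ℝ) (u : ℂ) : Cn n → ℂ :=
  fun z => u * (1 - z ⟨0, hn⟩) ^ (-s : ℂ)

lemma testFunction_mem_bergmanSpace (hn : 1 ≤ n) {p α s : ℝ} (hp : 0 < p) (hα : -1 < α)
    (hs : 0 < s) (hsp : s * p < n + 1 + α) (u : ℂ) :
    testFunction hn s u ∈ bergmanSpace n p α := by
  rw [mem_bergmanSpace_iff hp]
  constructor
  · refine DifferentiableOn.const_mul (fun z hz => ?_) u
    refine DifferentiableWithinAt.cpow_const ?_ ?_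
    · exact DifferentiableAt.differentiableWithinAt (by fun_prop)
    · left
      have h1 : ‖z ⟨0, hn⟩‖ < 1 := (norm_apply_le _ z).trans_lt (mem_unitBall.1 hz)
      have h2 := (Complex.re_le_norm (z ⟨0, hn⟩)).trans_lt h1
      simpa using h2
  · have h1 : ∀ z : Cn n, ‖testFunction hn s u z‖ₑ ^ p =
        ENNReal.ofReal (‖u‖ ^ p) * ENNReal.ofReal (‖1 - z ⟨0, hn⟩‖ ^ (-(s * p))) := by
      intro z
      rw [testFunction, ← ENNReal.ofReal_mul (by positivity), ← ofReal_norm,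
        ENNReal.ofReal_rpow_of_nonneg (norm_nonneg _) hp.le, norm_mul, ← Complex.ofReal_neg,
        Complex.norm_cpow_real, Real.mul_rpow (norm_nonneg _) (by positivity),
        ← Real.rpow_mul (norm_nonneg _), neg_mul]
    simp_rw [h1]
    rw [lintegral_const_mul' _ _ ENNReal.ofReal_ne_top]
    exact ENNReal.mul_ne_top ENNReal.ofReal_ne_top
      (lintegral_norm_one_sub_rpow_ne_top hn hα (by positivity) hsp)

/-! ### The symbol is a polynomial -/

open Filter Topology in
/-- Liouville's theorem for entire functions of polynomial growth. -/
lemma exists_polynomial_of_growth {φ : ℂ → ℂ} (hφ : Differentiable ℂ φ) {B : ℝ} (hB : 0 ≤ B)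
    (h : ∀ k : ℕ, B < k → ∃ M : ℝ, M < k ∧ ∃ C R : ℝ, ∀ w, R ≤ ‖w‖ → ‖φ w‖ ≤ C * ‖w‖ ^ M) :
    ∃ P : Polynomial ℂ, (∀ u, φ u = P.eval u) ∧ (P.natDegree : ℝ) ≤ B := by
  have hzero : ∀ k : ℕ, B < k → iteratedDeriv k φ 0 = 0 := by
    intro k hk
    obtain ⟨M, hM, C, R, hC⟩ := h k hk
    have hbound : ∀ᶠ r : ℝ in atTop, ‖iteratedDeriv k φ 0‖ ≤ k.factorial * C * r ^ (M - k) := by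
      filter_upwards [eventually_ge_atTop R, eventually_gt_atTop 0] with r hr hr0
      have h1 := Complex.norm_iteratedDeriv_le_of_forall_mem_sphere_norm_le (c := (0 : ℂ))
        (C := C * r ^ M) k hr0 hφ.diffContOnCl (fun z hz => by
          have hz' : ‖z‖ = r := by simpa using hz
          have := hC z (by rw [hz']; exact hr)
          rwa [hz'] at this)
      refine h1.trans (le_of_eq ?_)
      rw [Real.rpow_sub hr0, Real.rpow_natCast]
      ring
    have hlim : Tendsto (fun r : ℝ => k.factorial * C * r ^ (M - k)) atTop (𝓝 0) := by
      have := (tendsto_rpow_neg_atTop (y := k - M) (by linarith)).const_mul (k.factorial * C)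
      simpa using this
    exact norm_le_zero_iff.1 (ge_of_tendsto hlim hbound)
  refine ⟨∑ k ∈ Finset.range (⌊B⌋₊ + 1),
    Polynomial.monomial k ((k.factorial : ℂ)⁻¹ * iteratedDeriv k φ 0), fun u => ?_, ?_⟩
  · have h1 := Complex.hasSum_taylorSeries_of_entire hφ 0 u
    have h2 : HasSum (fun k : ℕ => (k.factorial : ℂ)⁻¹ • (u - 0) ^ k • iteratedDeriv k φ 0)
        (∑ k ∈ Finset.range (⌊B⌋₊ + 1),
          (k.factorial : ℂ)⁻¹ • (u - 0) ^ k • iteratedDeriv k φ 0) := by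
      refine hasSum_sum_of_ne_finset_zero fun k hk => ?_
      rw [hzero k, smul_zero, smul_zero]
      rw [Finset.mem_range, not_lt] at hk
      exact (Nat.lt_floor_add_one B).trans_le (by exact_mod_cast hk)
    rw [h1.unique h2, Polynomial.eval_finsetSum]
    refine Finset.sum_congr rfl fun k _ => ?_
    simp only [sub_zero, smul_eq_mul, Polynomial.eval_monomial]
    ring
  · refine le_trans ?_ (Nat.floor_le hB)
    exact_mod_cast Polynomial.natDegree_sum_le_of_forall_le _ _ fun k hk =>
      (Polynomial.natDegree_monomial_le _).trans (by rw [Finset.mem_range] at hk; omega)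

lemma exists_norm_le_of_mem_bergmanSpace (hn : 1 ≤ n) {q β : ℝ} (hq : 0 < q) {g : Cn n → ℂ}
    (hg : g ∈ bergmanSpace n q β) : ∃ D : ℝ, 0 ≤ D ∧ ∀ z ∈ unitBall n,
      ‖g z‖ ≤ D * (1 - ‖z‖ ^ 2) ^ (-((n + 1 + β) / q)) := by
  rw [mem_bergmanSpace_iff hq] at hg
  obtain ⟨C, hC, h⟩ := enorm_rpow_mul_weight_le hn hq β
  set I := ∫⁻ z, ‖g z‖ₑ ^ q ∂weightedMeasure n β
  refine ⟨(C * I.toReal) ^ (1 / q), by positivity, fun z hz => ?_⟩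
  have hK := one_sub_norm_sq_pos hz
  have h1 : _ ≤ ENNReal.ofReal C * I := h g hg.1 z hz
  rw [← ofReal_norm, ENNReal.ofReal_rpow_of_nonneg (norm_nonneg _) hq.le,
    ← ENNReal.ofReal_mul (by positivity), ← ENNReal.ofReal_toReal hg.2,
    ← ENNReal.ofReal_mul hC.le, ENNReal.ofReal_le_ofReal_iff (by positivity)] at h1
  have h2 := Real.rpow_le_rpow (by positivity) h1 (one_div_nonneg.2 hq.le)
  rw [Real.mul_rpow (by positivity) (by positivity), ← Real.rpow_mul (norm_nonneg _),
    mul_one_div_cancel hq.ne', Real.rpow_one, ← Real.rpow_mul hK.le, mul_one_div] at h2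
  rw [Real.rpow_neg hK.le, ← div_eq_mul_inv, le_div_iff₀ (by positivity)]
  exact h2

lemma differentiable_of_mapsTo (hn : 1 ≤ n) {p q α β : ℝ} (hp : 0 < p) (hα : -1 < α) {φ : ℂ → ℂ}
    (h : MapsTo (superposition φ) (bergmanSpace n p α) (bergmanSpace n q β)) :
    Differentiable ℂ φ := by
  intro w
  set i : Fin n := ⟨0, hn⟩
  set R : ℝ := ‖w‖ + 1 with hR
  have hR0 : 0 < R := by positivity
  have hR0' : (R : ℂ) ≠ 0 := by exact_mod_cast hR0.ne'
  set f : Cn n → ℂ := fun z => R * z i with hf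
  have hfd : Differentiable ℂ f := by fun_prop
  have hfmem : f ∈ bergmanSpace n p α := by
    refine mem_bergmanSpace_of_bounded hn hp hα hfd.differentiableOn (M := R) fun z hz => ?_
    rw [hf, norm_mul, Complex.norm_real, Real.norm_of_nonneg hR0.le]
    exact mul_le_of_le_one_right hR0.le ((norm_apply_le i z).trans (mem_unitBall.1 hz).le)
  have hd := (h hfmem).1
  set g : ℂ → Cn n := fun u => (u / R) • EuclideanSpace.single i (1 : ℂ) with hg
  have hgd : Differentiable ℂ g := by fun_prop
  have hgw : g w ∈ unitBall n := by
    rw [mem_unitBall, hg, norm_smul, norm_div, Complex.norm_real, Real.norm_of_nonneg hR0.le]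
    simp only [PiLp.norm_single, norm_one, mul_one]
    rw [div_lt_one hR0]
    linarith
  have hcomp : φ = superposition φ f ∘ g := by
    ext u
    simp only [superposition, Function.comp, hf, hg]
    congr 1
    simp
    field_simp
  rw [hcomp]
  exact (hd.differentiableAt (isOpen_unitBall.mem_nhds hgw)).comp w hgd.differentiableAt

open Filter Topology in
/-- Composing `φ` with `u₀ (1 - z_0)^(-s)` and approaching the singularity in a Stolz angle bounds
`φ` in a sector around the direction `u₀`. -/
lemma exists_growth_near_direction (hn : 1 ≤ n) {p q α β : ℝ} (hp : 0 < p) (hq : 0 < q)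
    (hα : -1 < α) (hβ : -1 < β) {φ : ℂ → ℂ}
    (h : MapsTo (superposition φ) (bergmanSpace n p α) (bergmanSpace n q β)) {s : ℝ} (hs : 0 < s)
    (hsp : s * p < n + 1 + α) {u₀ : ℂ} (hu₀ : ‖u₀‖ = 1) :
    ∃ t ∈ 𝓝 u₀, ∃ C : ℝ, ∀ v ∈ t, ‖v‖ = 1 → ∀ ρ : ℝ, 2 ^ s ≤ ρ →
      ‖φ (ρ * v)‖ ≤ C * ρ ^ ((n + 1 + β) / (q * s)) := by
  have hu0 : u₀ ≠ 0 := norm_pos_iff.1 (by rw [hu₀]; exact one_pos)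
  obtain ⟨D, hD, hbound⟩ := exists_norm_le_of_mem_bergmanSpace hn hq
    (h (testFunction_mem_bergmanSpace hn hp hα hs hsp u₀))
  set i : Fin n := ⟨0, hn⟩ with hi
  set e : ℝ := (n + 1 + β) / q with he
  have he0 : 0 < e := div_pos (by linarith [(Nat.cast_nonneg n : (0 : ℝ) ≤ n)]) hq
  have hlog : Tendsto (fun v : ℂ => |(Complex.log (v / u₀)).im / s|) (𝓝 u₀) (𝓝 0) := by
    have h1 : ContinuousAt (fun v : ℂ => |(Complex.log (v / u₀)).im / s|) u₀ := by
      have h2 : ContinuousAt (fun v : ℂ => Complex.log (v / u₀)) u₀ := by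
        refine ContinuousAt.clog (by fun_prop) ?_
        rw [div_self hu0]; exact Complex.one_mem_slitPlane
      exact ((Complex.continuous_im.continuousAt.comp h2).div_const s).abs
    have h3 := h1.tendsto
    simpa [div_self hu0] using h3
  refine ⟨_, hlog.eventually (gt_mem_nhds one_pos), D * 2 ^ e, fun v hv hv1 ρ hρ => ?_⟩
  have hρ0 : 0 < ρ := lt_of_lt_of_le (by positivity) hρ
  replace hv : |(Complex.log (v / u₀)).im / s| < 1 := hv
  set x := v / u₀ with hx
  have hx1 : ‖x‖ = 1 := by rw [hx, norm_div, hv1, hu₀, div_one]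
  have hx0 : x ≠ 0 := norm_pos_iff.1 (by rw [hx1]; exact one_pos)
  -- With `ζ = exp y`, the point `1 - ζ` is where the test function takes the value `ρ v`.
  set y : ℂ := -(Complex.log x + Real.log ρ) / s with hy
  have hyre : y.re = -(Real.log ρ) / s := by
    rw [hy, Complex.div_ofReal_re]
    simp [Complex.log_re, hx1]
  have hyim : y.im = -((Complex.log x).im / s) := by
    rw [hy, Complex.div_ofReal_im]
    simp [neg_div]
  have hyim1 : |y.im| < 1 := by rw [hyim, abs_neg]; exact hv
  set ζ := Complex.exp y with hζ
  have hζn : ‖ζ‖ = ρ ^ (-(1 / s)) := by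
    rw [hζ, Complex.norm_exp, hyre, Real.rpow_def_of_pos hρ0]
    congr 1; ring
  have hζhalf : ‖ζ‖ ≤ 1 / 2 := by
    rw [hζn, Real.rpow_neg hρ0.le, one_div, ]
    have h1 : (2 : ℝ) ≤ ρ ^ s⁻¹ := by
      have := Real.rpow_le_rpow (by positivity) hρ (inv_nonneg.2 hs.le)
      rwa [← Real.rpow_mul (by norm_num), mul_inv_cancel₀ hs.ne', Real.rpow_one] at this
    rw [one_div]
    gcongr
  have hζpos : 0 < ‖ζ‖ := by rw [hζn]; positivity
  have hζre : ‖ζ‖ / 2 ≤ ζ.re := by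
    have h1 : ζ.re = ‖ζ‖ * Real.cos y.im := by
      rw [hζ, Complex.exp_re, Complex.norm_exp]
    have h2 := Real.one_sub_sq_div_two_le_cos (x := y.im)
    have h3 : y.im ^ 2 ≤ 1 := by
      rw [← sq_abs]; exact pow_le_one₀ (abs_nonneg _) hyim1.le
    rw [h1]
    nlinarith
  set z : Cn n := EuclideanSpace.single i (1 - ζ) with hz
  have hzK : ‖ζ‖ / 2 ≤ 1 - ‖z‖ ^ 2 := by
    have h1 : ‖z‖ ^ 2 = 1 - 2 * ζ.re + ‖ζ‖ ^ 2 := by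
      rw [hz, PiLp.norm_single, ← Complex.normSq_eq_norm_sq, ← Complex.normSq_eq_norm_sq,
        Complex.normSq_apply, Complex.normSq_apply]
      simp
      ring
    rw [h1]
    nlinarith
  have hzmem : z ∈ unitBall n := by
    rw [mem_unitBall]
    nlinarith [norm_nonneg z]
  have hlogζ : Complex.log ζ = y := by
    have := abs_lt.1 hyim1
    exact Complex.log_exp (by linarith [Real.pi_gt_three]) (by linarith [Real.pi_gt_three])
  have hval : testFunction hn s u₀ z = ρ * v := by
    have h1 : z ⟨0, hn⟩ = 1 - ζ := by simp [hz, hi]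
    have h2 : ζ ^ (-s : ℂ) = x * ρ := by
      have hs' : (s : ℂ) ≠ 0 := by exact_mod_cast hs.ne'
      rw [Complex.cpow_def_of_ne_zero (Complex.exp_ne_zero y), ← hζ, hlogζ]
      have h3 : y * -(s : ℂ) = Complex.log x + Real.log ρ := by
        rw [hy]; field_simp
      rw [h3, Complex.exp_add, Complex.exp_log hx0, ← Complex.ofReal_exp, Real.exp_log hρ0]
    rw [testFunction, h1, sub_sub_cancel, h2, hx]
    field_simp
  have h1 := hbound z hzmem
  rw [superposition, hval] at h1
  refine h1.trans ?_
  rw [mul_assoc]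
  refine mul_le_mul_of_nonneg_left ?_ hD
  calc (1 - ‖z‖ ^ 2) ^ (-e) ≤ (‖ζ‖ / 2) ^ (-e) :=
        Real.rpow_le_rpow_of_nonpos (by positivity) hzK (by linarith)
    _ = 2 ^ e * ρ ^ ((n + 1 + β) / (q * s)) := by
        rw [Real.div_rpow hζpos.le (by norm_num), Real.rpow_neg (by norm_num : (0 : ℝ) ≤ 2),
          div_inv_eq_mul, hζn, ← Real.rpow_mul hρ0.le, mul_comm]
        congr 2
        rw [he]; field_simp

open Filter Topology in
/-- The bounds in sectors are made uniform by compactness of the unit circle. -/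
lemma exists_growth (hn : 1 ≤ n) {p q α β : ℝ} (hp : 0 < p) (hq : 0 < q)
    (hα : -1 < α) (hβ : -1 < β) {φ : ℂ → ℂ}
    (h : MapsTo (superposition φ) (bergmanSpace n p α) (bergmanSpace n q β)) {s : ℝ} (hs : 0 < s)
    (hsp : s * p < n + 1 + α) :
    ∃ C R : ℝ, ∀ w, R ≤ ‖w‖ → ‖φ w‖ ≤ C * ‖w‖ ^ ((n + 1 + β) / (q * s)) := by
  have hcpt : ∃ C : ℝ, ∀ v ∈ Metric.sphere (0 : ℂ) 1, ∀ ρ : ℝ, 2 ^ s ≤ ρ →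
      ‖φ (ρ * v)‖ ≤ C * ρ ^ ((n + 1 + β) / (q * s)) := by
    refine (isCompact_sphere (0 : ℂ) 1).induction_on
      (p := fun S => ∃ C : ℝ, ∀ v ∈ S, ∀ ρ : ℝ, 2 ^ s ≤ ρ →
        ‖φ (ρ * v)‖ ≤ C * ρ ^ ((n + 1 + β) / (q * s)))
      ⟨0, by simp⟩ (fun S T hST ⟨C, hC⟩ => ⟨C, fun v hv => hC v (hST hv)⟩) ?_ ?_
    · rintro S T ⟨C, hC⟩ ⟨C', hC'⟩
      refine ⟨max C C', fun v hv ρ hρ => ?_⟩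
      have hρ0 : 0 < ρ := lt_of_lt_of_le (by positivity) hρ
      rcases hv with hv | hv
      · exact (hC v hv ρ hρ).trans (by gcongr; exact le_max_left _ _)
      · exact (hC' v hv ρ hρ).trans (by gcongr; exact le_max_right _ _)
    · intro u hu
      obtain ⟨t, ht, C, hC⟩ := exists_growth_near_direction hn hp hq hα hβ h hs hsp
        (u₀ := u) (by simpa using hu)
      refine ⟨t ∩ Metric.sphere 0 1, inter_mem (mem_nhdsWithin_of_mem_nhds ht)
        self_mem_nhdsWithin, C, fun v hv => hC v hv.1 (by simpa using hv.2)⟩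
  obtain ⟨C, hC⟩ := hcpt
  refine ⟨C, 2 ^ s, fun w hw => ?_⟩
  have hw0 : 0 < ‖w‖ := lt_of_lt_of_le (by positivity) hw
  have hw0' : (‖w‖ : ℂ) ≠ 0 := by exact_mod_cast hw0.ne'
  have := hC (w / ‖w‖) (by simp [hw0.ne']) ‖w‖ hw
  rwa [mul_div_cancel₀ _ hw0'] at this

/-- A symbol acting from `A^p_α` to `A^q_β` is a polynomial, of degree at most the ratio of the
critical growth exponents. -/
lemma exists_polynomial_of_mapsTo (hn : 1 ≤ n) {p q α β : ℝ} (hp : 0 < p) (hq : 0 < q)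
    (hα : -1 < α) (hβ : -1 < β) {φ : ℂ → ℂ}
    (h : MapsTo (superposition φ) (bergmanSpace n p α) (bergmanSpace n q β)) :
    ∃ P : Polynomial ℂ, (∀ u, φ u = P.eval u) ∧
      (P.natDegree : ℝ) ≤ p * (n + 1 + β) / (q * (n + 1 + α)) := by
  have hn0 : (0 : ℝ) ≤ n := Nat.cast_nonneg n
  have hα1 : 0 < n + 1 + α := by linarith
  have hβ1 : 0 < n + 1 + β := by linarith
  have hB : 0 ≤ p * (n + 1 + β) / (q * (n + 1 + α)) := by positivity
  refine exists_polynomial_of_growth (differentiable_of_mapsTo hn hp hα h) hB fun k hk => ?_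
  have hk0 : (0 : ℝ) < k := hB.trans_lt hk
  have hlt : (n + 1 + β) / (q * k) < (n + 1 + α) / p := by
    rw [div_lt_iff₀ (by positivity)] at hk
    rw [div_lt_div_iff₀ (by positivity) hp]
    linarith
  obtain ⟨s, hs1, hs2⟩ := exists_between hlt
  have hs0 : 0 < s := lt_trans (by positivity) hs1
  rw [lt_div_iff₀ hp] at hs2
  rw [div_lt_iff₀ (by positivity)] at hs1
  refine ⟨_, ?_, exists_growth hn hp hq hα hβ h hs0 hs2⟩
  rw [div_lt_iff₀ (by positivity)]
  linarith

/-! ### A radial profile separating the two integrability conditions -/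

lemma weightedMeasure_univ_anti {a b : ℝ} (hab : a ≤ b) :
    weightedMeasure n b univ ≤ weightedMeasure n a univ := by
  rw [← lintegral_one, ← lintegral_one, lintegral_weightedMeasure, lintegral_weightedMeasure]
  refine lintegral_mono_ae ?_
  filter_upwards [ae_mem_unitBall n] with z hz
  have hK := one_sub_norm_sq_pos hz
  have := Real.rpow_le_rpow_of_exponent_ge hK (by linarith [sq_nonneg ‖z‖]) hab
  gcongr

lemma lintegral_const_mul_weight_rpow {α s c P : ℝ} (hc : 0 < c) :
    ∫⁻ z : Cn n, ENNReal.ofReal (c * (1 - ‖z‖ ^ 2) ^ (-s)) ^ P ∂weightedMeasure n α =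
      ENNReal.ofReal (c ^ P) * weightedMeasure n (α - s * P) univ := by
  rw [← lintegral_one, lintegral_weightedMeasure, lintegral_weightedMeasure,
    ← lintegral_const_mul' _ _ ENNReal.ofReal_ne_top]
  refine lintegral_congr_ae ?_
  filter_upwards [ae_mem_unitBall n] with z hz
  have hK := one_sub_norm_sq_pos hz
  rw [ENNReal.ofReal_rpow_of_pos (by positivity), ← ENNReal.ofReal_mul (by positivity), mul_one,
    ← ENNReal.ofReal_mul (by positivity), Real.mul_rpow hc.le (by positivity),
    ← Real.rpow_mul hK.le, mul_left_comm, ← Real.rpow_add hK]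
  congr 3
  ring

/-- The power of a sum is controlled by the sum of the powers, at the cost of a geometric
weight. -/
lemma tsum_rpow_le {θ P : ℝ} (hθ : 0 < θ) (hP : 0 < P) (u : ℕ → ENNReal) :
    (∑' j, u j) ^ P ≤ (∑' j, ENNReal.ofReal (θ ^ j)) ^ P *
      ∑' j, (ENNReal.ofReal ((θ ^ j)⁻¹) * u j) ^ P := by
  set S := ∑' j, (ENNReal.ofReal ((θ ^ j)⁻¹) * u j) ^ P with hS
  have h1 : ∀ j, u j ≤ ENNReal.ofReal (θ ^ j) * S ^ (1 / P) := by
    intro j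
    have h2 : ENNReal.ofReal ((θ ^ j)⁻¹) * u j ≤ S ^ (1 / P) := by
      have h3 := ENNReal.rpow_le_rpow
        (ENNReal.le_tsum (f := fun j => (ENNReal.ofReal ((θ ^ j)⁻¹) * u j) ^ P) j)
        (one_div_nonneg.2 hP.le)
      rwa [← ENNReal.rpow_mul, mul_one_div_cancel hP.ne', ENNReal.rpow_one] at h3
    calc u j = ENNReal.ofReal (θ ^ j) * (ENNReal.ofReal ((θ ^ j)⁻¹) * u j) := by
          rw [← mul_assoc, ← ENNReal.ofReal_mul (by positivity),
            mul_inv_cancel₀ (by positivity), ENNReal.ofReal_one, one_mul]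
      _ ≤ _ := by gcongr
  calc (∑' j, u j) ^ P ≤ (∑' j, ENNReal.ofReal (θ ^ j) * S ^ (1 / P)) ^ P :=
        ENNReal.rpow_le_rpow (ENNReal.tsum_le_tsum h1) hP.le
    _ = _ := by
        rw [ENNReal.tsum_mul_right, ENNReal.mul_rpow_of_nonneg _ _ hP.le, ← ENNReal.rpow_mul,
          one_div_mul_cancel hP.ne', ENNReal.rpow_one]

lemma hasSum_one_sub_rpow_neg (t : ℝ) {x : ℝ} (hx : x ∈ Ico (0 : ℝ) 1) :
    HasSum (fun d : ℕ => Ring.choose (t + d - 1) d * x ^ d) ((1 - x) ^ (-t)) := by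
  have h := (Real.one_div_one_sub_rpow_hasFPowerSeriesOnBall_zero t).hasSum (y := x) (by
    simp only [Metric.mem_eball, edist_zero_right]
    rw [← ofReal_norm, Real.norm_of_nonneg hx.1]
    simpa using hx.2)
  simp only [FormalMultilinearSeries.ofScalars_apply_eq, zero_add, smul_eq_mul] at h
  rw [Real.rpow_neg (by linarith [hx.2]), ← one_div]
  exact h

lemma ring_choose_nonneg {t : ℝ} (ht : 0 < t) (d : ℕ) : 0 ≤ Ring.choose (t + d - 1) d := by
  have h := Ring.factorial_nsmul_multichoose_eq_ascPochhammer (t : ℝ) d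
  have h1 : Ring.choose (t + d - 1) d = Ring.multichoose t d := by
    rw [Ring.choose]; congr 1; ring
  rw [h1]
  rw [Polynomial.ascPochhammer_smeval_eq_eval, nsmul_eq_mul] at h
  have h2 := ascPochhammer_pos d t ht
  rw [← h] at h2
  exact (pos_of_mul_pos_right h2 (by positivity)).le

/-- The exponents `t - (t/2) 2^(-j)`, which increase to `t`. -/
def profileExponent (t : ℝ) (j : ℕ) : ℝ := t - t / 2 * (1 / 2) ^ j

lemma profileExponent_pos {t : ℝ} (ht : 0 < t) (j : ℕ) : 0 < profileExponent t j := by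
  have : t / 2 * (1 / 2) ^ j ≤ t / 2 :=
    mul_le_of_le_one_right (by positivity) (pow_le_one₀ (by norm_num) (by norm_num))
  unfold profileExponent
  linarith

/-- The profile `∑ γ^j (1 - x)^(-t_j)`, with `t_j` increasing to `t`. -/
def radialProfile (γ t x : ℝ) : ℝ := ∑' j : ℕ, γ ^ j * (1 - x) ^ (-profileExponent t j)

lemma radialProfile_term_nonneg {γ : ℝ} (hγ : 0 < γ) (t : ℝ) {x : ℝ} (hx : x ∈ Ico (0 : ℝ) 1)
    (j : ℕ) : 0 ≤ γ ^ j * (1 - x) ^ (-profileExponent t j) :=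
  mul_nonneg (by positivity) (Real.rpow_nonneg (by linarith [hx.2]) _)

lemma summable_radialProfile {γ t : ℝ} (hγ0 : 0 < γ) (hγ1 : γ < 1) (ht : 0 < t) {x : ℝ}
    (hx : x ∈ Ico (0 : ℝ) 1) :
    Summable fun j : ℕ => γ ^ j * (1 - x) ^ (-profileExponent t j) := by
  have hx1 : 0 < 1 - x := by linarith [hx.2]
  refine Summable.of_nonneg_of_le (radialProfile_term_nonneg hγ0 t hx) (fun j => ?_)
    ((summable_geometric_of_lt_one hγ0.le hγ1).mul_right ((1 - x) ^ (-t)))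
  refine mul_le_mul_of_nonneg_left ?_ (by positivity)
  refine Real.rpow_le_rpow_of_exponent_ge hx1 (by linarith [hx.1]) ?_
  have : 0 < t / 2 * (1 / 2) ^ j := by positivity
  unfold profileExponent
  linarith

lemma hasSum_radialProfile {γ t : ℝ} (hγ0 : 0 < γ) (hγ1 : γ < 1) (ht : 0 < t) :
    ∃ h : ℕ → ℝ, (∀ d, 0 ≤ h d) ∧
      ∀ x ∈ Ico (0 : ℝ) 1, HasSum (fun d => h d * x ^ d) (radialProfile γ t x) := by
  set a : ℕ → ℕ → ℝ := fun j d => γ ^ j * Ring.choose (profileExponent t j + d - 1) d with ha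
  have ha0 : ∀ j d, 0 ≤ a j d := fun j d =>
    mul_nonneg (by positivity) (ring_choose_nonneg (profileExponent_pos ht j) d)
  refine ⟨fun d => ∑' j, a j d, fun d => tsum_nonneg fun j => ha0 j d, fun x hx => ?_⟩
  have hrow : ∀ j, HasSum (fun d => a j d * x ^ d)
      (γ ^ j * (1 - x) ^ (-profileExponent t j)) := by
    intro j
    simp only [ha, mul_assoc]
    exact (hasSum_one_sub_rpow_neg (profileExponent t j) hx).mul_left _
  have hsum : Summable fun y : ℕ × ℕ => a y.1 y.2 * x ^ y.2 := by
    rw [summable_prod_of_nonneg fun y => mul_nonneg (ha0 _ _) (pow_nonneg hx.1 _)]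
    refine ⟨fun j => (hrow j).summable, ?_⟩
    have : (fun j => ∑' d, a j d * x ^ d) =
        fun j => γ ^ j * (1 - x) ^ (-profileExponent t j) := funext fun j => (hrow j).tsum_eq
    exact this ▸ summable_radialProfile hγ0 hγ1 ht hx
  have h2 : (fun d => (∑' j, a j d) * x ^ d) = fun d => ∑' j, a j d * x ^ d :=
    funext fun d => tsum_mul_right.symm
  have h3 : radialProfile γ t x = ∑' d, ∑' j, a j d * x ^ d := by
    rw [hsum.tsum_comm]
    exact tsum_congr fun j => (hrow j).tsum_eq.symm
  rw [h2, h3]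
  exact (hsum.prod_symm.prod).hasSum

lemma norm_sq_mem_Ico {z : Cn n} (hz : z ∈ unitBall n) : ‖z‖ ^ 2 ∈ Ico (0 : ℝ) 1 :=
  ⟨by positivity, by linarith [one_sub_norm_sq_pos hz]⟩

/-- For `t P = α + 1` the `P`-th power of the summand with index `j` has integral of order
`(2 γ^P)^j`, and `2 γ^P < 1`. -/
lemma lintegral_radialProfile_ne_top (hn : 1 ≤ n) {γ t P α : ℝ} (hγ0 : 0 < γ) (ht0 : 0 < t)
    (hP : 0 < P) (htP : t * P = α + 1) (hγP : γ * 2 ^ (1 / P) < 1) :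
    ∫⁻ z : Cn n, ENNReal.ofReal (radialProfile γ t (‖z‖ ^ 2)) ^ P ∂weightedMeasure n α ≠ ⊤ := by
  -- the geometric weight `θ` is chosen so that `2 (γ / θ)^P < 1`
  obtain ⟨θ, hθ1, hθ2⟩ : ∃ θ : ℝ, γ * 2 ^ (1 / P) < θ ∧ θ < 1 := exists_between hγP
  have hγ1 : γ < 1 := by
    have : (1 : ℝ) ≤ 2 ^ (1 / P) := Real.one_le_rpow (by norm_num) (by positivity)
    nlinarith
  set η : ℕ → ℝ := fun j => t / 2 * (1 / 2) ^ j with hη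
  have hη0 : ∀ j, 0 < η j := fun j => by simp only [hη]; positivity
  have hθ0 : 0 < θ := lt_trans (by positivity) hθ1
  set ρ : ℝ := (γ / θ) ^ P * 2 with hρ
  have hρ0 : 0 < ρ := by positivity
  have hρ1 : ρ < 1 := by
    have h1 : γ / θ < (2 ^ (1 / P))⁻¹ := by
      rw [div_lt_iff₀ hθ0, inv_mul_eq_div, lt_div_iff₀ (by positivity)]
      exact hθ1
    have h2 := Real.rpow_lt_rpow (by positivity) h1 hP
    rw [Real.inv_rpow (by positivity), ← Real.rpow_mul (by norm_num), one_div_mul_cancel hP.ne',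
      Real.rpow_one] at h2
    rw [hρ]; linarith
  have hA : (∑' j, ENNReal.ofReal (θ ^ j)) ^ P ≠ ⊤ :=
    ENNReal.rpow_ne_top_of_nonneg hP.le
      (summable_geometric_of_lt_one hθ0.le hθ2).tsum_ofReal_ne_top
  refine ne_top_of_le_ne_top (b := (∑' j, ENNReal.ofReal (θ ^ j)) ^ P *
    ∑' j, ENNReal.ofReal (n * 2 / (t * P) * ρ ^ j)) (ENNReal.mul_ne_top hA
    ((summable_geometric_of_lt_one hρ0.le hρ1).mul_left _).tsum_ofReal_ne_top) ?_
  calc ∫⁻ z : Cn n, ENNReal.ofReal (radialProfile γ t (‖z‖ ^ 2)) ^ P ∂weightedMeasure n α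
      ≤ ∫⁻ z : Cn n, (∑' j, ENNReal.ofReal (θ ^ j)) ^ P *
        ∑' j, ENNReal.ofReal ((θ ^ j)⁻¹ * γ ^ j * (1 - ‖z‖ ^ 2) ^ (-profileExponent t j)) ^ P
        ∂weightedMeasure n α := by
        refine lintegral_mono_ae ?_
        filter_upwards [ae_weightedMeasure_mem_unitBall n α] with z hz
        unfold radialProfile
        rw [ENNReal.ofReal_tsum_of_nonneg (radialProfile_term_nonneg hγ0 t
            (norm_sq_mem_Ico hz)) (summable_radialProfile hγ0 hγ1 ht0 (norm_sq_mem_Ico hz))]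
        refine (tsum_rpow_le hθ0 hP _).trans (le_of_eq ?_)
        congr 1
        refine tsum_congr fun j => ?_
        rw [← ENNReal.ofReal_mul (by positivity), mul_assoc]
    _ = (∑' j, ENNReal.ofReal (θ ^ j)) ^ P * ∑' j,
        ENNReal.ofReal (((θ ^ j)⁻¹ * γ ^ j) ^ P) *
          weightedMeasure n (α - profileExponent t j * P) univ := by
        rw [lintegral_const_mul' _ _ hA, lintegral_tsum fun j => by fun_prop]
        congr 1
        refine tsum_congr fun j => ?_
        rw [lintegral_const_mul_weight_rpow (by positivity)]
    _ ≤ _ := by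
        gcongr with j
        have h1 : α - profileExponent t j * P = η j * P - 1 := by
          simp only [profileExponent, hη]; linear_combination -htP
        rw [h1]
        calc _ ≤ ENNReal.ofReal (((θ ^ j)⁻¹ * γ ^ j) ^ P) * ENNReal.ofReal (n / (η j * P)) := by
              gcongr
              exact weightedMeasure_univ_le hn (mul_pos (hη0 j) hP)
          _ = _ := by
              rw [← ENNReal.ofReal_mul (by positivity)]
              congr 1
              have h2 : ((θ ^ j)⁻¹ * γ ^ j) ^ P = ((γ / θ) ^ P) ^ j := by
                rw [← inv_pow, ← mul_pow, inv_mul_eq_div, ← Real.rpow_natCast,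
                  ← Real.rpow_natCast, ← Real.rpow_mul (by positivity),
                  ← Real.rpow_mul (by positivity), mul_comm]
              rw [h2, hρ, mul_pow, hη]
              simp only [one_div, inv_pow]
              field_simp

/-- The `Q`-th powers of the summands alone have integrals of order at least `(2 γ^Q)^j`, which is
unbounded in `j`. -/
lemma lintegral_radialProfile_eq_top (hn : 1 ≤ n) {γ t Q β : ℝ} (hγ0 : 0 < γ) (hγ1 : γ < 1)
    (ht0 : 0 < t) (hQ : 0 < Q) (htQ : β + 1 ≤ t * Q) (hγQ : 1 < γ ^ Q * 2) :
    ∫⁻ z : Cn n, ENNReal.ofReal (radialProfile γ t (‖z‖ ^ 2)) ^ Q ∂weightedMeasure n β = ⊤ := by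
  obtain ⟨c, hc, hlow⟩ := le_weightedMeasure_univ hn
  set ρ : ℝ := γ ^ Q * 2 with hρ
  set η : ℕ → ℝ := fun j => t / 2 * (1 / 2) ^ j with hη
  have hη0 : ∀ j, 0 < η j := fun j => by simp only [hη]; positivity
  have hbound : ∀ᶠ j in Filter.atTop, ENNReal.ofReal (c * 2 / (t * Q) * ρ ^ j) ≤
      ∫⁻ z : Cn n, ENNReal.ofReal (radialProfile γ t (‖z‖ ^ 2)) ^ Q ∂weightedMeasure n β := by
    have hsmall : Filter.Tendsto (fun j => η j * Q) Filter.atTop (nhds 0) := by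
      have := ((tendsto_pow_atTop_nhds_zero_of_lt_one (r := (1 / 2 : ℝ)) (by norm_num)
        (by norm_num)).const_mul (t / 2)).mul_const Q
      simpa [hη] using this
    filter_upwards [hsmall.eventually (ge_mem_nhds one_pos)] with j hj
    have h1 : β - profileExponent t j * Q ≤ η j * Q - 1 := by
      simp only [profileExponent, hη]; linarith
    calc ENNReal.ofReal (c * 2 / (t * Q) * ρ ^ j)
        = ENNReal.ofReal ((γ ^ j) ^ Q) * ENNReal.ofReal (c / (η j * Q)) := by
          rw [← ENNReal.ofReal_mul (by positivity)]
          congr 1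
          have h2 : (γ ^ j) ^ Q = (γ ^ Q) ^ j := by
            rw [← Real.rpow_natCast, ← Real.rpow_natCast, ← Real.rpow_mul (by positivity),
              ← Real.rpow_mul (by positivity), mul_comm]
          rw [h2, hρ, mul_pow, hη]
          simp only [one_div, inv_pow]
          field_simp
      _ ≤ ENNReal.ofReal ((γ ^ j) ^ Q) * weightedMeasure n (β - profileExponent t j * Q) univ := by
          gcongr
          exact (hlow _ (mul_pos (hη0 j) hQ) hj).trans (weightedMeasure_univ_anti h1)
      _ = ∫⁻ z : Cn n, ENNReal.ofReal (γ ^ j * (1 - ‖z‖ ^ 2) ^ (-profileExponent t j)) ^ Q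
          ∂weightedMeasure n β := (lintegral_const_mul_weight_rpow (by positivity)).symm
      _ ≤ _ := by
          refine lintegral_mono_ae ?_
          filter_upwards [ae_weightedMeasure_mem_unitBall n β] with z hz
          gcongr
          exact (summable_radialProfile hγ0 hγ1 ht0 (norm_sq_mem_Ico hz)).le_tsum j fun i _ =>
            radialProfile_term_nonneg hγ0 t (norm_sq_mem_Ico hz) i
  have hlim : Filter.Tendsto (fun j : ℕ => ENNReal.ofReal (c * 2 / (t * Q) * ρ ^ j))
      Filter.atTop (nhds ⊤) := by
    rw [ENNReal.tendsto_ofReal_nhds_top]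
    exact (tendsto_pow_atTop_atTop_of_one_lt hγQ).const_mul_atTop (by positivity)
  exact top_le_iff.1 (le_of_tendsto hlim hbound)

/-- Radial profiles with nonnegative Taylor coefficients whose `P`-th power is integrable for one
weight while the `Q`-th power is not for another. -/
lemma exists_radial_profile (hn : 1 ≤ n) {P Q α β : ℝ} (hQ : 0 < Q) (hQP : Q < P) (hα : -1 < α)
    (hcrit : P * (β + 1) ≤ Q * (α + 1)) :
    ∃ (h : ℕ → ℝ) (H : ℝ → ℝ), (∀ d, 0 ≤ h d) ∧
      (∀ x ∈ Ico (0 : ℝ) 1, HasSum (fun d => h d * x ^ d) (H x)) ∧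
      ∫⁻ z : Cn n, ENNReal.ofReal (H (‖z‖ ^ 2)) ^ P ∂weightedMeasure n α ≠ ⊤ ∧
      ∫⁻ z : Cn n, ENNReal.ofReal (H (‖z‖ ^ 2)) ^ Q ∂weightedMeasure n β = ⊤ := by
  have hP : 0 < P := hQ.trans hQP
  have hα1 : 0 < α + 1 := by linarith
  -- `γ = 2^(-1/m)` with `Q < m < P` gives `2 γ^P < 1 < 2 γ^Q`.
  obtain ⟨m, hm1, hm2⟩ := exists_between hQP
  have hm : 0 < m := hQ.trans hm1
  have ht0 : 0 < (α + 1) / P := by positivity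
  have hγ0 : (0 : ℝ) < (1 / 2) ^ (1 / m) := by positivity
  have hγ1 : ((1 / 2) ^ (1 / m) : ℝ) < 1 :=
    Real.rpow_lt_one (by norm_num) (by norm_num) (by positivity)
  obtain ⟨h, hh0, hh⟩ := hasSum_radialProfile hγ0 hγ1 ht0
  refine ⟨h, _, hh0, hh, lintegral_radialProfile_ne_top hn hγ0 ht0 hP (by field_simp) ?_,
    lintegral_radialProfile_eq_top hn hγ0 hγ1 ht0 hQ ?_ ?_⟩
  · rw [one_div 2, Real.inv_rpow (by norm_num), inv_mul_lt_one₀ (by positivity)]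
    exact Real.rpow_lt_rpow_of_exponent_lt (by norm_num) (one_div_lt_one_div_of_lt hm hm2)
  · rw [div_mul_eq_mul_div, le_div_iff₀ hP]; linarith
  · rw [← Real.rpow_mul (by norm_num), one_div 2, Real.inv_rpow (by norm_num),
      inv_mul_eq_div, one_lt_div (by positivity)]
    calc (2 : ℝ) ^ (1 / m * Q) < 2 ^ (1 : ℝ) :=
          Real.rpow_lt_rpow_of_exponent_lt (by norm_num) (by
            rw [one_div_mul_eq_div, div_lt_one hm]; exact hm1)
      _ = 2 := Real.rpow_one 2

/-! ### Gaussian series -/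

section Gaussian

open ProbabilityTheory Filter Topology

variable {ι Ω : Type*} [MeasurableSpace Ω] {P : Measure Ω} {g : ι → Ω → ℝ}

lemma charFun_finset_sum_gaussian (hg : ∀ i, Measurable (g i))
    (hlaw : ∀ i, HasLaw (g i) (gaussianReal 0 1) P) (hind : iIndepFun g P) (b : ι → ℝ)
    (s : Finset ι) (t : ℝ) :
    charFun (P.map fun ω => ∑ i ∈ s, b i * g i ω) t =
      Complex.exp (-(((∑ i ∈ s, b i ^ 2) * t ^ 2 / 2 : ℝ) : ℂ)) := by
  have hind' : iIndepFun (fun i ω => b i * g i ω) P :=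
    hind.comp (fun i x => b i * x) fun i => by fun_prop
  have h1 := iIndepFun.charFun_map_fun_finsetSum_eq_prod (P := P) (s := s)
    (X := fun i ω => b i * g i ω) (fun i _ => ((hg i).const_mul _).aemeasurable) (hind'.restrict _)
  rw [h1, Finset.prod_apply]
  have h2 : ∀ i, charFun (P.map fun ω => b i * g i ω) t =
      Complex.exp (-((b i ^ 2 * t ^ 2 / 2 : ℝ) : ℂ)) := by
    intro i
    have h3 : P.map (fun ω => b i * g i ω) = (P.map (g i)).map (b i * ·) := by
      rw [Measure.map_map (by fun_prop) (hg i)]; rfl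
    rw [h3, (hlaw i).map_eq, gaussianReal_map_const_mul, charFun_gaussianReal]
    congr 1
    simp
  rw [Finset.prod_congr rfl fun i _ => h2 i, ← Complex.exp_sum]
  congr 1
  push_cast
  rw [Finset.sum_neg_distrib, Finset.sum_mul, Finset.sum_div]

lemma aemeasurable_of_hasSum_gaussian [Countable ι] (hg : ∀ i, Measurable (g i)) {b : ι → ℝ}
    {X : Ω → ℝ} (hX : ∀ᵐ ω ∂P, HasSum (fun i => b i * g i ω) (X ω)) : AEMeasurable X P :=
  aemeasurable_of_tendsto_metrizable_ae (atTop : Filter (Finset ι))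
    (f := fun s ω => ∑ i ∈ s, b i * g i ω)
    (fun s => (Finset.measurable_fun_sum s fun i _ => (hg i).const_mul _).aemeasurable) hX

/-- An almost surely convergent series of independent centred Gaussian variables is Gaussian. -/
lemma map_eq_gaussianReal_of_hasSum [Countable ι] [IsProbabilityMeasure P]
    (hg : ∀ i, Measurable (g i))
    (hlaw : ∀ i, HasLaw (g i) (gaussianReal 0 1) P) (hind : iIndepFun g P) {b : ι → ℝ} {v : NNReal}
    (hv : HasSum (fun i => b i ^ 2) (v : ℝ)) {X : Ω → ℝ}
    (hX : ∀ᵐ ω ∂P, HasSum (fun i => b i * g i ω) (X ω)) :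
    P.map X = gaussianReal 0 v := by
  have hXm := aemeasurable_of_hasSum_gaussian hg hX
  have hm : ∀ s : Finset ι, Measurable fun ω => ∑ i ∈ s, b i * g i ω := fun s =>
    Finset.measurable_fun_sum s fun i _ => (hg i).const_mul _
  have hprob : IsProbabilityMeasure (P.map X) := Measure.isProbabilityMeasure_map hXm
  refine Measure.ext_of_charFun (funext fun t => ?_)
  have h1 : Tendsto (fun s : Finset ι => charFun (P.map fun ω => ∑ i ∈ s, b i * g i ω) t) atTop
      (𝓝 (charFun (P.map X) t)) := by
    have hc : Continuous fun x : ℝ => Complex.exp (t * x * Complex.I) := by fun_prop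
    have h4 : ∀ s : Finset ι, charFun (P.map fun ω => ∑ i ∈ s, b i * g i ω) t =
        ∫ ω, Complex.exp (t * (∑ i ∈ s, b i * g i ω : ℝ) * Complex.I) ∂P := fun s => by
      rw [charFun_apply_real, integral_map (hm s).aemeasurable hc.aestronglyMeasurable]
    rw [charFun_apply_real, integral_map hXm hc.aestronglyMeasurable]
    simp_rw [h4]
    refine tendsto_integral_filter_of_dominated_convergence (fun _ => 1)
      (Eventually.of_forall fun s => (hc.measurable.comp (hm s)).aestronglyMeasurable)
      (Eventually.of_forall fun s => Eventually.of_forall fun ω => ?_) (integrable_const _) ?_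
    · rw [← Complex.ofReal_mul, Complex.norm_exp_ofReal_mul_I]
    · filter_upwards [hX] with ω hω
      exact (hc.tendsto _).comp hω
  have h2 : Tendsto (fun s : Finset ι => charFun (P.map fun ω => ∑ i ∈ s, b i * g i ω) t) atTop
      (𝓝 (charFun (gaussianReal 0 v) t)) := by
    simp only [charFun_finset_sum_gaussian hg hlaw hind, charFun_gaussianReal]
    have hc : Continuous fun x : ℝ => Complex.exp (-((x * t ^ 2 / 2 : ℝ) : ℂ)) := by fun_prop
    have hv' : Tendsto (fun s : Finset ι => ∑ i ∈ s, b i ^ 2) atTop (𝓝 (v : ℝ)) := hv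
    have h3 := (hc.tendsto _).comp hv'
    convert h3 using 2
    congr 1
    simp
  exact tendsto_nhds_unique h1 h2

lemma gaussianReal_eq_map (v : NNReal) :
    gaussianReal 0 v = (gaussianReal 0 1).map (√(v : ℝ) * ·) := by
  rw [gaussianReal_map_const_mul]
  congr 1
  · simp
  · ext; simp

/-- Absolute moments of the standard normal distribution. -/
def gaussianMoment (p : ℝ) : ENNReal := ∫⁻ x, ‖x‖ₑ ^ p ∂gaussianReal 0 1

lemma gaussianMoment_ne_top {p : ℝ} (hp : 0 < p) : gaussianMoment p ≠ ⊤ := by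
  have h := (memLp_id_gaussianReal' (μ := 0) (v := 1) (ENNReal.ofReal p) ENNReal.ofReal_ne_top)
  have h2 := (eLpNorm_lt_top_iff_lintegral_rpow_enorm_lt_top (by simpa using hp)
    ENNReal.ofReal_ne_top).1 h.2
  rw [ENNReal.toReal_ofReal hp.le] at h2
  exact h2.ne

lemma lintegral_enorm_rpow_of_gaussian {X : Ω → ℝ} (hXm : AEMeasurable X P) {v : NNReal}
    (hX : P.map X = gaussianReal 0 v) {p : ℝ} (hp : 0 < p) :
    ∫⁻ ω, ‖X ω‖ₑ ^ p ∂P = (v : ENNReal) ^ (p / 2) * gaussianMoment p := by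
  have hm : Measurable fun x : ℝ => ‖x‖ₑ ^ p := by fun_prop
  rw [← lintegral_map' (f := fun x => ‖x‖ₑ ^ p) hm.aemeasurable hXm, hX, gaussianReal_eq_map,
    lintegral_map hm (by fun_prop), gaussianMoment, ← lintegral_const_mul _ hm]
  refine lintegral_congr fun x => ?_
  rw [enorm_mul, ENNReal.mul_rpow_of_nonneg _ _ hp.le]
  congr 1
  rw [← ofReal_norm, Real.norm_of_nonneg (Real.sqrt_nonneg _),
    ENNReal.ofReal_rpow_of_nonneg (Real.sqrt_nonneg _) hp.le, Real.sqrt_eq_rpow,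
    ← Real.rpow_mul v.coe_nonneg, ← ENNReal.ofReal_coe_nnreal,
    ENNReal.ofReal_rpow_of_nonneg v.coe_nonneg (by positivity)]
  congr 2
  ring

/-- A centred Gaussian variable is, with probability at least `3/4`, at least a fixed multiple of
its standard deviation. -/
lemma exists_small_ball : ∃ η : ℝ, 0 < η ∧ ∀ (X : Ω → ℝ) (v : NNReal), AEMeasurable X P →
    P.map X = gaussianReal 0 v → P {ω | |X ω| < η * √v} ≤ 1 / 4 := by
  have hlim : Tendsto (fun k : ℕ => gaussianReal 0 1 {x | |x| < 1 / ((k : ℝ) + 1)}) atTop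
      (𝓝 (gaussianReal 0 1 (⋂ k : ℕ, {x : ℝ | |x| < 1 / ((k : ℝ) + 1)}))) := by
    refine tendsto_measure_iInter_atTop (fun k => ?_) (fun k l hkl x hx => ?_)
      ⟨0, measure_ne_top _ _⟩
    · exact (measurableSet_lt (by fun_prop) (by fun_prop)).nullMeasurableSet
    · exact lt_of_lt_of_le (show |x| < _ from hx) (Nat.one_div_le_one_div hkl)
  have hinter : (⋂ k : ℕ, {x : ℝ | |x| < 1 / ((k : ℝ) + 1)}) ⊆ {0} := by
    intro x hx
    simp only [mem_iInter, mem_ofPred_eq] at hx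
    by_contra h0
    obtain ⟨k, hk⟩ := exists_nat_one_div_lt (abs_pos.2 h0)
    exact absurd (hx k) (not_lt.2 hk.le)
  have hnull : gaussianReal 0 1 (⋂ k : ℕ, {x : ℝ | |x| < 1 / ((k : ℝ) + 1)}) = 0 :=
    measure_mono_null hinter
      (gaussianReal_absolutelyContinuous 0 one_ne_zero (by simp))
  rw [hnull] at hlim
  obtain ⟨k, hk⟩ := (hlim.eventually (ge_mem_nhds (show (0 : ENNReal) < 1 / 4 by simp))).exists
  refine ⟨1 / ((k : ℝ) + 1), by positivity, fun X v hXm hX => ?_⟩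
  have hms : MeasurableSet {x : ℝ | |x| < 1 / ((k : ℝ) + 1) * √v} :=
    measurableSet_lt (by fun_prop) (by fun_prop)
  have h1 : P {ω | |X ω| < 1 / ((k : ℝ) + 1) * √v} =
      P.map X {x : ℝ | |x| < 1 / ((k : ℝ) + 1) * √v} := by
    rw [Measure.map_apply_of_aemeasurable hXm hms]; rfl
  rw [h1, hX, gaussianReal_eq_map, Measure.map_apply (by fun_prop) hms]
  refine (measure_mono fun x hx => ?_).trans hk
  simp only [mem_preimage, mem_ofPred_eq, abs_mul, abs_of_nonneg (Real.sqrt_nonneg _)] at hx ⊢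
  rw [mul_comm] at hx
  exact lt_of_mul_lt_mul_right hx (Real.sqrt_nonneg _)

end Gaussian

/-! ### Power series in the ball with prescribed square sum -/

/-- The monomials `z^m`, normalized so that those of degree `d` have square sum `h d |z|^(2d)`. -/
def normalizedMonomial (h : ℕ → ℝ) (m : Fin n → ℕ) (z : Cn n) : ℂ :=
  (√(h (∑ j, m j) * Nat.multinomial Finset.univ m) : ℝ) * ∏ j, z j ^ m j

lemma differentiable_normalizedMonomial (h : ℕ → ℝ) (m : Fin n → ℕ) :
    Differentiable ℂ (normalizedMonomial h m) := by
  unfold normalizedMonomial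
  fun_prop

lemma norm_normalizedMonomial_sq {h : ℕ → ℝ} (hh : ∀ d, 0 ≤ h d) (m : Fin n → ℕ) (z : Cn n) :
    ‖normalizedMonomial h m z‖ ^ 2 =
      h (∑ j, m j) * (Nat.multinomial Finset.univ m * ∏ j, (‖z j‖ ^ 2) ^ m j) := by
  rw [normalizedMonomial, norm_mul, Complex.norm_real, Real.norm_of_nonneg (Real.sqrt_nonneg _),
    mul_pow, Real.sq_sqrt (mul_nonneg (hh _) (Nat.cast_nonneg _)), norm_prod, ← Finset.prod_pow,
    mul_assoc]
  congr 2
  refine Finset.prod_congr rfl fun j _ => ?_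
  rw [norm_pow, ← pow_mul, ← pow_mul, mul_comm]

lemma sum_piAntidiag_eq (d : ℕ) (z : Cn n) :
    ∑ m ∈ Finset.piAntidiag Finset.univ d,
      (Nat.multinomial Finset.univ m * ∏ j, (‖z j‖ ^ 2) ^ m j : ℝ) = (‖z‖ ^ 2) ^ d := by
  rw [EuclideanSpace.norm_sq_eq, Finset.sum_pow_eq_sum_piAntidiag]

lemma norm_normalizedMonomial_le {h : ℕ → ℝ} (hh : ∀ d, 0 ≤ h d) (m : Fin n → ℕ) (z : Cn n) :
    ‖normalizedMonomial h m z‖ ≤ √(h (∑ j, m j)) * ‖z‖ ^ (∑ j, m j) := by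
  refine le_of_sq_le_sq ?_ (by positivity)
  rw [norm_normalizedMonomial_sq hh, mul_pow, Real.sq_sqrt (hh _), ← pow_mul, mul_comm _ 2, pow_mul,
    ← sum_piAntidiag_eq]
  refine mul_le_mul_of_nonneg_left ?_ (hh _)
  exact Finset.single_le_sum
    (f := fun m : Fin n → ℕ => (Nat.multinomial Finset.univ m * ∏ j, (‖z j‖ ^ 2) ^ m j : ℝ))
    (fun m _ => by positivity) (by simp)

lemma hasSum_norm_normalizedMonomial_sq {h : ℕ → ℝ} (hh : ∀ d, 0 ≤ h d) {z : Cn n} {S : ℝ}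
    (hS : HasSum (fun d => h d * (‖z‖ ^ 2) ^ d) S) :
    HasSum (fun m : Fin n → ℕ => ‖normalizedMonomial h m z‖ ^ 2) S := by
  set deg : (Fin n → ℕ) → ℕ := fun m => ∑ j, m j with hdeg
  rw [← (Equiv.sigmaFiberEquiv deg).hasSum_iff]
  have hfib : ∀ d, HasSum (fun m : {m // deg m = d} => ‖normalizedMonomial h m.1 z‖ ^ 2)
      (h d * (‖z‖ ^ 2) ^ d) := by
    intro d
    have h1 := Finset.hasSum (Finset.piAntidiag Finset.univ d)
      (fun m : Fin n → ℕ => ‖normalizedMonomial h m z‖ ^ 2)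
    have h2 : ∑ m ∈ Finset.piAntidiag Finset.univ d, ‖normalizedMonomial h m z‖ ^ 2 =
        h d * (‖z‖ ^ 2) ^ d := by
      rw [← sum_piAntidiag_eq, Finset.mul_sum]
      refine Finset.sum_congr rfl fun m hm => ?_
      rw [norm_normalizedMonomial_sq hh, (Finset.mem_piAntidiag.1 hm).1]
    rw [h2] at h1
    exact (Equiv.hasSum_iff (Equiv.subtypeEquivRight fun m => by simp [hdeg]) (f := fun
      m : {m // deg m = d} => ‖normalizedMonomial h m.1 z‖ ^ 2)).1 h1
  refine HasSum.sigma_of_hasSum hS hfib ?_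
  rw [summable_sigma_of_nonneg fun x => by simp only [Function.comp]; positivity]
  refine ⟨fun d => (hfib d).summable, ?_⟩
  have : (fun d => ∑' m : {m // deg m = d}, ‖normalizedMonomial h m.1 z‖ ^ 2) =
      fun d => h d * (‖z‖ ^ 2) ^ d := funext fun d => (hfib d).tsum_eq
  exact this ▸ hS.summable

lemma summable_pow_sum {r : ℝ} (hr0 : 0 ≤ r) (hr1 : r < 1) :
    ∀ k : ℕ, Summable fun m : Fin k → ℕ => r ^ (∑ j, m j)
  | 0 => Summable.of_finite
  | k + 1 => by
    rw [← (Fin.consEquiv (fun _ : Fin (k + 1) => ℕ)).summable_iff]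
    have h1 := (summable_geometric_of_lt_one hr0 hr1).mul_of_nonneg (summable_pow_sum hr0 hr1 k)
      (fun _ => by positivity) (fun _ => by positivity)
    refine h1.congr fun x => ?_
    simp [Fin.consEquiv, Fin.sum_univ_succ, pow_add]

/-- Absolute convergence of the normalized power series on smaller balls. -/
lemma summable_sqrt_mul_pow {h : ℕ → ℝ} (hh : ∀ d, 0 ≤ h d)
    (hsum : ∀ x ∈ Ico (0 : ℝ) 1, Summable fun d => h d * x ^ d) {ρ : ℝ} (hρ0 : 0 ≤ ρ)
    (hρ1 : ρ < 1) :
    Summable fun m : Fin n → ℕ => √(h (∑ j, m j)) * ρ ^ (∑ j, m j) := by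
  have hs1 : √ρ < 1 := by rw [Real.sqrt_lt' one_pos]; simpa using hρ1
  obtain ⟨C, hC⟩ := (hsum ρ ⟨hρ0, hρ1⟩).tendsto_atTop_zero.bddAbove_range
  refine Summable.of_nonneg_of_le (fun m => by positivity) (fun m => ?_)
    ((summable_pow_sum (Real.sqrt_nonneg ρ) hs1 n).mul_left (√C))
  set d := ∑ j, m j
  have h1 : h d * ρ ^ d ≤ C := hC ⟨d, rfl⟩
  have h2 : √(h d) * √ρ ^ d ≤ √C := by
    refine Real.le_sqrt_of_sq_le ?_
    rw [mul_pow, Real.sq_sqrt (hh d), ← pow_mul, mul_comm d 2, pow_mul, Real.sq_sqrt hρ0]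
    exact h1
  calc √(h d) * ρ ^ d = √(h d) * √ρ ^ d * √ρ ^ d := by
        rw [mul_assoc, ← mul_pow, Real.mul_self_sqrt hρ0]
    _ ≤ √C * √ρ ^ d := by gcongr

/-- A series of entire functions that converges normally on each smaller ball is holomorphic on the
unit ball. The derivatives are controlled by the Schwarz lemma. -/
lemma differentiableOn_tsum_unitBall {ι : Type*} {F : ι → Cn n → ℂ}
    (hF : ∀ i, Differentiable ℂ (F i))
    (hsum : ∀ ρ : ℝ, 0 < ρ → ρ < 1 → ∃ u : ι → ℝ, Summable u ∧ ∀ i z, ‖z‖ ≤ ρ → ‖F i z‖ ≤ u i) :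
    DifferentiableOn ℂ (fun z => ∑' i, F i z) (unitBall n) := by
  intro z hz
  rw [mem_unitBall] at hz
  obtain ⟨ρ, hzρ, hρ1⟩ := exists_between hz
  obtain ⟨ρ', hρρ', hρ'1⟩ := exists_between hρ1
  have hρ0 : 0 < ρ := (norm_nonneg z).trans_lt hzρ
  obtain ⟨u, hu, hFu⟩ := hsum ρ' (hρ0.trans hρρ') hρ'1
  have hd : 0 < ρ' - ρ := by linarith
  refine DifferentiableAt.differentiableWithinAt (HasFDerivAt.differentiableAt
    (hasFDerivAt_tsum_of_isPreconnected (u := fun i => 2 * u i / (ρ' - ρ))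
      ((hu.mul_left 2).div_const _) (Metric.isOpen_ball (x := (0 : Cn n)) (ε := ρ))
      (convex_ball (0 : Cn n) ρ).isPreconnected (f' := fun i x => fderiv ℂ (F i) x)
      (fun i x _ => (hF i x).hasFDerivAt) (fun i x hx => ?_) (x₀ := 0) (by simpa using hρ0) ?_
      (x := z) (by simpa using hzρ)))
  · have hx' : ‖x‖ < ρ := by simpa using hx
    refine Complex.norm_fderiv_le_div_of_mapsTo_ball (hF i).differentiableOn (fun w hw => ?_) hd
    have hw1 : ‖w‖ ≤ ρ' := by
      have h1 : ‖w - x‖ < ρ' - ρ := by simpa [dist_eq_norm] using hw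
      have h2 := norm_le_norm_add_norm_sub' w x
      linarith
    rw [mem_closedBall_iff_norm]
    calc ‖F i w - F i x‖ ≤ ‖F i w‖ + ‖F i x‖ := norm_sub_le _ _
      _ ≤ u i + u i := add_le_add (hFu i w hw1) (hFu i x (by linarith))
      _ = 2 * u i := by ring
  · exact Summable.of_norm_bounded hu fun i => hFu i 0 (by rw [norm_zero]; linarith)

/-! ### Random power series -/

lemma ENNReal.add_rpow_le_two_rpow_mul (a b : ENNReal) {q : ℝ} (hq : 0 ≤ q) :
    (a + b) ^ q ≤ 2 ^ q * (a ^ q + b ^ q) := by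
  calc (a + b) ^ q ≤ (2 * max a b) ^ q := by
        rw [two_mul]; gcongr; exacts [le_max_left _ _, le_max_right _ _]
    _ = 2 ^ q * (max a b) ^ q := ENNReal.mul_rpow_of_nonneg _ _ hq
    _ ≤ _ := by
      gcongr
      rcases max_choice a b with h | h <;> rw [h]
      · exact le_self_add
      · exact le_add_self

section RandomSeries

open ProbabilityTheory Filter Topology

variable {ι Ω : Type*} [Countable ι] [MeasurableSpace Ω] {P : Measure Ω}
  {g : ι → Ω → ℝ}

lemma exists_re_im_gaussian [IsProbabilityMeasure P] (hg : ∀ i, Measurable (g i))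
    (hlaw : ∀ i, HasLaw (g i) (gaussianReal 0 1) P) (hind : iIndepFun g P) {b : ι → ℂ} {S : ℝ}
    (hS : HasSum (fun i => ‖b i‖ ^ 2) S) {Z : Ω → ℂ}
    (hZ : ∀ᵐ ω ∂P, HasSum (fun i => (g i ω : ℂ) * b i) (Z ω)) :
    ∃ v w : NNReal, (v : ℝ) + w = S ∧
      (AEMeasurable (fun ω => (Z ω).re) P ∧ P.map (fun ω => (Z ω).re) = gaussianReal 0 v) ∧
      AEMeasurable (fun ω => (Z ω).im) P ∧ P.map (fun ω => (Z ω).im) = gaussianReal 0 w := by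
  have hsq : ∀ i, ‖b i‖ ^ 2 = (b i).re ^ 2 + (b i).im ^ 2 := fun i => by
    rw [Complex.sq_norm, Complex.normSq_apply]; ring
  have hre : Summable fun i => (b i).re ^ 2 :=
    Summable.of_nonneg_of_le (fun i => sq_nonneg _)
      (fun i => by rw [hsq]; nlinarith [sq_nonneg (b i).im]) hS.summable
  have him : Summable fun i => (b i).im ^ 2 :=
    Summable.of_nonneg_of_le (fun i => sq_nonneg _)
      (fun i => by rw [hsq]; nlinarith [sq_nonneg (b i).re]) hS.summable
  have hX : ∀ᵐ ω ∂P, HasSum (fun i => (b i).re * g i ω) (Z ω).re := by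
    filter_upwards [hZ] with ω hω
    simpa [mul_comm] using Complex.hasSum_re hω
  have hY : ∀ᵐ ω ∂P, HasSum (fun i => (b i).im * g i ω) (Z ω).im := by
    filter_upwards [hZ] with ω hω
    simpa [mul_comm] using Complex.hasSum_im hω
  refine ⟨⟨∑' i, (b i).re ^ 2, tsum_nonneg fun i => sq_nonneg _⟩,
    ⟨∑' i, (b i).im ^ 2, tsum_nonneg fun i => sq_nonneg _⟩, ?_,
    ⟨aemeasurable_of_hasSum_gaussian hg hX,
      map_eq_gaussianReal_of_hasSum hg hlaw hind hre.hasSum hX⟩,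
    aemeasurable_of_hasSum_gaussian hg hY,
    map_eq_gaussianReal_of_hasSum hg hlaw hind him.hasSum hY⟩
  refine HasSum.unique (hre.hasSum.add him.hasSum) ?_
  simpa only [hsq] using hS

lemma lintegral_gaussian_series_le [IsProbabilityMeasure P] (hg : ∀ i, Measurable (g i))
    (hlaw : ∀ i, HasLaw (g i) (gaussianReal 0 1) P) (hind : iIndepFun g P) {b : ι → ℂ} {S : ℝ}
    (hS : HasSum (fun i => ‖b i‖ ^ 2) S) {Z : Ω → ℂ}
    (hZ : ∀ᵐ ω ∂P, HasSum (fun i => (g i ω : ℂ) * b i) (Z ω)) {p : ℝ} (hp : 0 < p) :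
    ∫⁻ ω, ‖Z ω‖ₑ ^ p ∂P ≤ 2 ^ p * (2 * gaussianMoment p) * ENNReal.ofReal S ^ (p / 2) := by
  obtain ⟨v, w, hvw, ⟨hXm, hX⟩, hYm, hY⟩ := exists_re_im_gaussian hg hlaw hind hS hZ
  have hle : ∀ u : NNReal, (u : ℝ) ≤ S →
      (u : ENNReal) ^ (p / 2) * gaussianMoment p ≤
        ENNReal.ofReal S ^ (p / 2) * gaussianMoment p := by
    intro u hu
    gcongr
    rw [← ENNReal.ofReal_coe_nnreal]
    exact ENNReal.ofReal_le_ofReal hu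
  have hpt : ∀ ω, ‖Z ω‖ₑ ^ p ≤ 2 ^ p * (‖(Z ω).re‖ₑ ^ p + ‖(Z ω).im‖ₑ ^ p) := by
    intro ω
    have h1 : ‖Z ω‖ₑ ≤ ‖(Z ω).re‖ₑ + ‖(Z ω).im‖ₑ := by
      rw [← ofReal_norm, ← ofReal_norm, ← ofReal_norm,
        ← ENNReal.ofReal_add (norm_nonneg _) (norm_nonneg _)]
      exact ENNReal.ofReal_le_ofReal (Complex.norm_le_abs_re_add_abs_im _)
    exact (ENNReal.rpow_le_rpow h1 hp.le).trans (ENNReal.add_rpow_le_two_rpow_mul _ _ hp.le)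
  calc ∫⁻ ω, ‖Z ω‖ₑ ^ p ∂P ≤ ∫⁻ ω, 2 ^ p * (‖(Z ω).re‖ₑ ^ p + ‖(Z ω).im‖ₑ ^ p) ∂P :=
        lintegral_mono hpt
    _ = 2 ^ p * (∫⁻ ω, ‖(Z ω).re‖ₑ ^ p ∂P + ∫⁻ ω, ‖(Z ω).im‖ₑ ^ p ∂P) := by
        rw [lintegral_const_mul' _ _ (by simp), lintegral_add_left' (hXm.enorm.pow_const p)]
    _ ≤ 2 ^ p * (ENNReal.ofReal S ^ (p / 2) * gaussianMoment p +
          ENNReal.ofReal S ^ (p / 2) * gaussianMoment p) := by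
        rw [lintegral_enorm_rpow_of_gaussian hXm hX hp, lintegral_enorm_rpow_of_gaussian hYm hY hp]
        exact mul_le_mul_right (add_le_add (hle v (by linarith [w.coe_nonneg]))
          (hle w (by linarith [v.coe_nonneg]))) _
    _ = _ := by ring

/-- A Gaussian series keeps a fixed proportion of its `r`-th moment on every event of probability
at least `3/4`. -/
lemma exists_le_setLIntegral_gaussian_series [IsProbabilityMeasure P]
    (hg : ∀ i, Measurable (g i))
    (hlaw : ∀ i, HasLaw (g i) (gaussianReal 0 1) P) (hind : iIndepFun g P) {r : ℝ} (hr : 0 < r) :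
    ∃ c : ENNReal, c ≠ 0 ∧ ∀ (b : ι → ℂ) (S : ℝ) (Z : Ω → ℂ) (A : Set Ω),
      HasSum (fun i => ‖b i‖ ^ 2) S →
      (∀ᵐ ω ∂P, HasSum (fun i => (g i ω : ℂ) * b i) (Z ω)) → P Aᶜ ≤ 1 / 4 →
      c * ENNReal.ofReal S ^ (r / 2) ≤ ∫⁻ ω in A, ‖Z ω‖ₑ ^ r ∂P := by
  obtain ⟨η, hη, hball⟩ := exists_small_ball (P := P)
  refine ⟨ENNReal.ofReal (η ^ 2 / 2) ^ (r / 2) * (1 / 2), ?_, fun b S Z A hS hZ hA => ?_⟩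
  · have : ENNReal.ofReal (η ^ 2 / 2) ≠ 0 := by simpa using by positivity
    simp [ENNReal.rpow_eq_zero_iff, this]
  obtain ⟨v, w, hvw, ⟨hXm, hX⟩, hYm, hY⟩ := exists_re_im_gaussian hg hlaw hind hS hZ
  have hS0 : 0 ≤ S := by rw [← hvw]; positivity
  have hZm : AEMeasurable Z P := by
    have h1 : Z = fun ω => ((Z ω).re : ℂ) + ((Z ω).im : ℂ) * Complex.I :=
      funext fun ω => (Complex.re_add_im _).symm
    rw [h1]
    exact (Complex.measurable_ofReal.comp_aemeasurable hXm).add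
      ((Complex.measurable_ofReal.comp_aemeasurable hYm).mul_const _)
  -- One of the two components carries at least half of the variance.
  have hexc : P {ω | ‖Z ω‖ < η * √(S / 2)} ≤ 1 / 4 := by
    have key : ∀ (X : Ω → ℝ) (u : NNReal), AEMeasurable X P → P.map X = gaussianReal 0 u →
        (∀ ω, |X ω| ≤ ‖Z ω‖) → S / 2 ≤ u → P {ω | ‖Z ω‖ < η * √(S / 2)} ≤ 1 / 4 := by
      intro X u hXm hX hXZ hu
      refine (measure_mono fun ω hω => ?_).trans (hball X u hXm hX)
      calc |X ω| ≤ ‖Z ω‖ := hXZ ω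
        _ < η * √(S / 2) := hω
        _ ≤ η * √u := by gcongr
    rcases le_total (S / 2) v with h | h
    · exact key _ v hXm hX (fun ω => Complex.abs_re_le_norm _) h
    · exact key _ w hYm hY (fun ω => Complex.abs_im_le_norm _) (by linarith)
  set t : ENNReal := ENNReal.ofReal (η * √(S / 2)) ^ r with ht
  have hmass : (1 / 2 : ENNReal) ≤ P.restrict A {ω | t ≤ ‖Z ω‖ₑ ^ r} := by
    have h1 : (univ : Set Ω) ⊆ ({ω | t ≤ ‖Z ω‖ₑ ^ r} ∩ A) ∪
        (Aᶜ ∪ {ω | ‖Z ω‖ < η * √(S / 2)}) := by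
      intro ω _
      by_cases h2 : ω ∈ A
      · by_cases h3 : ‖Z ω‖ < η * √(S / 2)
        · exact Or.inr (Or.inr h3)
        · refine Or.inl ⟨?_, h2⟩
          simp only [mem_ofPred_eq, ht]
          rw [← ofReal_norm]
          exact ENNReal.rpow_le_rpow (ENNReal.ofReal_le_ofReal (not_lt.1 h3)) hr.le
      · exact Or.inr (Or.inl h2)
    have h2 : (1 : ENNReal) ≤ P ({ω | t ≤ ‖Z ω‖ₑ ^ r} ∩ A) + 1 / 2 := by
      calc (1 : ENNReal) = P univ := measure_univ.symm
        _ ≤ _ := measure_mono h1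
        _ ≤ P ({ω | t ≤ ‖Z ω‖ₑ ^ r} ∩ A) + (P Aᶜ + P {ω | ‖Z ω‖ < η * √(S / 2)}) :=
          (measure_union_le _ _).trans (by gcongr; exact measure_union_le _ _)
        _ ≤ P ({ω | t ≤ ‖Z ω‖ₑ ^ r} ∩ A) + (1 / 4 + 1 / 4) := by gcongr
        _ = _ := by
          congr 1
          rw [← ENNReal.add_div, ENNReal.div_eq_div_iff] <;> norm_num
    have h3 : (1 / 2 : ENNReal) ≤ P ({ω | t ≤ ‖Z ω‖ₑ ^ r} ∩ A) := by
      have h4 : (1 / 2 : ENNReal) + 1 / 2 = 1 := ENNReal.add_halves 1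
      exact (ENNReal.add_le_add_iff_right (a := 1 / 2) (by simp)).1 (h4.trans_le h2)
    exact h3.trans (Measure.le_restrict_apply _ _)
  have hteq : ENNReal.ofReal (η ^ 2 / 2) ^ (r / 2) * ENNReal.ofReal S ^ (r / 2) = t := by
    rw [ht, ← ENNReal.mul_rpow_of_nonneg _ _ (by positivity), ← ENNReal.ofReal_mul (by positivity),
      show η ^ 2 / 2 * S = (η * √(S / 2)) ^ 2 by rw [mul_pow, Real.sq_sqrt (by positivity)]; ring,
      ENNReal.ofReal_pow (by positivity), ← ENNReal.rpow_natCast, ← ENNReal.rpow_mul]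
    congr 1
    push_cast
    ring
  calc ENNReal.ofReal (η ^ 2 / 2) ^ (r / 2) * (1 / 2) * ENNReal.ofReal S ^ (r / 2)
      = t * (1 / 2) := by rw [← hteq]; ring
    _ ≤ t * P.restrict A {ω | t ≤ ‖Z ω‖ₑ ^ r} := by gcongr
    _ ≤ ∫⁻ ω in A, ‖Z ω‖ₑ ^ r ∂P :=
      mul_meas_ge_le_lintegral₀ (hZm.restrict.enorm.pow_const r) t

lemma ae_summable_gaussian (hg : ∀ i, Measurable (g i))
    (hlaw : ∀ i, HasLaw (g i) (gaussianReal 0 1) P) {u : ι → ℝ} (hu0 : ∀ i, 0 ≤ u i)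
    (hu : Summable u) : ∀ᵐ ω ∂P, Summable fun i => |g i ω| * u i := by
  have hE : ∀ i, ∫⁻ ω, ‖g i ω‖ₑ ∂P = gaussianMoment 1 := by
    intro i
    have h := lintegral_enorm_rpow_of_gaussian (hg i).aemeasurable (v := 1) (hlaw i).map_eq one_pos
    simpa using h
  have hm : ∀ i, Measurable fun ω => ‖g i ω‖ₑ * ENNReal.ofReal (u i) := fun i =>
    (hg i).enorm.mul_const _
  have hfin : ∫⁻ ω, ∑' i, ‖g i ω‖ₑ * ENNReal.ofReal (u i) ∂P ≠ ⊤ := by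
    rw [lintegral_tsum fun i => (hm i).aemeasurable]
    simp_rw [lintegral_mul_const _ (hg _).enorm, hE]
    rw [ENNReal.tsum_mul_left]
    exact ENNReal.mul_ne_top (gaussianMoment_ne_top one_pos)
      (by rw [← ENNReal.ofReal_tsum_of_nonneg hu0 hu]; exact ENNReal.ofReal_ne_top)
  filter_upwards [ae_lt_top (Measurable.tsum hm) hfin] with ω hω
  have h1 := ENNReal.summable_toReal hω.ne
  refine h1.congr fun i => ?_
  rw [ENNReal.toReal_mul, ENNReal.toReal_ofReal (hu0 i), toReal_enorm, Real.norm_eq_abs]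

end RandomSeries

section RandomPowerSeries

open ProbabilityTheory Filter Topology

variable {Ω : Type} [MeasurableSpace Ω] {P : Measure Ω}
  {g : (Fin n → ℕ) → Ω → ℝ} {h : ℕ → ℝ}

/-- The random power series with independent Gaussian coefficients on the normalized monomials. -/
def randomSeries (g : (Fin n → ℕ) → Ω → ℝ) (h : ℕ → ℝ) (ω : Ω) (z : Cn n) : ℂ :=
  ∑' m, (g m ω : ℂ) * normalizedMonomial h m z

/-- Almost surely, the random power series converges in the whole ball to a holomorphic function. -/
lemma ae_randomSeries (hg : ∀ i, Measurable (g i))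
    (hlaw : ∀ i, HasLaw (g i) (gaussianReal 0 1) P) (hh : ∀ d, 0 ≤ h d)
    (hsum : ∀ x ∈ Ico (0 : ℝ) 1, Summable fun d => h d * x ^ d) :
    ∀ᵐ ω ∂P, DifferentiableOn ℂ (randomSeries g h ω) (unitBall n) ∧
      ∀ z ∈ unitBall n, HasSum (fun m => (g m ω : ℂ) * normalizedMonomial h m z)
        (randomSeries g h ω z) := by
  have hρ0 : ∀ k : ℕ, (0 : ℝ) ≤ 1 - 1 / ((k : ℝ) + 1) := fun k => by
    have : 1 / ((k : ℝ) + 1) ≤ 1 := by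
      rw [div_le_one (by positivity)]; linarith [k.cast_nonneg (α := ℝ)]
    linarith
  have hρ1 : ∀ k : ℕ, 1 - 1 / ((k : ℝ) + 1) < 1 := fun k => by
    have : 0 < 1 / ((k : ℝ) + 1) := by positivity
    linarith
  have hall : ∀ᵐ ω ∂P, ∀ k : ℕ, Summable fun m : Fin n → ℕ =>
      |g m ω| * (√(h (∑ j, m j)) * (1 - 1 / ((k : ℝ) + 1)) ^ (∑ j, m j)) :=
    ae_all_iff.2 fun k => ae_summable_gaussian hg hlaw
      (fun m => mul_nonneg (Real.sqrt_nonneg _) (pow_nonneg (hρ0 k) _))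
      (summable_sqrt_mul_pow hh hsum (hρ0 k) (hρ1 k))
  filter_upwards [hall] with ω hω
  have hdom : ∀ ρ : ℝ, 0 < ρ → ρ < 1 → ∃ u : (Fin n → ℕ) → ℝ, Summable u ∧
      ∀ m z, ‖z‖ ≤ ρ → ‖(g m ω : ℂ) * normalizedMonomial h m z‖ ≤ u m := by
    intro ρ hρ hρ'
    obtain ⟨k, hk⟩ := exists_nat_one_div_lt (sub_pos.2 hρ')
    refine ⟨_, hω k, fun m z hz => ?_⟩
    rw [norm_mul, Complex.norm_real, Real.norm_eq_abs]
    gcongr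
    refine (norm_normalizedMonomial_le hh m z).trans ?_
    gcongr
    linarith
  refine ⟨differentiableOn_tsum_unitBall
    (fun m => (differentiable_normalizedMonomial h m).const_mul _) hdom, fun z hz => ?_⟩
  rw [mem_unitBall] at hz
  obtain ⟨ρ, hzρ, hρ1⟩ := exists_between hz
  obtain ⟨u, hu, hle⟩ := hdom ρ ((norm_nonneg z).trans_lt hzρ) hρ1
  exact (Summable.of_norm_bounded hu fun m => hle m z hzρ.le).hasSum

lemma aemeasurable_uncurry_randomSeries (hg : ∀ i, Measurable (g i)) {P' : Measure Ω} [SFinite P']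
    (hgood : ∀ᵐ ω ∂P', ∀ z ∈ unitBall n, HasSum (fun m => (g m ω : ℂ) * normalizedMonomial h m z)
        (randomSeries g h ω z)) (α : ℝ) :
    AEMeasurable (fun x : Ω × Cn n => randomSeries g h x.1 x.2)
      (P'.prod (weightedMeasure n α)) := by
  refine aemeasurable_of_tendsto_metrizable_ae (atTop : Filter (Finset (Fin n → ℕ)))
    (f := fun s x => ∑ m ∈ s, (g m x.1 : ℂ) * normalizedMonomial h m x.2) (fun s => ?_) ?_
  · refine (Finset.measurable_fun_sum s fun m _ => ?_).aemeasurable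
    exact (Complex.measurable_ofReal.comp ((hg m).comp measurable_fst)).mul
      ((differentiable_normalizedMonomial h m).continuous.measurable.comp measurable_snd)
  · filter_upwards [Measure.quasiMeasurePreserving_fst.ae hgood,
      Measure.quasiMeasurePreserving_snd.ae (ae_weightedMeasure_mem_unitBall n α)] with x h1 h2
    exact h1 x.2 h2

/-- Below the critical line, `A^p_α` is not contained in `A^r_β`: a random power series whose
coefficients are Gaussian multiples of those of a radial profile is almost surely in `A^p_α` but
not almost surely in `A^r_β`. -/
lemma exists_mem_bergmanSpace_lintegral_eq_top (hn : 1 ≤ n) {p r α β : ℝ} (hr : 0 < r) (hrp : r < p)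
    (hα : -1 < α) (hcrit : p * (β + 1) ≤ r * (α + 1)) :
    ∃ f ∈ bergmanSpace n p α, ∫⁻ z, ‖f z‖ₑ ^ r ∂weightedMeasure n β = ⊤ := by
  have hp : 0 < p := hr.trans hrp
  -- The exponents are halved because moments of order `s` scale like the variance to the `s / 2`.
  obtain ⟨h, H, hh, hH, hfin, hinf⟩ := exists_radial_profile hn (P := p / 2) (Q := r / 2)
    (α := α) (β := β) (by positivity) (by linarith) hα (by linarith)
  obtain ⟨Ω, mΩ, P, g, hg, hlaw, hind, hP⟩ := exists_iid (Fin n → ℕ) (gaussianReal 0 1)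
  have hgood := ae_randomSeries hg hlaw hh fun x hx => (hH x hx).summable
  have hgood' := hgood.mono fun ω hω => hω.2
  have hS : ∀ z ∈ unitBall n, HasSum (fun m : Fin n → ℕ => ‖normalizedMonomial h m z‖ ^ 2)
      (H (‖z‖ ^ 2)) := fun z hz =>
    hasSum_norm_normalizedMonomial_sq hh (hH _ (norm_sq_mem_Ico hz))
  have hZ : ∀ z ∈ unitBall n, ∀ᵐ ω ∂P,
      HasSum (fun m => (g m ω : ℂ) * normalizedMonomial h m z) (randomSeries g h ω z) :=
    fun z hz => hgood'.mono fun ω hω => hω z hz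
  have hjoint : ∀ (s γ : ℝ) (A : Set Ω), AEMeasurable
      (fun x : Ω × Cn n => ‖randomSeries g h x.1 x.2‖ₑ ^ s)
      ((P.restrict A).prod (weightedMeasure n γ)) := fun s γ A =>
    (aemeasurable_uncurry_randomSeries hg (ae_restrict_of_ae hgood') γ).enorm.pow_const s
  have hmem : ∀ᵐ ω ∂P, randomSeries g h ω ∈ bergmanSpace n p α := by
    have hj := hjoint p α univ
    rw [Measure.restrict_univ] at hj
    have hE : ∫⁻ ω, ∫⁻ z, ‖randomSeries g h ω z‖ₑ ^ p ∂weightedMeasure n α ∂P ≠ ⊤ := by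
      rw [lintegral_lintegral_swap hj]
      refine ne_top_of_le_ne_top (b := 2 ^ p * (2 * gaussianMoment p) *
        ∫⁻ z : Cn n, ENNReal.ofReal (H (‖z‖ ^ 2)) ^ (p / 2) ∂weightedMeasure n α) ?_ ?_
      · exact ENNReal.mul_ne_top (ENNReal.mul_ne_top (by simp)
          (ENNReal.mul_ne_top (by simp) (gaussianMoment_ne_top hp))) hfin
      · rw [← lintegral_const_mul' _ _ (ENNReal.mul_ne_top (by simp)
          (ENNReal.mul_ne_top (by simp) (gaussianMoment_ne_top hp)))]
        refine lintegral_mono_ae ?_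
        filter_upwards [ae_weightedMeasure_mem_unitBall n α] with z hz
        exact lintegral_gaussian_series_le hg hlaw hind (hS z hz) (hZ z hz) hp
    filter_upwards [hgood, ae_lt_top' hj.lintegral_prod_right' hE] with ω h1 h2
    exact (mem_bergmanSpace_iff hp).2 ⟨h1.1, h2.ne⟩
  by_contra! hcon
  set N : Ω → ENNReal := fun ω => ∫⁻ z, ‖randomSeries g h ω z‖ₑ ^ r ∂weightedMeasure n β with hN
  have hNfin : ∀ᵐ ω ∂P, N ω ≠ ⊤ := hmem.mono fun ω hω => hcon _ hω
  have hNm : AEMeasurable N P := by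
    have hj := hjoint r β univ
    rw [Measure.restrict_univ] at hj
    exact hj.lintegral_prod_right'
  -- Almost sure finiteness would bound `N` by a constant on an event of probability `3/4`.
  obtain ⟨k, hk⟩ : ∃ k : ℕ, P {ω | N ω ≤ k}ᶜ ≤ 1 / 4 := by
    have hlim : Tendsto (fun k : ℕ => P {ω | N ω ≤ k}ᶜ) atTop
        (𝓝 (P (⋂ k : ℕ, {ω | N ω ≤ k}ᶜ))) := by
      refine tendsto_measure_iInter_atTop (fun k => ?_) (fun k l hkl => ?_)
        ⟨0, measure_ne_top _ _⟩
      · exact (nullMeasurableSet_le hNm aemeasurable_const).compl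
      · refine compl_subset_compl.2 fun ω (hω : N ω ≤ k) => ?_
        exact hω.trans (by exact_mod_cast hkl)
    have hnull : P (⋂ k : ℕ, {ω | N ω ≤ k}ᶜ) = 0 := by
      refine measure_mono_null (fun ω hω => ?_) hNfin
      simp only [mem_iInter, mem_compl_iff, mem_ofPred_eq] at hω ⊢
      intro hne
      obtain ⟨k, hk⟩ := ENNReal.exists_nat_gt hne
      exact hω k hk.le
    rw [hnull] at hlim
    exact (hlim.eventually (ge_mem_nhds (show (0 : ENNReal) < 1 / 4 by simp))).exists
  obtain ⟨c, hc, hlow⟩ := exists_le_setLIntegral_gaussian_series hg hlaw hind hr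
  set A : Set Ω := {ω | N ω ≤ k} with hA
  have hup : ∫⁻ ω in A, N ω ∂P ≤ k := by
    have hAm : NullMeasurableSet A P := nullMeasurableSet_le hNm aemeasurable_const
    calc ∫⁻ ω in A, N ω ∂P ≤ ∫⁻ _ in A, (k : ENNReal) ∂P := by
          refine lintegral_mono_ae ?_
          exact (ae_restrict_mem₀ hAm).mono fun ω hω => hω
      _ = k * P A := by simp
      _ ≤ k * 1 := by gcongr; exact prob_le_one
      _ = k := mul_one _
  have hlo : c * ∫⁻ z : Cn n, ENNReal.ofReal (H (‖z‖ ^ 2)) ^ (r / 2) ∂weightedMeasure n β ≤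
      ∫⁻ ω in A, N ω ∂P := by
    rw [hN, lintegral_lintegral_swap (hjoint r β A)]
    refine (lintegral_const_mul_le _ _).trans (lintegral_mono_ae ?_)
    filter_upwards [ae_weightedMeasure_mem_unitBall n β] with z hz
    exact hlow _ _ _ A (hS z hz) (hZ z hz) hk
  rw [hinf, ENNReal.mul_top hc, top_le_iff] at hlo
  rw [hlo, top_le_iff] at hup
  exact ENNReal.natCast_ne_top k hup

end RandomPowerSeries

/-! ### Growth of polynomials -/

lemma norm_add_pow_sub_pow_le {u h : ℂ} {a : ℝ} (ha : ‖u‖ ≤ a) (i : ℕ) :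
    ‖(u + h) ^ i - u ^ i‖ ≤ (a + ‖h‖) ^ i - a ^ i := by
  induction i with
  | zero => simp
  | succ i ih =>
    calc ‖(u + h) ^ (i + 1) - u ^ (i + 1)‖ = ‖(u + h) * ((u + h) ^ i - u ^ i) + h * u ^ i‖ := by
          congr 1; ring
      _ ≤ ‖u + h‖ * ‖(u + h) ^ i - u ^ i‖ + ‖h‖ * ‖u‖ ^ i := by
          rw [← norm_mul, ← norm_pow, ← norm_mul]; exact norm_add_le _ _
      _ ≤ (a + ‖h‖) * ((a + ‖h‖) ^ i - a ^ i) + ‖h‖ * a ^ i := by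
          have h1 : ‖u + h‖ ≤ a + ‖h‖ := (norm_add_le _ _).trans (by gcongr)
          gcongr
          exact (norm_nonneg _).trans h1
      _ = _ := by ring

lemma add_pow_sub_pow_le {a t : ℝ} (ha : 1 ≤ a) (ht : 0 ≤ t) {i N : ℕ} (hi : i ≤ N) :
    (a + t) ^ i - a ^ i ≤ (a + t) ^ N - a ^ N := by
  refine monotone_nat_of_le_succ (f := fun i => (a + t) ^ i - a ^ i) (fun i => ?_) hi
  have h1 : a ^ i * (a - 1) ≤ (a + t) ^ i * (a + t - 1) := by
    gcongr
    · linarith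
    · linarith
  simp only [pow_succ]
  linarith

lemma Polynomial.exists_norm_eval_add_sub_le (P : Polynomial ℂ) : ∃ C : ℝ, 0 ≤ C ∧ ∀ u h : ℂ,
    ‖P.eval (u + h) - P.eval u‖ ≤
      C * ((1 + ‖u‖ + ‖h‖) ^ P.natDegree - (1 + ‖u‖) ^ P.natDegree) := by
  refine ⟨∑ i ∈ Finset.range (P.natDegree + 1), ‖P.coeff i‖,
    Finset.sum_nonneg fun i _ => norm_nonneg _, fun u h => ?_⟩
  rw [Polynomial.eval_eq_sum_range, Polynomial.eval_eq_sum_range, ← Finset.sum_sub_distrib,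
    Finset.sum_mul]
  refine (norm_sum_le _ _).trans (Finset.sum_le_sum fun i hi => ?_)
  rw [← mul_sub, norm_mul]
  gcongr
  refine (norm_add_pow_sub_pow_le (a := 1 + ‖u‖) (by linarith) i).trans ?_
  exact add_pow_sub_pow_le (by linarith [norm_nonneg u]) (norm_nonneg h)
    (Nat.lt_succ_iff.1 (Finset.mem_range.1 hi))

lemma Polynomial.exists_norm_eval_le (P : Polynomial ℂ) : ∃ C : ℝ, 0 ≤ C ∧ ∀ u : ℂ,
    ‖P.eval u‖ ≤ C * (1 + ‖u‖) ^ P.natDegree := by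
  obtain ⟨C, hC, h⟩ := P.exists_norm_eval_add_sub_le
  refine ⟨‖P.eval 0‖ + C, by positivity, fun u => ?_⟩
  have h1 := h 0 u
  rw [zero_add, norm_zero, add_zero, one_pow] at h1
  have h2 : (1 : ℝ) ≤ (1 + ‖u‖) ^ P.natDegree := one_le_pow₀ (by linarith [norm_nonneg u])
  have h3 := norm_le_norm_add_norm_sub' (P.eval u) (P.eval 0)
  nlinarith [norm_nonneg (P.eval 0)]

/-- The increments of a polynomial of degree `N` are controlled by a small multiple of the size of
its argument and a large multiple of the size of the increment, both to the power `N`. -/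
lemma Polynomial.exists_norm_eval_sub_le (P : Polynomial ℂ) {ε : ℝ} (hε : 0 < ε) :
    ∃ C : ℝ, 0 ≤ C ∧ ∀ u v : ℂ, ‖P.eval v - P.eval u‖ ≤
      ε * (1 + ‖u‖) ^ P.natDegree + C * ‖v - u‖ ^ P.natDegree := by
  obtain ⟨C, hC, h⟩ := P.exists_norm_eval_add_sub_le
  set N := P.natDegree
  obtain ⟨δ, hδε, hδ⟩ : ∃ δ : ℝ, C * ((1 + δ) ^ N - 1) < ε ∧ 0 < δ := by
    have hc : Continuous fun δ : ℝ => C * ((1 + δ) ^ N - 1) := by fun_prop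
    have h1 := (hc.tendsto 0).eventually_lt_const (show C * ((1 + 0) ^ N - 1) < ε by simpa using hε)
    exact ((h1.filter_mono nhdsWithin_le_nhds).and
      (self_mem_nhdsWithin : Ioi (0 : ℝ) ∈ nhdsWithin 0 (Ioi 0))).exists
  refine ⟨C * (1 / δ + 1) ^ N, by positivity, fun u v => ?_⟩
  have h1 := h u (v - u)
  rw [add_sub_cancel] at h1
  refine h1.trans ?_
  set w := 1 + ‖u‖ with hw
  set t := ‖v - u‖ with ht
  have hw0 : 0 < w := by positivity
  rcases le_total t (δ * w) with htw | htw
  · calc C * ((w + t) ^ N - w ^ N) ≤ C * ((w + δ * w) ^ N - w ^ N) := by gcongr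
      _ = C * ((1 + δ) ^ N - 1) * w ^ N := by
        rw [show w + δ * w = (1 + δ) * w by ring, mul_pow]; ring
      _ ≤ ε * w ^ N := by gcongr
      _ ≤ _ := le_add_of_nonneg_right (by positivity)
  · have hwt : w ≤ 1 / δ * t := by
      rw [one_div, inv_mul_eq_div, le_div_iff₀ hδ, mul_comm]; exact htw
    calc C * ((w + t) ^ N - w ^ N) ≤ C * (1 / δ * t + t) ^ N := by
          gcongr
          have h2 : (w + t) ^ N ≤ (1 / δ * t + t) ^ N := by gcongr
          linarith [pow_pos hw0 N]
      _ = C * (1 / δ + 1) ^ N * t ^ N := by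
        rw [show 1 / δ * t + t = (1 / δ + 1) * t by ring, mul_pow]; ring
      _ ≤ _ := le_add_of_nonneg_left (by positivity)

lemma Polynomial.exists_pow_natDegree_le {P : Polynomial ℂ} (hP : 1 ≤ P.natDegree) :
    ∃ C : ℝ, 0 ≤ C ∧ ∀ u : ℂ, ‖u‖ ^ P.natDegree ≤ C * (1 + ‖P.eval u‖) := by
  obtain ⟨C, hC, hQ⟩ := P.eraseLead.exists_norm_eval_le
  have hP0 : P ≠ 0 := by rintro rfl; simp at hP
  have ha : 0 < ‖P.leadingCoeff‖ := by simpa using hP0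
  obtain ⟨M, hM⟩ : ∃ M, P.natDegree = M + 1 := ⟨P.natDegree - 1, by omega⟩
  have hdeg : P.eraseLead.natDegree ≤ M :=
    P.eraseLead_natDegree_le.trans (by omega)
  have hsplit : ∀ u : ℂ, P.eval u = P.eraseLead.eval u + P.leadingCoeff * u ^ (M + 1) := fun u => by
    conv_lhs => rw [← P.eraseLead_add_C_mul_X_pow]
    simp [hM]
  set a := ‖P.leadingCoeff‖ with ha'
  -- Beyond radius `K` the lower-order terms are at most half of the leading term.
  set K : ℝ := 1 + 2 * C * 2 ^ M / a with hK
  have hK1 : 1 ≤ K := by rw [hK]; linarith [show 0 ≤ 2 * C * 2 ^ M / a by positivity]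
  have hlow : ∀ x : ℝ, 0 ≤ x → C * (1 + x) ^ M ≤ a / 2 * x ^ (M + 1) + C * (1 + K) ^ M := by
    intro x hx
    rcases le_total x K with h | h
    · calc C * (1 + x) ^ M ≤ C * (1 + K) ^ M := by gcongr
        _ ≤ _ := le_add_of_nonneg_left (by positivity)
    · have hx1 : 1 ≤ x := hK1.trans h
      have h3 : C * 2 ^ M ≤ a / 2 * x := by
        have h4 : 2 * C * 2 ^ M / a ≤ x := by linarith
        rw [div_le_iff₀ ha] at h4
        linarith
      calc C * (1 + x) ^ M ≤ C * (2 * x) ^ M := by gcongr; linarith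
        _ = C * 2 ^ M * x ^ M := by rw [mul_pow]; ring
        _ ≤ a / 2 * x * x ^ M := by gcongr
        _ = a / 2 * x ^ (M + 1) := by ring
        _ ≤ _ := le_add_of_nonneg_right (by positivity)
  refine ⟨2 / a * (1 + C * (1 + K) ^ M), by positivity, fun u => ?_⟩
  have h1 : a * ‖u‖ ^ (M + 1) ≤ ‖P.eval u‖ + C * (1 + ‖u‖) ^ M := by
    have h2 : P.leadingCoeff * u ^ (M + 1) = P.eval u - P.eraseLead.eval u := by
      rw [hsplit]; ring
    rw [ha', ← norm_pow, ← norm_mul, h2]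
    refine (norm_sub_le _ _).trans (add_le_add le_rfl ((hQ u).trans ?_))
    gcongr
    linarith [norm_nonneg u]
  have h5 := hlow ‖u‖ (norm_nonneg u)
  have h6 : a * ‖u‖ ^ (M + 1) ≤ 2 * (1 + C * (1 + K) ^ M) * (1 + ‖P.eval u‖) := by
    have h7 : 0 ≤ C * (1 + K) ^ M := by positivity
    nlinarith [norm_nonneg (P.eval u)]
  rw [hM, div_mul_eq_mul_div, div_mul_eq_mul_div, le_div_iff₀ ha]
  linarith

/-! ### Superposition by polynomials -/

lemma ENNReal.exists_mul_ofReal_rpow_lt {M τ : ENNReal} (hM : M ≠ ⊤) (hτ : τ ≠ 0) {s : ℝ}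
    (hs : 0 < s) : ∃ e : ℝ, 0 < e ∧ M * ENNReal.ofReal e ^ s < τ := by
  have hc : Continuous fun e : ℝ => M * ENNReal.ofReal e ^ s :=
    (ENNReal.continuous_const_mul hM).comp
      (ENNReal.continuous_rpow_const.comp ENNReal.continuous_ofReal)
  have h1 := (hc.tendsto 0).eventually_lt_const
    (show M * ENNReal.ofReal 0 ^ s < τ by simpa [hs] using pos_iff_ne_zero.2 hτ)
  obtain ⟨e, he, he0⟩ := ((h1.filter_mono nhdsWithin_le_nhds).and
      (self_mem_nhdsWithin : Ioi (0 : ℝ) ∈ nhdsWithin 0 (Ioi 0))).exists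
  exact ⟨e, he0, he⟩

lemma enorm_le_ofReal_mul_pow {u v : ℂ} {C : ℝ} (hC : 0 ≤ C) {N : ℕ}
    (h : ‖v‖ ≤ C * (1 + ‖u‖) ^ N) : ‖v‖ₑ ≤ ENNReal.ofReal C * (1 + ‖u‖ₑ) ^ N := by
  rw [← ofReal_norm, ← ofReal_norm, ← ENNReal.ofReal_one,
    ← ENNReal.ofReal_add zero_le_one (norm_nonneg _), ← ENNReal.ofReal_pow (by positivity),
    ← ENNReal.ofReal_mul hC]
  exact ENNReal.ofReal_le_ofReal h

/-- The embedding of `A^p_α` into `A^(Nq)_β`, in the form needed for polynomials of degree `N`. -/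
lemma exists_lintegral_one_add_pow_le (hn : 1 ≤ n) {p q α β : ℝ} (hp : 0 < p) (hq : 0 < q)
    (hα : -1 < α) (hβ : -1 < β) {N : ℕ}
    (h1 : α ≤ β → N * q * (n + 1 + α) ≤ p * (n + 1 + β))
    (h2 : β < α → N * q * (α + 1) < p * (β + 1)) :
    ∃ K L : ENNReal, K ≠ ⊤ ∧ L ≠ ⊤ ∧ ∀ f : Cn n → ℂ, DifferentiableOn ℂ f (unitBall n) →
      ∫⁻ z, ‖f z‖ₑ ^ p ∂weightedMeasure n α ≠ ⊤ →
      ∫⁻ z, ((1 + ‖f z‖ₑ) ^ N) ^ q ∂weightedMeasure n β ≤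
        K + L * (∫⁻ z, ‖f z‖ₑ ^ p ∂weightedMeasure n α) ^ (N * q / p) := by
  have hfin := isFiniteMeasure_weightedMeasure hn hβ
  rcases Nat.eq_zero_or_pos N with rfl | hN
  · exact ⟨weightedMeasure n β univ, 0, measure_ne_top _ _, by simp, fun f _ _ => by simp⟩
  have hr : 0 < N * q := mul_pos (by exact_mod_cast hN) hq
  obtain ⟨C, hC, hemb⟩ := lintegral_rpow_le hn hp hr hα h1 h2
  refine ⟨2 ^ (N * q) * weightedMeasure n β univ, 2 ^ (N * q) * C,
    ENNReal.mul_ne_top (by simp) (measure_ne_top _ _), ENNReal.mul_ne_top (by simp) hC,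
    fun f hf hfi => ?_⟩
  have hpow : ∀ x : ENNReal, ((1 + x) ^ N) ^ q = (1 + x) ^ (N * q) := fun x => by
    rw [← ENNReal.rpow_natCast, ← ENNReal.rpow_mul]
  calc ∫⁻ z, ((1 + ‖f z‖ₑ) ^ N) ^ q ∂weightedMeasure n β
      ≤ ∫⁻ z, 2 ^ (N * q) * (1 + ‖f z‖ₑ ^ (N * q)) ∂weightedMeasure n β := by
        refine lintegral_mono fun z => ?_
        rw [hpow]
        simpa using ENNReal.add_rpow_le_two_rpow_mul 1 ‖f z‖ₑ hr.le
    _ = 2 ^ (N * q) * (weightedMeasure n β univ +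
          ∫⁻ z, ‖f z‖ₑ ^ (N * q) ∂weightedMeasure n β) := by
        rw [lintegral_const_mul' _ _ (by simp), lintegral_add_left measurable_const]
        simp
    _ ≤ 2 ^ (N * q) * (weightedMeasure n β univ +
          C * (∫⁻ z, ‖f z‖ₑ ^ p ∂weightedMeasure n α) ^ (N * q / p)) := by
        gcongr
        exact hemb f hf hfi
    _ = _ := by ring

lemma exists_lintegral_polynomial_le (hn : 1 ≤ n) {p q α β : ℝ} (hp : 0 < p) (hq : 0 < q)
    (hα : -1 < α) (hβ : -1 < β) {P : Polynomial ℂ}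
    (h1 : α ≤ β → P.natDegree * q * (n + 1 + α) ≤ p * (n + 1 + β))
    (h2 : β < α → P.natDegree * q * (α + 1) < p * (β + 1)) :
    ∃ K L : ENNReal, K ≠ ⊤ ∧ L ≠ ⊤ ∧ ∀ f : Cn n → ℂ, DifferentiableOn ℂ f (unitBall n) →
      ∫⁻ z, ‖f z‖ₑ ^ p ∂weightedMeasure n α ≠ ⊤ →
      ∫⁻ z, ‖P.eval (f z)‖ₑ ^ q ∂weightedMeasure n β ≤
        K + L * (∫⁻ z, ‖f z‖ₑ ^ p ∂weightedMeasure n α) ^ (P.natDegree * q / p) := by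
  obtain ⟨K, L, hK, hL, h⟩ := exists_lintegral_one_add_pow_le hn hp hq hα hβ h1 h2
  obtain ⟨C, hC, hP⟩ := P.exists_norm_eval_le
  have htop : ENNReal.ofReal C ^ q ≠ ⊤ := ENNReal.rpow_ne_top_of_nonneg hq.le ENNReal.ofReal_ne_top
  refine ⟨ENNReal.ofReal C ^ q * K, ENNReal.ofReal C ^ q * L, ENNReal.mul_ne_top htop hK,
    ENNReal.mul_ne_top htop hL, fun f hf hfi => ?_⟩
  calc ∫⁻ z, ‖P.eval (f z)‖ₑ ^ q ∂weightedMeasure n β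
      ≤ ∫⁻ z, ENNReal.ofReal C ^ q * ((1 + ‖f z‖ₑ) ^ P.natDegree) ^ q ∂weightedMeasure n β := by
        refine lintegral_mono fun z => ?_
        rw [← ENNReal.mul_rpow_of_nonneg _ _ hq.le]
        exact ENNReal.rpow_le_rpow (enorm_le_ofReal_mul_pow hC (hP (f z))) hq.le
    _ = ENNReal.ofReal C ^ q * ∫⁻ z, ((1 + ‖f z‖ₑ) ^ P.natDegree) ^ q ∂weightedMeasure n β :=
        lintegral_const_mul' _ _ htop
    _ ≤ ENNReal.ofReal C ^ q *
          (K + L * (∫⁻ z, ‖f z‖ₑ ^ p ∂weightedMeasure n α) ^ (P.natDegree * q / p)) := by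
        gcongr
        exact h f hf hfi
    _ = _ := by ring

lemma superposition_eq {φ : ℂ → ℂ} {P : Polynomial ℂ} (hφ : ∀ u, φ u = P.eval u) (f : Cn n → ℂ) :
    superposition φ f = fun z => P.eval (f z) := funext fun z => hφ (f z)

lemma mapsTo_superposition_polynomial (hn : 1 ≤ n) {p q α β : ℝ} (hp : 0 < p) (hq : 0 < q)
    (hα : -1 < α) (hβ : -1 < β) {φ : ℂ → ℂ} {P : Polynomial ℂ} (hφ : ∀ u, φ u = P.eval u)
    (h1 : α ≤ β → P.natDegree * q * (n + 1 + α) ≤ p * (n + 1 + β))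
    (h2 : β < α → P.natDegree * q * (α + 1) < p * (β + 1)) :
    MapsTo (superposition φ) (bergmanSpace n p α) (bergmanSpace n q β) := by
  obtain ⟨K, L, hK, hL, h⟩ := exists_lintegral_polynomial_le hn hp hq hα hβ h1 h2
  intro f hf
  obtain ⟨hfd, hfi⟩ := (mem_bergmanSpace_iff hp).1 hf
  rw [superposition_eq hφ, mem_bergmanSpace_iff hq]
  refine ⟨P.differentiable.comp_differentiableOn hfd, ne_top_of_le_ne_top ?_ (h f hfd hfi)⟩
  exact ENNReal.add_ne_top.2 ⟨hK, ENNReal.mul_ne_top hL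
    (ENNReal.rpow_ne_top_of_nonneg (by positivity) hfi)⟩

lemma lintegral_rpow_le_of_bergmanNorm_le {p α R : ℝ} (hp : 0 < p) {f : Cn n → ℂ}
    (hf : f ∈ bergmanSpace n p α) (hR : bergmanNorm n p α f ≤ R) :
    ∫⁻ z, ‖f z‖ₑ ^ p ∂weightedMeasure n α ≤ ENNReal.ofReal R ^ p := by
  have hfi := ((mem_bergmanSpace_iff hp).1 hf).2
  rw [bergmanNorm_eq hp] at hR
  have h1 := ENNReal.ofReal_le_ofReal hR
  rw [ENNReal.ofReal_toReal (ENNReal.rpow_ne_top_of_nonneg (by positivity) hfi)] at h1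
  calc ∫⁻ z, ‖f z‖ₑ ^ p ∂weightedMeasure n α
      = ((∫⁻ z, ‖f z‖ₑ ^ p ∂weightedMeasure n α) ^ (1 / p)) ^ p := by
        rw [← ENNReal.rpow_mul, one_div_mul_cancel hp.ne', ENNReal.rpow_one]
    _ ≤ _ := ENNReal.rpow_le_rpow h1 hp.le

lemma isBoundedBergman_superposition_polynomial (hn : 1 ≤ n) {p q α β : ℝ} (hp : 0 < p)
    (hq : 0 < q) (hα : -1 < α) (hβ : -1 < β) {φ : ℂ → ℂ} {P : Polynomial ℂ}
    (hφ : ∀ u, φ u = P.eval u)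
    (h1 : α ≤ β → P.natDegree * q * (n + 1 + α) ≤ p * (n + 1 + β))
    (h2 : β < α → P.natDegree * q * (α + 1) < p * (β + 1)) :
    IsBoundedBergman n p α q β (superposition φ) := by
  obtain ⟨K, L, hK, hL, h⟩ := exists_lintegral_polynomial_le hn hp hq hα hβ h1 h2
  intro R
  set M : ENNReal := K + L * (ENNReal.ofReal R ^ p) ^ (P.natDegree * q / p) with hM
  have hMtop : M ≠ ⊤ := ENNReal.add_ne_top.2 ⟨hK, ENNReal.mul_ne_top hL
    (ENNReal.rpow_ne_top_of_nonneg (by positivity)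
      (ENNReal.rpow_ne_top_of_nonneg hp.le ENNReal.ofReal_ne_top))⟩
  refine ⟨(M ^ (1 / q)).toReal, fun f hf hfR => ?_⟩
  obtain ⟨hfd, hfi⟩ := (mem_bergmanSpace_iff hp).1 hf
  rw [bergmanNorm_eq hq, superposition_eq hφ]
  refine ENNReal.toReal_mono (ENNReal.rpow_ne_top_of_nonneg (by positivity) hMtop)
    (ENNReal.rpow_le_rpow ((h f hfd hfi).trans ?_) (by positivity))
  rw [hM]
  gcongr
  exact lintegral_rpow_le_of_bergmanNorm_le hp hf hfR

lemma isContinuousBergman_superposition_polynomial (hn : 1 ≤ n) {p q α β : ℝ} (hp : 0 < p)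
    (hq : 0 < q) (hα : -1 < α) (hβ : -1 < β) {φ : ℂ → ℂ} {P : Polynomial ℂ}
    (hφ : ∀ u, φ u = P.eval u)
    (h1 : α ≤ β → P.natDegree * q * (n + 1 + α) ≤ p * (n + 1 + β))
    (h2 : β < α → P.natDegree * q * (α + 1) < p * (β + 1)) :
    IsContinuousBergman n p α q β (superposition φ) := by
  intro f hf ε hε
  rcases Nat.eq_zero_or_pos P.natDegree with hN | hN
  · refine ⟨1, one_pos, fun g _ _ => ?_⟩
    have h0 : superposition φ g - superposition φ f = 0 := by
      rw [superposition_eq hφ, superposition_eq hφ, Polynomial.eq_C_of_natDegree_eq_zero hN]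
      ext z
      simp
    rw [h0, bergmanNorm]
    simpa using hε
  obtain ⟨K, L, hK, hL, hone⟩ := exists_lintegral_one_add_pow_le hn hp hq hα hβ h1 h2
  have hr : 0 < P.natDegree * q := mul_pos (by exact_mod_cast hN) hq
  obtain ⟨E, hE, hemb⟩ := lintegral_rpow_le hn hp hr hα h1 h2
  obtain ⟨hfd, hfi⟩ := (mem_bergmanSpace_iff hp).1 hf
  set N := P.natDegree
  set M : ENNReal := ∫⁻ z, ((1 + ‖f z‖ₑ) ^ N) ^ q ∂weightedMeasure n β with hM
  have hMtop : M ≠ ⊤ := ne_top_of_le_ne_top (ENNReal.add_ne_top.2 ⟨hK, ENNReal.mul_ne_top hL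
    (ENNReal.rpow_ne_top_of_nonneg (by positivity) hfi)⟩) (hone f hfd hfi)
  have h2q : (2 : ENNReal) ^ q ≠ ⊤ := by simp
  set τ : ENNReal := ENNReal.ofReal ε ^ q with hτ
  have hτ0 : τ ≠ 0 := by
    simp only [hτ, ne_eq, ENNReal.rpow_eq_zero_iff, ENNReal.ofReal_eq_zero, not_le.2 hε, false_and,
      ENNReal.ofReal_ne_top, or_self, not_false_eq_true]
  have hτ2 : τ / 2 ≠ 0 := (ENNReal.half_pos hτ0).ne'
  obtain ⟨e, he, heτ⟩ := ENNReal.exists_mul_ofReal_rpow_lt (ENNReal.mul_ne_top h2q hMtop) hτ2 hq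
  obtain ⟨C, hC, hP⟩ := P.exists_norm_eval_sub_le he
  have hCq : ENNReal.ofReal C ^ q ≠ ⊤ := ENNReal.rpow_ne_top_of_nonneg hq.le ENNReal.ofReal_ne_top
  obtain ⟨δ, hδ, hδτ⟩ := ENNReal.exists_mul_ofReal_rpow_lt
    (ENNReal.mul_ne_top h2q (ENNReal.mul_ne_top hCq hE)) hτ2 hr
  refine ⟨δ, hδ, fun g hg hgf => ?_⟩
  have hsub : g - f ∈ bergmanSpace n p α := ⟨hg.1.sub hf.1, hg.2.sub hf.2⟩
  obtain ⟨hsd, hsi⟩ := (mem_bergmanSpace_iff hp).1 hsub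
  have hpt : ∀ z, ‖P.eval (g z) - P.eval (f z)‖ₑ ^ q ≤
      2 ^ q * (ENNReal.ofReal e ^ q * ((1 + ‖f z‖ₑ) ^ N) ^ q +
        ENNReal.ofReal C ^ q * ‖(g - f) z‖ₑ ^ (N * q)) := by
    intro z
    have h3 : ‖P.eval (g z) - P.eval (f z)‖ₑ ≤
        ENNReal.ofReal e * (1 + ‖f z‖ₑ) ^ N + ENNReal.ofReal C * ‖(g - f) z‖ₑ ^ N := by
      rw [← ofReal_norm, ← ofReal_norm, ← ofReal_norm, ← ENNReal.ofReal_one,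
        ← ENNReal.ofReal_add zero_le_one (norm_nonneg _), ← ENNReal.ofReal_pow (by positivity),
        ← ENNReal.ofReal_pow (by positivity), ← ENNReal.ofReal_mul hC, ← ENNReal.ofReal_mul he.le,
        ← ENNReal.ofReal_add (by positivity) (by positivity)]
      exact ENNReal.ofReal_le_ofReal (hP (f z) (g z))
    refine (ENNReal.rpow_le_rpow h3 hq.le).trans ?_
    refine (ENNReal.add_rpow_le_two_rpow_mul _ _ hq.le).trans_eq ?_
    rw [ENNReal.mul_rpow_of_nonneg _ _ hq.le, ENNReal.mul_rpow_of_nonneg _ _ hq.le,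
      ← ENNReal.rpow_natCast ‖(g - f) z‖ₑ, ← ENNReal.rpow_mul ‖(g - f) z‖ₑ]
  have hfm := (aestronglyMeasurable_weightedMeasure hfd β).enorm
  have hint : ∫⁻ z, ‖P.eval (g z) - P.eval (f z)‖ₑ ^ q ∂weightedMeasure n β < τ := by
    calc ∫⁻ z, ‖P.eval (g z) - P.eval (f z)‖ₑ ^ q ∂weightedMeasure n β
        ≤ ∫⁻ z, 2 ^ q * (ENNReal.ofReal e ^ q * ((1 + ‖f z‖ₑ) ^ N) ^ q +
            ENNReal.ofReal C ^ q * ‖(g - f) z‖ₑ ^ (N * q)) ∂weightedMeasure n β :=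
          lintegral_mono hpt
      _ = 2 ^ q * (ENNReal.ofReal e ^ q * M + ENNReal.ofReal C ^ q *
            ∫⁻ z, ‖(g - f) z‖ₑ ^ (N * q) ∂weightedMeasure n β) := by
          rw [lintegral_const_mul' _ _ h2q, lintegral_add_left', lintegral_const_mul' _ _
            (ENNReal.rpow_ne_top_of_nonneg hq.le ENNReal.ofReal_ne_top),
            lintegral_const_mul' _ _ hCq]
          exact (((hfm.const_add 1).pow_const N).pow_const q).const_mul _
      _ ≤ 2 ^ q * (ENNReal.ofReal e ^ q * M + ENNReal.ofReal C ^ q *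
            (E * ENNReal.ofReal δ ^ (N * q))) := by
          gcongr
          refine (hemb _ hsd hsi).trans ?_
          gcongr
          calc (∫⁻ z, ‖(g - f) z‖ₑ ^ p ∂weightedMeasure n α) ^ (N * q / p)
              ≤ (ENNReal.ofReal δ ^ p) ^ (N * q / p) := by
                gcongr
                exact lintegral_rpow_le_of_bergmanNorm_le hp hsub hgf.le
            _ = ENNReal.ofReal δ ^ (N * q) := by
                rw [← ENNReal.rpow_mul, mul_div_cancel₀ _ hp.ne']
      _ = 2 ^ q * M * ENNReal.ofReal e ^ q +
            2 ^ q * (ENNReal.ofReal C ^ q * E) * ENNReal.ofReal δ ^ (N * q) := by ring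
      _ < τ / 2 + τ / 2 := ENNReal.add_lt_add heτ hδτ
      _ = τ := ENNReal.add_halves τ
  have hnorm : bergmanNorm n q β (superposition φ g - superposition φ f) =
      ((∫⁻ z, ‖P.eval (g z) - P.eval (f z)‖ₑ ^ q ∂weightedMeasure n β) ^ (1 / q)).toReal := by
    rw [bergmanNorm_eq hq, superposition_eq hφ, superposition_eq hφ]
    rfl
  rw [hnorm]
  refine ENNReal.toReal_lt_of_lt_ofReal ?_
  calc (∫⁻ z, ‖P.eval (g z) - P.eval (f z)‖ₑ ^ q ∂weightedMeasure n β) ^ (1 / q)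
      < τ ^ (1 / q) := ENNReal.rpow_lt_rpow hint (by positivity)
    _ = ENNReal.ofReal ε := by
      rw [hτ, ← ENNReal.rpow_mul, mul_one_div_cancel hq.ne', ENNReal.rpow_one]

/-- If superposition by a polynomial of degree `N ≥ 1` maps `A^p_α` into `A^q_β`, then `A^p_α` is
contained in `A^(Nq)_β`. -/
lemma lintegral_rpow_natDegree_ne_top (hn : 1 ≤ n) {p q α β : ℝ} (hq : 0 < q) (hβ : -1 < β)
    {φ : ℂ → ℂ} {P : Polynomial ℂ} (hφ : ∀ u, φ u = P.eval u) (hN : 1 ≤ P.natDegree)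
    (hmaps : MapsTo (superposition φ) (bergmanSpace n p α) (bergmanSpace n q β)) {f : Cn n → ℂ}
    (hf : f ∈ bergmanSpace n p α) :
    ∫⁻ z, ‖f z‖ₑ ^ (P.natDegree * q) ∂weightedMeasure n β ≠ ⊤ := by
  have hfin := isFiniteMeasure_weightedMeasure hn hβ
  have hi := ((mem_bergmanSpace_iff hq).1 (hmaps hf)).2
  rw [superposition_eq hφ] at hi
  obtain ⟨C, hC, hP⟩ := P.exists_pow_natDegree_le hN
  have htop : ENNReal.ofReal C ^ q * 2 ^ q ≠ ⊤ := ENNReal.mul_ne_top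
    (ENNReal.rpow_ne_top_of_nonneg hq.le ENNReal.ofReal_ne_top) (by simp)
  refine ne_top_of_le_ne_top (b := ENNReal.ofReal C ^ q * 2 ^ q * (weightedMeasure n β univ +
    ∫⁻ z, ‖P.eval (f z)‖ₑ ^ q ∂weightedMeasure n β))
    (ENNReal.mul_ne_top htop (ENNReal.add_ne_top.2 ⟨measure_ne_top _ _, hi⟩)) ?_
  calc ∫⁻ z, ‖f z‖ₑ ^ (P.natDegree * q) ∂weightedMeasure n β
      ≤ ∫⁻ z, ENNReal.ofReal C ^ q * 2 ^ q * (1 + ‖P.eval (f z)‖ₑ ^ q) ∂weightedMeasure n β := by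
        refine lintegral_mono fun z => ?_
        have h1 : ‖f z‖ₑ ^ P.natDegree ≤ ENNReal.ofReal C * (1 + ‖P.eval (f z)‖ₑ) := by
          have h2 := enorm_le_ofReal_mul_pow (u := P.eval (f z)) (v := f z ^ P.natDegree) (N := 1)
            hC (by rw [norm_pow, pow_one]; exact hP (f z))
          rwa [enorm_pow, pow_one] at h2
        rw [ENNReal.rpow_mul, ENNReal.rpow_natCast, mul_assoc]
        refine (ENNReal.rpow_le_rpow h1 hq.le).trans ?_
        rw [ENNReal.mul_rpow_of_nonneg _ _ hq.le]
        gcongr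
        simpa using ENNReal.add_rpow_le_two_rpow_mul 1 ‖P.eval (f z)‖ₑ hq.le
    _ = _ := by
        rw [lintegral_const_mul' _ _ htop, lintegral_add_left measurable_const]
        simp

end

theorem corollary1p4 (n : ℕ) (hn : 1 ≤ n) (p q α β : ℝ) (hp : 0 < p) (hq : 0 < q)
    (hα : -1 < α) (hβ : -1 < β) (φ : ℂ → ℂ) :
    (MapsTo (superposition φ) (bergmanSpace n p α) (bergmanSpace n q β) ↔
      ∃ P : Polynomial ℂ, (∀ u : ℂ, φ u = P.eval u) ∧
        (α ≤ β → (P.natDegree : ℝ) ≤ p * (n + 1 + β) / (q * (n + 1 + α))) ∧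
        (β < α → (P.natDegree : ℝ) < p * (β + 1) / (q * (α + 1)))) ∧
    (MapsTo (superposition φ) (bergmanSpace n p α) (bergmanSpace n q β) →
      IsBoundedBergman n p α q β (superposition φ) ∧
      IsContinuousBergman n p α q β (superposition φ)) := by
  have hn0 : (0 : ℝ) ≤ n := n.cast_nonneg
  have hnα : 0 < q * (n + 1 + α) := mul_pos hq (by linarith)
  have hα1 : 0 < q * (α + 1) := mul_pos hq (by linarith)
  have hle : ∀ N : ℕ, (N : ℝ) ≤ p * (n + 1 + β) / (q * (n + 1 + α)) →
      N * q * (n + 1 + α) ≤ p * (n + 1 + β) := fun N h => by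
    rw [le_div_iff₀ hnα] at h
    linarith
  have hlt : ∀ N : ℕ, (N : ℝ) < p * (β + 1) / (q * (α + 1)) →
      N * q * (α + 1) < p * (β + 1) := fun N h => by
    rw [lt_div_iff₀ hα1] at h
    linarith
  have hnec : MapsTo (superposition φ) (bergmanSpace n p α) (bergmanSpace n q β) →
      ∃ P : Polynomial ℂ, (∀ u : ℂ, φ u = P.eval u) ∧
        (α ≤ β → (P.natDegree : ℝ) ≤ p * (n + 1 + β) / (q * (n + 1 + α))) ∧
        (β < α → (P.natDegree : ℝ) < p * (β + 1) / (q * (α + 1))) := by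
    intro h
    obtain ⟨P, hφ, hdeg⟩ := exists_polynomial_of_mapsTo hn hp hq hα hβ h
    refine ⟨P, hφ, fun _ => hdeg, fun hβα => ?_⟩
    by_contra! hcon
    have hpos : 0 < p * (β + 1) / (q * (α + 1)) := div_pos (mul_pos hp (by linarith)) hα1
    have hN : 1 ≤ P.natDegree := by exact_mod_cast hpos.trans_le hcon
    have hr : 0 < P.natDegree * q := mul_pos (hpos.trans_le hcon) hq
    have hrp : P.natDegree * q < p := by
      have h1 := hle _ hdeg
      have h2 : p * (n + 1 + β) < p * (n + 1 + α) := by gcongr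
      exact lt_of_mul_lt_mul_right (h1.trans_lt h2) (by linarith)
    have hcrit : p * (β + 1) ≤ P.natDegree * q * (α + 1) := by
      rw [div_le_iff₀ hα1] at hcon
      linarith
    obtain ⟨f, hf, hinf⟩ := exists_mem_bergmanSpace_lintegral_eq_top hn hr hrp hα hcrit
    exact lintegral_rpow_natDegree_ne_top hn hq hβ hφ hN h hf hinf
  refine ⟨⟨hnec, ?_⟩, fun h => ?_⟩
  · rintro ⟨P, hφ, h1, h2⟩
    exact mapsTo_superposition_polynomial hn hp hq hα hβ hφ (fun h => hle _ (h1 h))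
      fun h => hlt _ (h2 h)
  · obtain ⟨P, hφ, h1, h2⟩ := hnec h
    exact ⟨isBoundedBergman_superposition_polynomial hn hp hq hα hβ hφ (fun h => hle _ (h1 h))
      fun h => hlt _ (h2 h), isContinuousBergman_superposition_polynomial hn hp hq hα hβ hφ
        (fun h => hle _ (h1 h)) fun h => hlt _ (h2 h)⟩
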